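/- **Conventions.** Let $M^2$ be a real analytic $2$-manifold. For a positive semi-definite real analytic symmetric $2$-tensor $ds^2=\langle\ ,\ \rangle$ on $M^2$, a point is *regular* if $ds^2$ is positive definite there and *semi-definite* otherwise. A semi-definite point $p$ is *admissible* if $$\Theta(X,Y,Z)=\tfrac12\bigl(X\langle Y,Z\rangle+Y\langle X,Z\rangle-Z\langle X,Y\rangle+\langle[X,Y],Z\rangle-\langle[X,Z],Y\rangle-\langle[Y,Z],X\rangle\bigr)$$ vanishes at $p$ for all real analytic vector fields $X,Y,Z$ near $p$ with $\langle Z(p),\cdot\rangle=0$. The tensor $ds^2=E\,du^2+2F\,du\,dv+G\,dv^2$ is a *Kossowski metric* if every semi-definite point $p$ is admissible and has a coordinate neighborhood $(U;u,v)$ with a real analytic function $\lambda$ on $U$ such that $EG-F^2=\lambda^2$ on $U$ and $(\lambda_u(p),\lambda_v(p))\neq(0,0)$. With $K$ the Gaussian curvature of $ds^2$ on the regular set, the $2$-form $\Omega=K\lambda\,du\wedge dv$ (defined up to sign) extends analytically across the semi-definite points; a semi-definite point $p$ is *non-parabolic* if $\Omega(p)\neq0$. A real analytic map germ $f:(M^2,p)\to\mathbb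 R^3$ is a *frontal germ* if there is a real analytic unit vector field $\nu$ along $f$ orthogonal to the image of $df$ at every point near $p$ (a *unit normal vector field*); it is a *wave front* if $(f,\nu)$ is an immersion at $p$. For a curve $\gamma$ for which $\hat\gamma=f\circ\gamma$ is regular, the *normal curvature* is $\kappa_n=\hat\gamma''\cdot(\nu\circ\gamma)/|\hat\gamma'|^2$, and the torsion of $\hat\gamma$ is $\det(\hat\gamma',\hat\gamma'',\hat\gamma''')/|\hat\gamma'\times\hat\gamma''|^2$. At a semi-definite point $p$ of its first fundamental form, the *limiting normal curvature* of $f$ is the value at $p$ of $f_{uu}\cdot\nu/|f_u|^2$ in any coordinates with $f_v(p)=0$. Two germs $f_1,f_2$ at $p$ are *congruent* if $f_1=\Phi\circ f_2\circ\varphi$ for an isometry $\Phi$ of $\mathbb R^3$ (orientation reversing ones are allowed) and a real analytic diffeomorphism germ $\varphi$ of $M^2$ fixing $p$; they are *strongly congruent* if one can take $\varphi=\mathrm{id}$. **Theorem B.** Let $ds^2$ be a real analytic Kossowski metric on a real analytic $2$-manifold $M^2$, and let $\omega(t),\mu(t)$ be two germs of real analytic functions at $t=0$. Let $p\in M^2$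 and let $\gamma(t)$ be a real analytic regular curve in $M^2$ with $\gamma(0)=p$ and $ds^2(\gamma'(0),\gamma'(0))>0$. Then there exists a real analytic frontal germ $f:(M^2,p)\to\mathbb R^3$ such that 1. $ds^2$ is the first fundamental form of $f$ near $p$; 2. for a suitable unit normal vector field $\nu$, the normal curvature function germ of $f$ along $\gamma$ is $e^{\omega(t)}$; 3. $\mu(t)$ is the torsion function germ of $\hat\gamma=f\circ\gamma$; 4. if $p$ is a regular point of $ds^2$, then $f$ is an immersion at $p$; if $p$ is a non-parabolic semi-definite point of $ds^2$, then $f$ is a wave front at $p$ with non-zero limiting normal curvature at $p$. Every real analytic frontal germ $f$ at $p$ with (1), (2), (3) also satisfies (4). There are at most two strong congruence classes, and hence at most two congruence classes, of such germs $f$. If $\mu$ vanishes identically, then all such $f$ belong to a single strong congruence class (hence to a single congruence class). -/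

import Mathlib

open scoped Manifold ContDiff Topology

namespace KossowskiMetrics

/-- The model of real analytic `2`-manifolds. -/
abbrev Plane : Type := EuclideanSpace ℝ (Fin 2)

/-- Euclidean `3`-space. -/
abbrev Space : Type := EuclideanSpace ℝ (Fin 3)

/-! ### Calculus in a coordinate plane -/

/-- The coordinate vector `∂_u` (`i = 0`) or `∂_v` (`i = 1`). -/
noncomputable def coordVec (i : Fin 2) : Plane := EuclideanSpace.single i 1

/-- The partial derivative `∂_u F` (`i = 0`) or `∂_v F` (`i = 1`). -/
noncomputable def pder {V : Type*} [NormedAddCommGroup V] [NormedSpace ℝ V]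
    (i : Fin 2) (F : Plane → V) (x : Plane) : V :=
  fderiv ℝ F x (coordVec i)

/-- A field of bilinear forms on an open part of the plane. -/
abbrev PlaneForm : Type := Plane → Plane → Plane → ℝ

/-- The Kossowski pseudo-connection
`Θ(X,Y,Z) = ½ (X⟨Y,Z⟩ + Y⟨X,Z⟩ - Z⟨X,Y⟩ + ⟨[X,Y],Z⟩ - ⟨[X,Z],Y⟩ - ⟨[Y,Z],X⟩)`
of a field of bilinear forms `G`, at the point `x`. -/
noncomputable def pseudoConnection (G : PlaneForm) (X Y Z : Plane → Plane) (x : Plane) : ℝ :=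
  (1 / 2) *
    (fderiv ℝ (fun y => G y (Y y) (Z y)) x (X x)
      + fderiv ℝ (fun y => G y (X y) (Z y)) x (Y x)
      - fderiv ℝ (fun y => G y (X y) (Y y)) x (Z x)
      + G x (VectorField.lieBracket ℝ X Y x) (Z x)
      - G x (VectorField.lieBracket ℝ X Z x) (Y x)
      - G x (VectorField.lieBracket ℝ Y Z x) (X x))

/-- `x` is admissible for `G`: the pseudo-connection `Θ(X,Y,Z)` vanishes at `x` for all
vector fields `X, Y, Z` that are analytic at `x` and such that `Z x` is in the radical of `G x`. -/
def IsAdmissibleAt (G : PlaneForm) (x : Plane) : Prop :=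
  ∀ X Y Z : Plane → Plane, AnalyticAt ℝ X x → AnalyticAt ℝ Y x → AnalyticAt ℝ Z x →
    (∀ w, G x (Z x) w = 0) → pseudoConnection G X Y Z x = 0

/-- The coefficient `E = G(∂_u, ∂_u)`. -/
noncomputable def coeffE (G : PlaneForm) (x : Plane) : ℝ := G x (coordVec 0) (coordVec 0)

/-- The coefficient `F = G(∂_u, ∂_v)`. -/
noncomputable def coeffF (G : PlaneForm) (x : Plane) : ℝ := G x (coordVec 0) (coordVec 1)

/-- The coefficient `G = G(∂_v, ∂_v)`. -/
noncomputable def coeffG (G : PlaneForm) (x : Plane) : ℝ := G x (coordVec 1) (coordVec 1)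

/-- The determinant `EG - F²`. -/
noncomputable def discr (G : PlaneForm) (x : Plane) : ℝ :=
  coeffE G x * coeffG G x - coeffF G x ^ 2

/-- The Gaussian curvature of `E du² + 2F du dv + G dv²` (Brioschi's formula); it is meaningful
where the form is positive definite. -/
noncomputable def gaussCurvature (G : PlaneForm) (x : Plane) : ℝ :=
  let E := coeffE G
  let F := coeffF G
  let H := coeffG G
  (Matrix.det
      !![-(pder 1 (pder 1 E) x) / 2 + pder 0 (pder 1 F) x - pder 0 (pder 0 H) x / 2,
          pder 0 E x / 2, pder 0 F x - pder 1 E x / 2;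
         pder 1 F x - pder 0 H x / 2, E x, F x;
         pder 1 H x / 2, F x, H x]
    - Matrix.det
      !![0, pder 1 E x / 2, pder 0 H x / 2;
         pder 1 E x / 2, E x, F x;
         pder 0 H x / 2, F x, H x]) / discr G x ^ 2

/-! ### Space curves -/

/-- The torsion `det(c', c'', c''') / |c' × c''|²` of a space curve (meaningful where the
curvature does not vanish). -/
noncomputable def torsion (c : ℝ → Space) (t : ℝ) : ℝ :=
  Matrix.det (Matrix.of ![(iteratedDeriv 1 c t).ofLp, (iteratedDeriv 2 c t).ofLp,
      (iteratedDeriv 3 c t).ofLp])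
    / ‖WithLp.toLp 2 (crossProduct (iteratedDeriv 1 c t).ofLp (iteratedDeriv 2 c t).ofLp)‖ ^ 2

section Manifold

variable {M : Type*} [TopologicalSpace M] [ChartedSpace Plane M]

/-! ### Kossowski metrics -/

/-- A field of bilinear forms on the tangent spaces of `M`. -/
abbrev FormField (M : Type*) [TopologicalSpace M] [ChartedSpace Plane M] : Type _ :=
  ∀ x : M, TangentSpace 𝓘(ℝ, Plane) x →ₗ[ℝ] TangentSpace 𝓘(ℝ, Plane) x →ₗ[ℝ] ℝ

/-- `e` is a real analytic local coordinate system of `M` whose domain contains `p`. -/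
def IsChartAt (e : OpenPartialHomeomorph M Plane) (p : M) : Prop :=
  e ∈ IsManifold.maximalAtlas 𝓘(ℝ, Plane) ω M ∧ p ∈ e.source

/-- The form field `g` written in the chart `e`. -/
noncomputable def inChart (g : FormField M) (e : OpenPartialHomeomorph M Plane) : PlaneForm :=
  fun x v w =>
    g (e.symm x) (mfderiv 𝓘(ℝ, Plane) 𝓘(ℝ, Plane) e.symm x v)
      (mfderiv 𝓘(ℝ, Plane) 𝓘(ℝ, Plane) e.symm x w)

/-- `p` is a regular point: the form is positive definite at `p`. -/
def IsRegularPoint (g : FormField M) (p : M) : Prop :=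
  ∀ v : TangentSpace 𝓘(ℝ, Plane) p, v ≠ 0 → 0 < g p v v

/-- `p` is a semi-definite point: the form is not positive definite at `p`. -/
def IsSemiDefinitePoint (g : FormField M) (p : M) : Prop := ¬ IsRegularPoint g p

/-- Real analytic Kossowski metrics. -/
structure IsKossowskiMetric (g : FormField M) : Prop where
  symm : ∀ (x : M) (v w : TangentSpace 𝓘(ℝ, Plane) x), g x v w = g x w v
  nonneg : ∀ (x : M) (v : TangentSpace 𝓘(ℝ, Plane) x), 0 ≤ g x v v
  /-- The coefficients of the metric are real analytic in every chart. -/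
  analytic : ∀ e ∈ IsManifold.maximalAtlas 𝓘(ℝ, Plane) ω M, ∀ v w : Plane,
    AnalyticOnNhd ℝ (fun x => inChart g e x v w) e.target
  /-- Every semi-definite point is admissible. -/
  admissible : ∀ p : M, IsSemiDefinitePoint g p → ∀ e : OpenPartialHomeomorph M Plane,
    IsChartAt e p → IsAdmissibleAt (inChart g e) (e p)
  /-- Near a semi-definite point, `EG - F²` is the square of an analytic function whose gradient
  does not vanish at that point. -/
  density : ∀ p : M, IsSemiDefinitePoint g p → ∃ e : OpenPartialHomeomorph M Plane,
    IsChartAt e p ∧ ∃ lam : Plane → ℝ, AnalyticOnNhd ℝ lam e.target ∧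
      (∀ x ∈ e.target, discr (inChart g e) x = lam x ^ 2) ∧ fderiv ℝ lam (e p) ≠ 0

/-- `h du ∧ dv` is (up to sign) the Euler form `Ω = K λ du ∧ dv` of `g` in the chart `e` near `p`:
`h` is the analytic extension of `K λ` across the semi-definite points, where `K` is the Gaussian
curvature and `λ` is an analytic signed area density function, `λ² = EG - F²`. -/
def IsEulerDensityAt (g : FormField M) (e : OpenPartialHomeomorph M Plane) (p : M)
    (h : Plane → ℝ) : Prop :=
  AnalyticAt ℝ h (e p) ∧ ∃ lam : Plane → ℝ, AnalyticAt ℝ lam (e p) ∧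
    (∀ᶠ x in 𝓝 (e p), discr (inChart g e) x = lam x ^ 2) ∧
    (∀ᶠ x in 𝓝 (e p), lam x ≠ 0 → h x = gaussCurvature (inChart g e) x * lam x)

/-- The Euler form of `g` does not vanish at `p`. -/
def IsNonParabolicAt (g : FormField M) (p : M) : Prop :=
  ∃ e : OpenPartialHomeomorph M Plane, IsChartAt e p ∧
    ∃ h : Plane → ℝ, IsEulerDensityAt g e p h ∧ h (e p) ≠ 0

/-! ### Frontals

Germs at `p` are represented by maps defined on all of `M`, only the values near `p` being used. -/

/-- The differential of `f : M → ℝ³`. -/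
noncomputable def dmap (f : M → Space) (x : M) (v : TangentSpace 𝓘(ℝ, Plane) x) : Space :=
  mfderiv 𝓘(ℝ, Plane) 𝓘(ℝ, Space) f x v

/-- `ν` is a real analytic unit normal vector field along `f` near `p`. -/
def IsUnitNormalAt (f ν : M → Space) (p : M) : Prop :=
  ContMDiffAt 𝓘(ℝ, Plane) 𝓘(ℝ, Space) ω ν p ∧
    ∀ᶠ x in 𝓝 p, ‖ν x‖ = 1 ∧
      ∀ v : TangentSpace 𝓘(ℝ, Plane) x, inner ℝ (dmap f x v) (ν x) = 0

/-- `f` is a real analytic frontal germ at `p`. -/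
def IsFrontalAt (f : M → Space) (p : M) : Prop :=
  ContMDiffAt 𝓘(ℝ, Plane) 𝓘(ℝ, Space) ω f p ∧ ∃ ν : M → Space, IsUnitNormalAt f ν p

/-- `g` is the first fundamental form of `f` near `p`. -/
def IsFirstFundamentalFormAt (f : M → Space) (g : FormField M) (p : M) : Prop :=
  ∀ᶠ x in 𝓝 p, ∀ v w : TangentSpace 𝓘(ℝ, Plane) x,
    inner ℝ (dmap f x v) (dmap f x w) = g x v w

/-- `f` is an immersion at `p`. -/
def IsImmersedAt (f : M → Space) (p : M) : Prop := Function.Injective (dmap f p)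

/-- The frontal `f` with unit normal vector field `ν` is a wave front at `p`:
`(f, ν)` is an immersion at `p`. -/
def IsWaveFrontAt (f ν : M → Space) (p : M) : Prop :=
  Function.Injective
    (mfderiv 𝓘(ℝ, Plane) 𝓘(ℝ, Space × Space) (fun x => (f x, ν x)) p)

/-- The normal curvature function `c'' · (ν ∘ γ) / |c'|²` along `c = f ∘ γ`. -/
noncomputable def normalCurvature (f ν : M → Space) (γ : ℝ → M) (t : ℝ) : ℝ :=
  inner ℝ (iteratedDeriv 2 (f ∘ γ) t) (ν (γ t)) / ‖iteratedDeriv 1 (f ∘ γ) t‖ ^ 2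

/-- The chart `e` is adjusted at the singular point `p` of `f`: `f_v = 0` at `p`. -/
def IsAdjustedAt (f : M → Space) (e : OpenPartialHomeomorph M Plane) (p : M) : Prop :=
  IsChartAt e p ∧ pder 1 (f ∘ e.symm) (e p) = 0

/-- `κ` is the limiting normal curvature of `f` at its singular point `p`, that is, the common
value of `f_uu · ν / |f_u|²` at `p` in all adjusted charts (of which there is at least one). -/
def HasLimitingNormalCurvature (f ν : M → Space) (p : M) (κ : ℝ) : Prop :=
  (∃ e : OpenPartialHomeomorph M Plane, IsAdjustedAt f e p) ∧
    ∀ e : OpenPartialHomeomorph M Plane, IsAdjustedAt f e p →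
      inner ℝ (pder 0 (pder 0 (f ∘ e.symm)) (e p)) (ν p) / ‖pder 0 (f ∘ e.symm) (e p)‖ ^ 2 = κ

/-- The germs of `f₁` and `f₂` at `p` are strongly congruent. -/
def StronglyCongruentAt (p : M) (f₁ f₂ : M → Space) : Prop :=
  ∃ Φ : Space ≃ᵢ Space, f₁ =ᶠ[𝓝 p] Φ ∘ f₂

/-- The germs of `f₁` and `f₂` at `p` are congruent: they agree up to an isometry of `ℝ³` and a
real analytic diffeomorphism germ of `M` at `p`. -/
def CongruentAt (p : M) (f₁ f₂ : M → Space) : Prop :=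
  ∃ (Φ : Space ≃ᵢ Space) (φ : M → M), φ p = p ∧
    IsLocalDiffeomorphAt 𝓘(ℝ, Plane) 𝓘(ℝ, Plane) ω φ p ∧ f₁ =ᶠ[𝓝 p] Φ ∘ f₂ ∘ φ

/-- `f` is a real analytic frontal germ at `p` with first fundamental form `g`, normal curvature
`e^w` along `γ` for a suitable unit normal vector field, and torsion `μ` along `f ∘ γ`. -/
structure IsRealization (g : FormField M) (p : M) (γ : ℝ → M) (w μ : ℝ → ℝ)
    (f : M → Space) : Prop where
  frontal : IsFrontalAt f p
  isometric : IsFirstFundamentalFormAt f g p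
  normal_curvature : ∃ ν : M → Space, IsUnitNormalAt f ν p ∧
    ∀ᶠ t in 𝓝 (0 : ℝ), normalCurvature f ν γ t = Real.exp (w t)
  torsion_eq : ∀ᶠ t in 𝓝 (0 : ℝ), torsion (f ∘ γ) t = μ t

end Manifold

end KossowskiMetrics

open KossowskiMetrics

namespace KossowskiMetrics

open MvPowerSeries Finset Filter

/-! ### Convergent power series in two variables -/

/-! Take coordinates in which the curve is the axis `v = 0`, with its parameter, and write the
metric as `(s du + q dv)² + (l dv)²`, where `s = √E`, `q = F / s` and `l = λ / s`. The function `l`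
vanishes at semi-definite points, so the Levi-Civita connection form could have poles there.
Admissibility says that `q_u - s_v` vanishes wherever `λ` does. As `dλ ≠ 0` at semi-definite points,
analytic division gives an analytic `a` with `a l = q_u - s_v`, and the whole connection form `a du
+ b dv` is analytic (`exists_isCoframe`, `IsChartAt.exists_isCoframe`). From here on regular and
semi-definite points are treated alike.

A frontal with this metric amounts to an orthonormal frame with `df = (s du + q dv) e₀ + l dv e₁`
and `e₂ = ν` (`IsPlanarRealization.exists_frame`). Put `L = ⟨e₂, ∂_u e₀⟩`, `M = ⟨e₂, ∂_u e₁⟩`, `M' =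
⟨e₂, ∂_v e₀⟩` and `N = ⟨e₂, ∂_v e₁⟩`. Symmetry of the second derivatives of `f` gives `M' = (q L + l
M) / s`, and the Gauss equation reads `L N = k + M M'` with `k = a_v - b_u`. Since `L ≠ 0`, it can
be solved for `N`, and the Codazzi equations become an evolution system in `v` for the pair `(L, M)`
(`IsAdapted.isGaussCodazzi`). The Cauchy–Kovalevskaya theorem solves it uniquely from data on the
axis. The normal curvature fixes `L = s e^w` there. The torsion fixes `M` there once the sign `σ =
det (e₀, e₁, e₂)` is known (`IsAdapted.conn_axis`), and `σ` enters only through the product `σ μ`.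
Hence there are at most two strong congruence classes, and a single one if `μ = 0`. Conversely, a
solution `(L, M)` yields a flat connection whose parallel sections are the frame and the map
together (`exists_isAdapted`).

The Cauchy–Kovalevskaya theorem is proved in a Banach algebra of power series, the weighted `ℓ¹`
space with weight the inverse binomial coefficient, on which `∂_v⁻¹ ∂_u` has norm at most `1`. After
the rescaling `v ↦ ε v`, the integrated system is a perturbation of a trivial equation at `ε = 0`,
and the implicit function theorem gives both existence and uniqueness
(`DivergenceSystem.exists_solution`, `DivergenceSystem.eventually_eq_of_isSolution`).

For the last property, `(Kλ)²` equals the square of the density of the Gauss map at regular points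
(`gaussCurvature_sq`). These accumulate at a semi-definite point, so at a non-parabolic one `dν` is
injective. This makes `f` a front, and it excludes zero limiting normal curvature, which would force
`dν` to have rank at most one. -/

/-- Formal power series in two variables. -/
abbrev Series : Type := MvPowerSeries (Fin 2) ℝ

/-- The total degree of an exponent. -/
def deg (d : Fin 2 →₀ ℕ) : ℕ := d 0 + d 1

/-- The monomial with exponent `d`. -/
noncomputable def monom (d : Fin 2 →₀ ℕ) (x : Plane) : ℝ := x 0 ^ d 0 * x 1 ^ d 1

/-- The sum of a power series. -/
noncomputable def ev (c : Series) (x : Plane) : ℝ := ∑' d, coeff d c * monom d x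

/-- Absolute convergence of a power series on the bidisc of radius `R`. -/
def ConvergesOn (R : ℝ) (c : Series) : Prop := Summable fun d => |coeff d c| * R ^ deg d

lemma deg_add (d d' : Fin 2 →₀ ℕ) : deg (d + d') = deg d + deg d' := by
  simp [deg]; ring

lemma monom_add (d d' : Fin 2 →₀ ℕ) (x : Plane) : monom (d + d') x = monom d x * monom d' x := by
  simp [monom, pow_add]; ring

lemma abs_coord_le (x : Plane) (i : Fin 2) : |x i| ≤ ‖x‖ := by
  simpa using PiLp.norm_apply_le x i

lemma abs_monom_le (d : Fin 2 →₀ ℕ) (x : Plane) {R : ℝ} (h : ‖x‖ ≤ R) :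
    |monom d x| ≤ R ^ deg d := by
  rw [monom, abs_mul, abs_pow, abs_pow, deg, pow_add]
  have h0 := (abs_coord_le x 0).trans h
  have h1 := (abs_coord_le x 1).trans h
  have : 0 ≤ R := (norm_nonneg x).trans h
  gcongr

lemma ConvergesOn.summable {R : ℝ} {c : Series} (hc : ConvergesOn R c) {x : Plane}
    (hx : ‖x‖ ≤ R) : Summable fun d => coeff d c * monom d x := by
  refine Summable.of_norm_bounded hc fun d => ?_
  rw [Real.norm_eq_abs, abs_mul]
  gcongr
  exact abs_monom_le d x hx

lemma ConvergesOn.mono {R r : ℝ} {c : Series} (hc : ConvergesOn R c) (hr : 0 ≤ r) (h : r ≤ R) :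
    ConvergesOn r c :=
  Summable.of_nonneg_of_le (fun d => by positivity) (fun d => by gcongr) hc

/-- The monomial with exponent `d` as a multilinear map. -/
noncomputable def monomMultilinear (d : Fin 2 →₀ ℕ) :
    ContinuousMultilinearMap ℝ (fun _ : Fin (deg d) => Plane) ℝ :=
  (ContinuousMultilinearMap.mkPiAlgebra ℝ (Fin (deg d)) ℝ).compContinuousLinearMap
    fun i => if (i : ℕ) < d 0 then EuclideanSpace.proj 0 else EuclideanSpace.proj 1

lemma norm_monomMultilinear_le (d : Fin 2 →₀ ℕ) : ‖monomMultilinear d‖ ≤ 1 := by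
  refine ContinuousMultilinearMap.opNorm_le_bound zero_le_one fun m => ?_
  simp only [monomMultilinear, ContinuousMultilinearMap.compContinuousLinearMap_apply,
    ContinuousMultilinearMap.mkPiAlgebra_apply, norm_prod, one_mul]
  refine Finset.prod_le_prod (fun _ _ => norm_nonneg _) fun i _ => ?_
  split_ifs
  · exact abs_coord_le (m i) 0
  · exact abs_coord_le (m i) 1

lemma monomMultilinear_diag (d : Fin 2 →₀ ℕ) (x : Plane) :
    monomMultilinear d (fun _ => x) = monom d x := by
  simp only [monomMultilinear, ContinuousMultilinearMap.compContinuousLinearMap_apply,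
    ContinuousMultilinearMap.mkPiAlgebra_apply, monom]
  have : ∀ m n : ℕ, ∏ i : Fin (m + n), (if (i : ℕ) < m then EuclideanSpace.proj 0 else
      EuclideanSpace.proj 1 : Plane →L[ℝ] ℝ) x = x 0 ^ m * x 1 ^ n := by
    intro m n
    rw [Fin.prod_univ_add]
    simp
  exact this (d 0) (d 1)

lemma finite_deg_eq (n : ℕ) : {d : Fin 2 →₀ ℕ | deg d = n}.Finite := by
  refine ((Set.finite_Iic n).prod (Set.finite_Iic n)).of_injOn
    (f := fun d : Fin 2 →₀ ℕ => (d 0, d 1)) ?_ ?_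
  · intro d hd
    simp only [Set.mem_ofPred_eq, deg] at hd
    simp only [Set.mem_prod, Set.mem_Iic]
    omega
  · intro d _ d' _ h
    ext i
    simp only [Prod.mk.injEq] at h
    fin_cases i
    · exact h.1
    · exact h.2

noncomputable instance (n : ℕ) : Fintype {d : Fin 2 →₀ ℕ // deg d = n} :=
  (finite_deg_eq n).fintype

/-- A power series as a formal multilinear series. -/
noncomputable def toMultilinear (c : Series) : FormalMultilinearSeries ℝ Plane ℝ := fun n =>
  ∑ d : {d : Fin 2 →₀ ℕ // deg d = n}, coeff d.1 c •
    (monomMultilinear d.1).domDomCongr (finCongr d.2)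

lemma toMultilinear_diag (c : Series) (n : ℕ) (x : Plane) :
    toMultilinear c n (fun _ => x) =
      ∑ d : {d : Fin 2 →₀ ℕ // deg d = n}, coeff d.1 c * monom d.1 x := by
  simp only [toMultilinear, _root_.sum_apply, _root_.smul_apply,
    ContinuousMultilinearMap.domDomCongr_apply, smul_eq_mul, monomMultilinear_diag]

lemma norm_toMultilinear_le (c : Series) (n : ℕ) :
    ‖toMultilinear c n‖ ≤ ∑ d : {d : Fin 2 →₀ ℕ // deg d = n}, |coeff d.1 c| := by
  refine (norm_sum_le _ _).trans (Finset.sum_le_sum fun d _ => ?_)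
  obtain ⟨d, rfl⟩ := d
  rw [norm_smul, Real.norm_eq_abs]
  refine mul_le_of_le_one_right (abs_nonneg _) ?_
  exact norm_monomMultilinear_le d

lemma hasSum_deg {f : (Fin 2 →₀ ℕ) → ℝ} {a : ℝ} (h : HasSum f a) :
    HasSum (fun n => ∑ d : {d : Fin 2 →₀ ℕ // deg d = n}, f d.1) a :=
  ((Equiv.sigmaFiberEquiv deg).hasSum_iff.2 h).sigma fun _ => hasSum_fintype _

/-- Each monomial is a multilinear map of norm at most `1`, so a homogeneous part is bounded by the
sum of the absolute values of its coefficients. -/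
lemma ConvergesOn.le_radius {R : ℝ} {c : Series} (hR : 0 < R) (hc : ConvergesOn R c) :
    ENNReal.ofReal R ≤ (toMultilinear c).radius := by
  refine FormalMultilinearSeries.le_radius_of_summable_norm (r := R.toNNReal) _ ?_
  refine Summable.of_nonneg_of_le (fun n => by positivity) (fun n => ?_)
    (hasSum_deg hc.hasSum).summable
  rw [Real.coe_toNNReal R hR.le]
  refine (mul_le_mul_of_nonneg_right (norm_toMultilinear_le c n) (by positivity)).trans ?_
  rw [Finset.sum_mul]
  exact Finset.sum_le_sum fun d _ => by rw [d.2]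

lemma mem_eball_zero_iff {R : ℝ} (hR : 0 < R) (y : Plane) :
    y ∈ Metric.eball (0 : Plane) (ENNReal.ofReal R) ↔ ‖y‖ < R := by
  rw [Metric.mem_eball, edist_zero_right, ← ofReal_norm, ENNReal.ofReal_lt_ofReal_iff hR]

lemma ConvergesOn.hasSum_toMultilinear {R : ℝ} {c : Series} (hc : ConvergesOn R c) {y : Plane}
    (hy : ‖y‖ ≤ R) : HasSum (fun n => toMultilinear c n (fun _ => y)) (ev c y) := by
  have := hasSum_deg (hc.summable hy).hasSum
  refine this.congr_fun ?_
  intro n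
  exact toMultilinear_diag c n y

lemma ConvergesOn.hasFPowerSeriesOnBall {R : ℝ} {c : Series} (hR : 0 < R) (hc : ConvergesOn R c) :
    HasFPowerSeriesOnBall (ev c) (toMultilinear c) 0 (ENNReal.ofReal R) :=
  ⟨hc.le_radius hR, by simpa using hR, fun {y} hy => by
    rw [zero_add]
    exact hc.hasSum_toMultilinear ((mem_eball_zero_iff hR y).1 hy).le⟩

lemma ConvergesOn.analyticAt {R : ℝ} {c : Series} (hc : ConvergesOn R c) {x : Plane}
    (hx : ‖x‖ < R) : AnalyticAt ℝ (ev c) x := by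
  have hR : 0 < R := (norm_nonneg x).trans_lt hx
  exact (hc.hasFPowerSeriesOnBall hR).analyticAt_of_mem ((mem_eball_zero_iff hR x).2 hx)

/-! ### Expansion of analytic functions -/

lemma plane_eq_sum (x : Plane) : x = ∑ i, x i • coordVec i := by
  ext j
  fin_cases j <;> simp [coordVec, Fin.sum_univ_two]

/-- The exponent counting the values of `r`. -/
noncomputable def countExp {n : ℕ} (r : Fin n → Fin 2) : Fin 2 →₀ ℕ :=
  ∑ k, Finsupp.single (r k) 1

lemma monom_countExp {n : ℕ} (r : Fin n → Fin 2) (x : Plane) :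
    ∏ k, x (r k) = monom (countExp r) x := by
  have h : ∀ s : Finset (Fin n), ∏ k ∈ s, x (r k) = monom (∑ k ∈ s, Finsupp.single (r k) 1) x := by
    intro s
    induction s using Finset.induction_on with
    | empty => simp [monom]
    | insert a s ha ih =>
      rw [Finset.prod_insert ha, Finset.sum_insert ha, monom_add, ih]
      congr 1
      generalize r a = i
      fin_cases i <;> simp [monom]
  exact h _

lemma deg_countExp {n : ℕ} (r : Fin n → Fin 2) : deg (countExp r) = n := by
  have h : ∀ s : Finset (Fin n), deg (∑ k ∈ s, Finsupp.single (r k) 1) = #s := by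
    intro s
    induction s using Finset.induction_on with
    | empty => simp [deg]
    | insert a s ha ih =>
      rw [Finset.sum_insert ha, deg_add, ih, Finset.card_insert_of_notMem ha, add_comm]
      congr 1
      generalize r a = i
      fin_cases i <;> simp [deg]
  simpa [countExp] using h Finset.univ

/-- Multilinearity turns the degree `n` term into a sum over words of length `n` in the two
coordinate vectors; collecting the words with the same letter counts produces a double series. -/
lemma exists_series_of_analyticAt {φ : Plane → ℝ} (hφ : AnalyticAt ℝ φ 0) :
    ∃ R > 0, ∃ c : Series, ConvergesOn R c ∧ ∀ x, ‖x‖ ≤ R → φ x = ev c x := by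
  obtain ⟨p, r, hp⟩ := hφ
  obtain ⟨ρ, hρ0, hρ⟩ := ENNReal.lt_iff_exists_nnreal_btwn.1 hp.r_pos
  have hρ0' : 0 < (ρ : ℝ) := by exact_mod_cast hρ0
  -- There are `2 ^ n` words of length `n`, so absolute convergence of the sum over all words costs
  -- a factor `2` in the radius.
  set R : ℝ := ρ / 2 with hR
  have hR0 : 0 < R := by positivity
  let J := Σ n : ℕ, (Fin n → Fin 2)
  let a : J → ℝ := fun j => p j.1 fun k => coordVec (j.2 k)
  have ha : ∀ j, |a j| ≤ ‖p j.1‖ := fun j => by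
    have h := (p j.1).le_opNorm fun k => coordVec (j.2 k)
    have h1 : ∏ k, ‖coordVec (j.2 k)‖ = 1 := by simp [coordVec]
    rwa [h1, mul_one] at h
  have hmaj : Summable fun j : J => ‖p j.1‖ * R ^ j.1 := by
    rw [summable_sigma_of_nonneg fun j => by positivity]
    refine ⟨fun n => Summable.of_finite, ?_⟩
    have h := p.summable_norm_mul_pow (hρ.trans_le hp.r_le)
    have h2 : ∀ t : ℝ, ∀ n : ℕ, ∑' _ : Fin n → Fin 2, t * R ^ n = t * (ρ : ℝ) ^ n := by
      intro t n
      rw [tsum_fintype, Finset.sum_const, Finset.card_univ, Fintype.card_fun, Fintype.card_fin,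
        Fintype.card_fin, nsmul_eq_mul, hR, div_pow]
      push_cast
      field_simp
    exact h.congr fun n => (h2 _ n).symm
  have hterm : ∀ x : Plane, ‖x‖ ≤ R → ∀ j : J, |a j * monom (countExp j.2) x| ≤ ‖p j.1‖ * R ^ j.1 := by
    intro x hx j
    rw [abs_mul]
    have := abs_monom_le (countExp j.2) x hx
    rw [deg_countExp] at this
    exact mul_le_mul (ha j) this (abs_nonneg _) (norm_nonneg _)
  let c : Series := fun d => ∑' j : (fun j : J => countExp j.2) ⁻¹' {d}, a j
  have hcoeff : ∀ d, coeff d c = ∑' j : (fun j : J => countExp j.2) ⁻¹' {d}, a j := fun d => rfl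
  refine ⟨R, hR0, c, ?_, fun x hx => ?_⟩
  · refine Summable.of_nonneg_of_le (fun d => by positivity) (fun d => ?_)
      (hmaj.hasSum.tsum_fiberwise fun j : J => countExp j.2).summable
    have hs : Summable fun j : (fun j : J => countExp j.2) ⁻¹' {d} => ‖p j.1.1‖ * R ^ j.1.1 :=
      hmaj.subtype _
    have hb : ∀ j : (fun j : J => countExp j.2) ⁻¹' {d}, ‖a j * R ^ deg d‖ ≤ ‖p j.1.1‖ * R ^ j.1.1 := by
      rintro ⟨j, hj⟩
      have hj' : countExp j.2 = d := hj
      have hd : deg d = j.1 := by rw [← hj', deg_countExp]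
      rw [hd, norm_mul, Real.norm_eq_abs, Real.norm_of_nonneg (by positivity)]
      exact mul_le_mul_of_nonneg_right (ha j) (by positivity)
    have h := tsum_of_norm_bounded hs.hasSum hb
    rw [tsum_mul_right, norm_mul, Real.norm_eq_abs, Real.norm_of_nonneg (by positivity)] at h
    rwa [hcoeff]
  · have hs : Summable fun j : J => a j * monom (countExp j.2) x :=
      Summable.of_norm_bounded hmaj (hterm x hx)
    have h1 : HasSum (fun n => p n fun _ => x) (∑' j : J, a j * monom (countExp j.2) x) := by
      refine (hs.hasSum.sigma fun n => hasSum_fintype _).congr_fun fun n => ?_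
      conv_lhs => rw [plane_eq_sum x]
      have h2 := (p n).toMultilinearMap.map_sum fun (_ : Fin n) i => x i • coordVec i
      refine h2.trans (Finset.sum_congr rfl fun r _ => ?_)
      have h3 := (p n).toMultilinearMap.map_smul_univ (fun k => x (r k)) fun k => coordVec (r k)
      refine h3.trans ?_
      rw [monom_countExp, smul_eq_mul, mul_comm]
      rfl
    have h4 := hp.hasSum (y := x) (by
      rw [Metric.mem_eball, edist_zero_right, ← ofReal_norm]
      refine lt_of_le_of_lt ?_ hρ
      rw [ENNReal.ofReal_le_iff_le_toReal ENNReal.coe_ne_top, ENNReal.coe_toReal]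
      linarith)
    rw [zero_add] at h4
    rw [h4.unique h1, ← (hs.hasSum.tsum_fiberwise fun j : J => countExp j.2).tsum_eq, ev]
    refine tsum_congr fun d => ?_
    rw [hcoeff, ← tsum_mul_right]
    refine tsum_congr fun j => ?_
    rw [show countExp j.1.2 = d from j.2]

/-! ### Differentiation -/

/-- The elementary form of Cauchy's estimate: shrinking the radius absorbs the factor `m + 1`
created by differentiation, at the price `(R - r)⁻¹`. -/
lemma succ_mul_pow_mul_le {r R : ℝ} (hr : 0 ≤ r) (h : r ≤ R) (m : ℕ) :
    ((m : ℝ) + 1) * r ^ m * (R - r) ≤ R ^ (m + 1) := by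
  induction m with
  | zero => simp; linarith
  | succ m ih =>
    have h1 : r ^ (m + 1) ≤ R ^ (m + 1) := by gcongr
    have h2 := mul_le_mul_of_nonneg_left ih hr
    have h3 := mul_le_mul_of_nonneg_right h1 (sub_nonneg.2 h)
    push_cast
    calc ((m : ℝ) + 1 + 1) * r ^ (m + 1) * (R - r)
        = r * (((m : ℝ) + 1) * r ^ m * (R - r)) + r ^ (m + 1) * (R - r) := by ring
      _ ≤ r * R ^ (m + 1) + R ^ (m + 1) * (R - r) := add_le_add h2 h3
      _ = R ^ (m + 1 + 1) := by ring

lemma deg_add_single (d : Fin 2 →₀ ℕ) (i : Fin 2) : deg (d + Finsupp.single i 1) = deg d + 1 := by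
  rw [deg_add]
  fin_cases i <;> simp [deg]

lemma apply_le_deg (d : Fin 2 →₀ ℕ) (i : Fin 2) : d i ≤ deg d := by
  fin_cases i <;> simp [deg]

lemma eq_add_single {d : Fin 2 →₀ ℕ} {i : Fin 2} (h : d i ≠ 0) :
    d = d - Finsupp.single i 1 + Finsupp.single i 1 := by
  rw [tsub_add_cancel_of_le]
  exact Finsupp.single_le_iff.2 (Nat.one_le_iff_ne_zero.2 h)

lemma add_single_injective (i : Fin 2) :
    Function.Injective fun d : Fin 2 →₀ ℕ => d + Finsupp.single i 1 := add_left_injective _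

lemma ConvergesOn.pderiv {R r : ℝ} {c : Series} (hc : ConvergesOn R c) (hr : 0 ≤ r) (h : r < R)
    (i : Fin 2) : ConvergesOn r (MvPowerSeries.pderiv ℝ i c) := by
  have h1 := (hc.comp_injective (add_single_injective i)).mul_left (R - r)⁻¹
  refine Summable.of_nonneg_of_le (fun d => by positivity) (fun d => ?_) h1
  simp only [Function.comp, deg_add_single, coeff_pderiv]
  have h2 := succ_mul_pow_mul_le hr h.le (deg d)
  have h3 : ((d i : ℕ) : ℝ) ≤ deg d := by exact_mod_cast apply_le_deg d i
  rw [abs_mul, abs_of_nonneg (by positivity : (0 : ℝ) ≤ (d i : ℝ) + 1), inv_mul_eq_div,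
    le_div_iff₀ (sub_pos.2 h), mul_assoc, mul_assoc]
  refine mul_le_mul_of_nonneg_left ?_ (abs_nonneg _)
  rw [← mul_assoc]
  refine le_trans ?_ h2
  have := sub_nonneg.2 h.le
  gcongr

lemma hasFDerivAt_monom (d : Fin 2 →₀ ℕ) (x : Plane) :
    HasFDerivAt (monom d) (∑ i, ((d i : ℝ) * monom (d - Finsupp.single i 1) x) •
      (EuclideanSpace.proj i : Plane →L[ℝ] ℝ)) x := by
  have h0 : HasFDerivAt (fun x : Plane => x 0) (EuclideanSpace.proj 0 : Plane →L[ℝ] ℝ) x :=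
    (EuclideanSpace.proj 0 : Plane →L[ℝ] ℝ).hasFDerivAt
  have h1 : HasFDerivAt (fun x : Plane => x 1) (EuclideanSpace.proj 1 : Plane →L[ℝ] ℝ) x :=
    (EuclideanSpace.proj 1 : Plane →L[ℝ] ℝ).hasFDerivAt
  refine ((h0.pow (d 0)).mul (h1.pow (d 1))).congr_fderiv ?_
  ext v
  simp [Fin.sum_univ_two, monom]
  ring

lemma ConvergesOn.pder_ev {R : ℝ} {c : Series} (hc : ConvergesOn R c) (i : Fin 2) {x : Plane}
    (hx : ‖x‖ < R) : pder i (ev c) x = ev (MvPowerSeries.pderiv ℝ i c) x := by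
  obtain ⟨r, hxr, hrR⟩ := exists_between hx
  have hr : 0 < r := (norm_nonneg x).trans_lt hxr
  have hRr : 0 < R - r := sub_pos.2 hrR
  let f' : (Fin 2 →₀ ℕ) → Plane → Plane →L[ℝ] ℝ := fun d y =>
    coeff d c • ∑ i, ((d i : ℝ) * monom (d - Finsupp.single i 1) y) •
      (EuclideanSpace.proj i : Plane →L[ℝ] ℝ)
  -- A majorant of the differentiated terms on the ball of radius `r`: the factor `2` counts the
  -- coordinates, and `(R - r)⁻¹` comes from `succ_mul_pow_mul_le`.
  let u : (Fin 2 →₀ ℕ) → ℝ := fun d => |coeff d c| * R ^ deg d * (2 * (R - r)⁻¹)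
  have hu : Summable u := hc.mul_right _
  have hcoef : ∀ (d : Fin 2 →₀ ℕ) (i : Fin 2) (y : Plane), ‖y‖ < r →
      ‖(d i : ℝ) * monom (d - Finsupp.single i 1) y‖ ≤ R ^ deg d * (R - r)⁻¹ := by
    intro d i y hy
    by_cases hd : d i = 0
    · simp only [hd, Nat.cast_zero, zero_mul, norm_zero]
      have : 0 < R := hr.trans hrR
      positivity
    · obtain ⟨d', rfl⟩ : ∃ d', d = d' + Finsupp.single i 1 := ⟨_, eq_add_single hd⟩
      rw [add_tsub_cancel_right, deg_add_single, norm_mul, Real.norm_of_nonneg (by positivity),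
        ← div_eq_mul_inv, le_div_iff₀ hRr]
      refine le_trans ?_ (succ_mul_pow_mul_le hr.le hrR.le (deg d'))
      have h1 := abs_monom_le d' y hy.le
      have h2 : (((d' + Finsupp.single i 1 : Fin 2 →₀ ℕ) i : ℕ) : ℝ) ≤ deg d' + 1 := by
        have := apply_le_deg d' i
        simp only [Finsupp.add_apply, Finsupp.single_eq_same]
        exact_mod_cast Nat.succ_le_succ this
      rw [Real.norm_eq_abs]
      gcongr
  have hf' : ∀ d, ∀ y ∈ Metric.ball (0 : Plane) r, ‖f' d y‖ ≤ u d := by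
    intro d y hy
    rw [mem_ball_zero_iff] at hy
    have hproj : ∀ i : Fin 2, ‖(EuclideanSpace.proj i : Plane →L[ℝ] ℝ)‖ ≤ 1 := fun i =>
      ContinuousLinearMap.opNorm_le_bound _ zero_le_one fun y => by
        simpa using abs_coord_le y i
    rw [norm_smul, Real.norm_eq_abs]
    have : ‖∑ i, ((d i : ℝ) * monom (d - Finsupp.single i 1) y) •
        (EuclideanSpace.proj i : Plane →L[ℝ] ℝ)‖ ≤ ∑ _i : Fin 2, R ^ deg d * (R - r)⁻¹ := by
      refine (norm_sum_le _ _).trans (Finset.sum_le_sum fun i _ => ?_)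
      rw [norm_smul]
      exact (mul_le_of_le_one_right (norm_nonneg _) (hproj i)).trans (hcoef d i y hy)
    refine (mul_le_mul_of_nonneg_left this (abs_nonneg _)).trans_eq ?_
    simp [u]
    ring
  have hxb : x ∈ Metric.ball (0 : Plane) r := by simpa using hxr
  have key := hasFDerivAt_tsum_of_isPreconnected hu Metric.isOpen_ball
    (convex_ball (0 : Plane) r).isPreconnected (f := fun d y => coeff d c * monom d y) (f' := f')
    (fun d y _ => (hasFDerivAt_monom d y).const_smul (coeff d c)) hf' hxb
    (hc.summable hx.le) hxb
  have hs : Summable fun d => f' d x := Summable.of_norm_bounded hu fun d => hf' d x hxb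
  have h1 : pder i (ev c) x = ∑' d, f' d x (coordVec i) := by
    rw [pder, show fderiv ℝ (ev c) x = _ from key.fderiv]
    exact (ContinuousLinearMap.apply ℝ ℝ (coordVec i)).map_tsum hs
  rw [h1, ev]
  have h2 : ∀ d, f' d x (coordVec i) =
      coeff d c * ((d i : ℝ) * monom (d - Finsupp.single i 1) x) := by
    intro d
    simp only [f', coordVec, _root_.smul_apply, _root_.sum_apply]
    congr 1
    fin_cases i <;> simp
  rw [← (add_single_injective i).tsum_eq]
  · refine tsum_congr fun d => ?_
    rw [h2, coeff_pderiv, add_tsub_cancel_right]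
    simp
    ring
  · intro d hd
    rw [Function.mem_support, h2] at hd
    refine ⟨d - Finsupp.single i 1, (eq_add_single fun h => hd ?_).symm⟩
    simp [h]

/-! ### Uniqueness of the expansion. -/

lemma ev_zero_point (c : Series) : ev c 0 = coeff 0 c := by
  rw [ev, tsum_eq_single 0]
  · simp [monom]
  · intro d hd
    have : monom d 0 = 0 := by
      simp only [monom, PiLp.zero_apply]
      by_contra h
      simp only [mul_eq_zero, not_or, pow_eq_zero_iff', ne_eq, true_and, not_not] at h
      exact hd (by ext i; fin_cases i <;> simp [h.1, h.2])
    simp [this]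

/-- A coefficient of positive degree is, up to a nonzero factor, a coefficient of lower degree of a
partial derivative, whose sum vanishes as well. The induction on the degree runs over all radii and
series, because differentiating shrinks the disc. -/
lemma ConvergesOn.eq_zero {R : ℝ} {c : Series} (hR : 0 < R) (hc : ConvergesOn R c)
    (h : ev c =ᶠ[𝓝 0] 0) : c = 0 := by
  suffices H : ∀ d : Fin 2 →₀ ℕ, ∀ (R : ℝ) (c : Series), 0 < R → ConvergesOn R c →
      ev c =ᶠ[𝓝 0] 0 → coeff d c = 0 by
    ext d
    exact H d R c hR hc h
  clear h hc hR c R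
  intro d
  induction hn : deg d generalizing d with
  | zero =>
    intro R c hR hc h
    have hd : d = 0 := by
      simp only [deg, Nat.add_eq_zero_iff] at hn
      ext i
      fin_cases i <;> simp [hn.1, hn.2]
    rw [hd, ← ev_zero_point]
    exact h.self_of_nhds
  | succ n ih =>
    intro R c hR hc h
    obtain ⟨i, hi⟩ : ∃ i, d i ≠ 0 := by
      by_contra! H
      simp [deg, H] at hn
    obtain ⟨d', rfl⟩ : ∃ d', d = d' + Finsupp.single i 1 := ⟨_, eq_add_single hi⟩
    rw [deg_add_single, Nat.add_right_cancel_iff] at hn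
    have h1 := ih d' hn (R / 2) _ (half_pos hR) (hc.pderiv (half_pos hR).le (half_lt_self hR) i) (by
      have hb : ∀ᶠ x : Plane in 𝓝 0, ‖x‖ < R := by
        filter_upwards [Metric.ball_mem_nhds (0 : Plane) hR] with x hx
        simpa using hx
      filter_upwards [h.eventually_nhds, hb] with x hx hxR
      rw [← hc.pder_ev i hxR, pder, Filter.EventuallyEq.fderiv_eq hx]
      simp)
    rw [coeff_pderiv] at h1
    exact (mul_eq_zero.1 h1).resolve_right (by positivity)

end KossowskiMetrics

namespace KossowskiMetrics

open MvPowerSeries Finset Filter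

/-! ### A Banach algebra of power series -/

/-- The weight of an exponent: the inverse of the corresponding binomial coefficient. -/
noncomputable def wt (d : Fin 2 →₀ ℕ) : ℝ := ((deg d).choose (d 0) : ℝ)⁻¹

lemma choose_deg_pos (d : Fin 2 →₀ ℕ) : 0 < ((deg d).choose (d 0) : ℝ) := by
  exact_mod_cast Nat.choose_pos (apply_le_deg d 0)

lemma wt_pos (d : Fin 2 →₀ ℕ) : 0 < wt d := inv_pos.2 (choose_deg_pos d)

lemma wt_le_one (d : Fin 2 →₀ ℕ) : wt d ≤ 1 := by
  refine inv_le_one_of_one_le₀ ?_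
  exact_mod_cast Nat.choose_pos (apply_le_deg d 0)

/-- This bounds what the weight loses: a series of finite weighted norm still converges on the disc
of radius `1 / 2`. -/
lemma half_pow_le_wt (d : Fin 2 →₀ ℕ) : (1 / 2 : ℝ) ^ deg d ≤ wt d := by
  rw [one_div, inv_pow, wt]
  refine inv_anti₀ (choose_deg_pos d) ?_
  exact_mod_cast Nat.choose_le_two_pow _ _

/-- By Vandermonde's identity the product of the two binomial coefficients is one term of the sum
giving the third. Submultiplicativity of the weight is what makes the weighted `ℓ¹` space a Banach
algebra. -/
lemma wt_add_le (d d' : Fin 2 →₀ ℕ) : wt (d + d') ≤ wt d * wt d' := by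
  rw [wt, wt, wt, ← mul_inv]
  refine inv_anti₀ (mul_pos (choose_deg_pos d) (choose_deg_pos d')) ?_
  rw [deg_add, Finsupp.add_apply]
  norm_cast
  rw [Nat.add_choose_eq]
  exact Finset.single_le_sum
    (f := fun ij : ℕ × ℕ => (deg d).choose ij.1 * (deg d').choose ij.2) (fun _ _ => Nat.zero_le _)
    (by simp : (d 0, d' 0) ∈ antidiagonal (d 0 + d' 0))

/-- This identity is the reason for the choice of weight. The operator `∂_v⁻¹ ∂_u` sends `u^(m+1)
v^n` to `(m+1)/(n+1) u^m v^(n+1)`, and the two have the same weighted norm. -/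
lemma wt_add_single_one_mul (d : Fin 2 →₀ ℕ) :
    ((d 0 : ℝ) + 1) / (d 1 + 1) * wt (d + Finsupp.single 1 1) = wt (d + Finsupp.single 0 1) := by
  have h := Nat.choose_succ_right_eq (deg d + 1) (d 0)
  have h0 : deg d + 1 - d 0 = d 1 + 1 := by simp only [deg]; omega
  rw [h0] at h
  have h' : ((deg d + 1).choose (d 0 + 1) : ℝ) * (d 0 + 1) = (deg d + 1).choose (d 0) * (d 1 + 1) := by
    exact_mod_cast h
  have p1 := choose_deg_pos (d + Finsupp.single 1 1)
  have p2 := choose_deg_pos (d + Finsupp.single 0 1)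
  rw [wt, wt]
  rw [deg_add_single] at p1 p2 ⊢
  rw [deg_add_single]
  simp only [Finsupp.add_apply, Finsupp.single_eq_same, ne_eq, zero_ne_one, not_false_eq_true,
    Finsupp.single_eq_of_ne, add_zero] at p1 p2 ⊢
  field_simp
  linarith

lemma summable_of_le_antidiagonal {f g h : (Fin 2 →₀ ℕ) → ℝ} (hf : Summable f) (hg : Summable g)
    (hf0 : 0 ≤ f) (hg0 : 0 ≤ g) (hh : 0 ≤ h)
    (hle : ∀ d, h d ≤ ∑ kl ∈ antidiagonal d, f kl.1 * g kl.2) :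
    Summable h ∧ ∑' d, h d ≤ (∑' d, f d) * ∑' d, g d := by
  have hfg := hf.mul_of_nonneg hg hf0 hg0
  have hs := summable_sum_mul_antidiagonal_of_summable_mul hfg
  have hsum : Summable h := Summable.of_nonneg_of_le hh hle hs
  refine ⟨hsum, ?_⟩
  rw [hf.tsum_mul_tsum_eq_tsum_sum_antidiagonal hg hfg]
  exact hsum.tsum_le_tsum hle hs

lemma abs_coeff_mul_wt_nonneg (c : Series) (d : Fin 2 →₀ ℕ) : 0 ≤ |coeff d c| * wt d :=
  mul_nonneg (abs_nonneg _) (wt_pos d).le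

lemma abs_coeff_mul_mul_wt_le (a b : Series) (d : Fin 2 →₀ ℕ) : |coeff d (a * b)| * wt d ≤
    ∑ kl ∈ antidiagonal d, (|coeff kl.1 a| * wt kl.1) * (|coeff kl.2 b| * wt kl.2) := by
  rw [coeff_mul]
  refine (mul_le_mul_of_nonneg_right (abs_sum_le_sum_abs _ _) (wt_pos d).le).trans ?_
  rw [Finset.sum_mul]
  refine Finset.sum_le_sum fun kl hkl => ?_
  rw [← mem_antidiagonal.1 hkl, abs_mul, mul_mul_mul_comm]
  exact mul_le_mul_of_nonneg_left (wt_add_le _ _) (mul_nonneg (abs_nonneg _) (abs_nonneg _))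

/-- The weighted norm of a product is summable, with the expected bound. -/
lemma summable_mul_wt {a b : Series} (ha : Summable fun d => |coeff d a| * wt d)
    (hb : Summable fun d => |coeff d b| * wt d) :
    (Summable fun d => |coeff d (a * b)| * wt d) ∧
      ∑' d, |coeff d (a * b)| * wt d ≤
        (∑' d, |coeff d a| * wt d) * ∑' d, |coeff d b| * wt d :=
  summable_of_le_antidiagonal ha hb (abs_coeff_mul_wt_nonneg a) (abs_coeff_mul_wt_nonneg b)
    (abs_coeff_mul_wt_nonneg _) (abs_coeff_mul_mul_wt_le a b)

/-- The power series with finite weighted `ℓ¹` norm. -/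
noncomputable def weightedSubalgebra : Subalgebra ℝ Series where
  carrier := {c | Summable fun d => |coeff d c| * wt d}
  mul_mem' := fun ha hb => (summable_mul_wt ha hb).1
  add_mem' := by
    intro a b ha hb
    refine Summable.of_nonneg_of_le (fun d => mul_nonneg (abs_nonneg _) (wt_pos d).le) (fun d => ?_)
      (Summable.add ha hb)
    rw [map_add, ← add_mul]
    exact mul_le_mul_of_nonneg_right (abs_add_le _ _) (wt_pos d).le
  algebraMap_mem' := by
    intro r
    refine summable_of_ne_finset_zero (s := {0}) fun d hd => ?_
    have hd' : d ≠ 0 := by simpa using hd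
    rw [MvPowerSeries.algebraMap_apply, Algebra.algebraMap_self, RingHom.id_apply, coeff_C]
    simp [hd']

/-- The Banach algebra of power series with finite weighted `ℓ¹` norm. -/
def WS : Type := weightedSubalgebra

namespace WS

noncomputable instance : CommRing WS := inferInstanceAs (CommRing weightedSubalgebra)

noncomputable instance : Algebra ℝ WS := inferInstanceAs (Algebra ℝ weightedSubalgebra)

/-- The underlying power series. -/
noncomputable def val : WS →ₐ[ℝ] Series := weightedSubalgebra.val

lemma summable (c : WS) : Summable fun d => |coeff d c.val| * wt d := c.2

/-- A power series with finite weighted norm. -/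
def mk (c : Series) (h : Summable fun d => |coeff d c| * wt d) : WS := ⟨c, h⟩

@[simp] lemma val_mk (c : Series) (h : Summable fun d => |coeff d c| * wt d) : (mk c h).val = c := rfl

lemma val_injective : Function.Injective val := Subtype.val_injective

/-- The weighted norm. -/
noncomputable def groupNorm : AddGroupNorm WS where
  toFun c := ∑' d, |coeff d c.val| * wt d
  map_zero' := by simp
  add_le' := by
    intro a b
    rw [← a.summable.tsum_add b.summable]
    refine Summable.tsum_le_tsum (fun d => ?_) (a + b).summable (a.summable.add b.summable)
    rw [map_add, map_add, ← add_mul]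
    exact mul_le_mul_of_nonneg_right (abs_add_le _ _) (wt_pos d).le
  neg' := by simp
  eq_zero_of_map_eq_zero' := by
    intro c hc
    apply val_injective
    ext d
    have h := c.summable.le_tsum d fun e _ => mul_nonneg (abs_nonneg _) (wt_pos e).le
    rw [hc] at h
    have h2 : |coeff d c.val| ≤ 0 := nonpos_of_mul_nonpos_left h (wt_pos d)
    simpa using h2

noncomputable instance : NormedAddCommGroup WS := groupNorm.toNormedAddCommGroup

noncomputable instance : NormedCommRing WS :=
  { (inferInstance : CommRing WS), (inferInstance : NormedAddCommGroup WS) with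
    norm_mul_le := fun a b => by
      have h := (summable_mul_wt a.summable b.summable).2
      rw [← map_mul] at h
      exact h }

lemma norm_def (c : WS) : ‖c‖ = ∑' d, |coeff d c.val| * wt d := rfl


noncomputable instance : NormedAlgebra ℝ WS :=
  { (inferInstance : Algebra ℝ WS) with
    norm_smul_le := fun r c => by
      rw [norm_def c, norm_def (r • c), Real.norm_eq_abs, ← tsum_mul_left]
      refine le_of_eq (tsum_congr fun d => ?_)
      rw [map_smul, map_smul, smul_eq_mul, abs_mul, mul_assoc] }

/-- The weighted norm identifies the algebra with `ℓ¹`. -/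
noncomputable def toLp (c : WS) : lp (fun _ : Fin 2 →₀ ℕ => ℝ) 1 :=
  ⟨fun d => coeff d c.val * wt d, by
    refine memℓp_gen ?_
    simpa [abs_mul, abs_of_pos (wt_pos _)] using c.summable⟩

lemma toLp_apply (c : WS) (d : Fin 2 →₀ ℕ) : toLp c d = coeff d c.val * wt d := rfl

lemma isometry_toLp : Isometry toLp := by
  refine Isometry.of_dist_eq fun a b => ?_
  rw [dist_eq_norm a b, dist_eq_norm, lp.norm_eq_tsum_rpow (by simp), norm_def (a - b)]
  simp only [ENNReal.toReal_one, Real.rpow_one, ne_eq, one_ne_zero, not_false_eq_true, div_self]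
  refine tsum_congr fun d => ?_
  rw [lp.coeFn_sub, Pi.sub_apply, toLp_apply, toLp_apply, ← sub_mul, norm_mul, Real.norm_eq_abs,
    Real.norm_of_nonneg (wt_pos d).le, map_sub, map_sub]

lemma surjective_toLp : Function.Surjective toLp := by
  intro x
  have hx := (lp.memℓp x).summable (by simp)
  simp only [ENNReal.toReal_one, Real.rpow_one] at hx
  let c : Series := fun d => x d / wt d
  have hc : ∀ d, coeff d c * wt d = x d := fun d => div_mul_cancel₀ _ (wt_pos d).ne'
  refine ⟨mk c (hx.congr fun d => ?_), ?_⟩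
  · rw [← hc, norm_mul, Real.norm_eq_abs, Real.norm_of_nonneg (wt_pos d).le]
  · ext d
    exact hc d

/-- Completeness, inherited from `ℓ¹`, is what allows the implicit function theorem to be used in
this algebra. -/
instance : CompleteSpace WS := by
  rw [completeSpace_iff_isComplete_range isometry_toLp.isUniformInducing,
    surjective_toLp.range_eq]
  exact isComplete_univ

lemma convergesOn (c : WS) : ConvergesOn (1 / 2) c.val :=
  Summable.of_nonneg_of_le (fun d => by positivity)
    (fun d => mul_le_mul_of_nonneg_left (half_pow_le_wt d) (abs_nonneg _)) c.summable

/-- A power series convergent on the unit bidisc, as an element of the algebra. -/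
def ofConvergesOn {c : Series} (h : ConvergesOn 1 c) : WS :=
  mk c (Summable.of_nonneg_of_le (fun d => mul_nonneg (abs_nonneg _) (wt_pos d).le) (fun d => by
    rw [one_pow]
    exact mul_le_mul_of_nonneg_left (wt_le_one d) (abs_nonneg _)) h)

/-- Evaluation at a point of the disc of radius `1 / 2`. -/
noncomputable def eval (c : WS) (x : Plane) : ℝ := ev c.val x

lemma eval_add (a b : WS) {x : Plane} (hx : ‖x‖ ≤ 1 / 2) : (a + b).eval x = a.eval x + b.eval x := by
  rw [eval, eval, eval, ev, ev, ev,
    ← (a.convergesOn.summable hx).tsum_add (b.convergesOn.summable hx)]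
  exact tsum_congr fun d => by rw [map_add, map_add, add_mul]

lemma eval_smul (r : ℝ) (a : WS) (x : Plane) : (r • a).eval x = r * a.eval x := by
  rw [eval, eval, ev, ev, ← tsum_mul_left]
  exact tsum_congr fun d => by rw [map_smul, map_smul, smul_eq_mul, mul_assoc]

lemma eval_mul (a b : WS) {x : Plane} (hx : ‖x‖ ≤ 1 / 2) : (a * b).eval x = a.eval x * b.eval x := by
  have ha := a.convergesOn.summable hx
  have hb := b.convergesOn.summable hx
  rw [eval, eval, eval, ev, ev, ev, ha.tsum_mul_tsum_eq_tsum_sum_antidiagonal hb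
    (summable_mul_of_summable_norm ha.norm hb.norm)]
  refine tsum_congr fun d => ?_
  rw [map_mul, coeff_mul, Finset.sum_mul]
  refine Finset.sum_congr rfl fun kl hkl => ?_
  rw [← mem_antidiagonal.1 hkl, monom_add]
  ring

lemma eval_one (x : Plane) : (1 : WS).eval x = 1 := by
  rw [eval, map_one, ev, tsum_eq_single 0]
  · simp [monom]
  · intro d hd
    simp [coeff_one, hd]

lemma eval_zero (x : Plane) : (0 : WS).eval x = 0 := by
  simp [eval, ev]

/-- Evaluation at a point of the disc of radius `1 / 2` as a ring homomorphism. -/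
noncomputable def evalHom (x : Plane) (hx : ‖x‖ ≤ 1 / 2) : WS →+* ℝ where
  toFun c := c.eval x
  map_one' := eval_one x
  map_mul' a b := eval_mul a b hx
  map_zero' := eval_zero x
  map_add' a b := eval_add a b hx

lemma eval_sub (a b : WS) {x : Plane} (hx : ‖x‖ ≤ 1 / 2) : (a - b).eval x = a.eval x - b.eval x :=
  map_sub (evalHom x hx) a b

lemma eval_sum {ι : Type*} (s : Finset ι) (a : ι → WS) {x : Plane} (hx : ‖x‖ ≤ 1 / 2) :
    (∑ i ∈ s, a i).eval x = ∑ i ∈ s, (a i).eval x :=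
  map_sum (evalHom x hx) a s

lemma eval_inverse {a : WS} (ha : IsUnit a) {x : Plane} (hx : ‖x‖ ≤ 1 / 2) :
    (Ring.inverse a).eval x = (a.eval x)⁻¹ := by
  refine eq_inv_of_mul_eq_one_left ?_
  rw [← eval_mul _ _ hx, Ring.inverse_mul_cancel _ ha, eval_one]

lemma analyticAt_eval (a : WS) {x : Plane} (hx : ‖x‖ < 1 / 2) : AnalyticAt ℝ a.eval x :=
  a.convergesOn.analyticAt hx

lemma eq_of_eval_eq {a b : WS} (h : a.eval =ᶠ[𝓝 0] b.eval) : a = b := by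
  have hb : ∀ᶠ x : Plane in 𝓝 0, ‖x‖ < 1 / 2 := by
    filter_upwards [Metric.ball_mem_nhds (0 : Plane) (by norm_num : (0 : ℝ) < 1 / 2)] with x hx
    simpa using hx
  have h0 : (a - b).val = 0 := by
    refine (a - b).convergesOn.eq_zero (by norm_num) ?_
    filter_upwards [h, hb] with x hx hx'
    have := eval_sub a b hx'.le
    rw [hx, sub_self] at this
    exact this
  rw [map_sub, sub_eq_zero] at h0
  exact val_injective h0

/-! ### Operators -/

/-- Formal primitive in the second variable. -/
noncomputable def primitiveSeries : Series →ₗ[ℝ] Series where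
  toFun c := fun d => if d 1 = 0 then 0 else coeff (d - Finsupp.single 1 1) c / d 1
  map_add' a b := by
    ext d
    change (if d 1 = 0 then (0 : ℝ) else _) = (if d 1 = 0 then (0 : ℝ) else _) + if d 1 = 0 then (0 : ℝ) else _
    split_ifs
    · simp
    · rw [map_add, add_div]
  map_smul' r a := by
    ext d
    change (if d 1 = 0 then (0 : ℝ) else _) = r * if d 1 = 0 then (0 : ℝ) else _
    split_ifs
    · simp
    · rw [map_smul, smul_eq_mul, mul_div_assoc]

lemma coeff_primitiveSeries (c : Series) (d : Fin 2 →₀ ℕ) :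
    coeff d (primitiveSeries c) = if d 1 = 0 then 0 else coeff (d - Finsupp.single 1 1) c / d 1 := rfl

lemma coeff_primitiveSeries_add (c : Series) (d : Fin 2 →₀ ℕ) :
    coeff (d + Finsupp.single 1 1) (primitiveSeries c) = coeff d c / (d 1 + 1) := by
  rw [coeff_primitiveSeries, add_tsub_cancel_right]
  simp

/-- The weighted norm of a primitive in terms of shifted coefficients. -/
lemma hasSum_primitive {c : Series} {a : ℝ}
    (h : HasSum (fun d : Fin 2 →₀ ℕ => |coeff d c| / (d 1 + 1) * wt (d + Finsupp.single 1 1)) a) :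
    HasSum (fun d => |coeff d (primitiveSeries c)| * wt d) a := by
  rw [← (add_single_injective 1).hasSum_iff]
  · refine h.congr_fun fun d => ?_
    simp only [Function.comp, coeff_primitiveSeries_add, abs_div]
    rw [abs_of_pos (by positivity : (0 : ℝ) < d 1 + 1)]
  · intro d hd
    have : d 1 = 0 := by
      by_contra h1
      exact hd ⟨d - Finsupp.single 1 1, (eq_add_single h1).symm⟩
    simp [coeff_primitiveSeries, this]

lemma primitive_aux (c : WS) :
    (Summable fun d => |coeff d (primitiveSeries c.val)| * wt d) ∧
      ∑' d, |coeff d (primitiveSeries c.val)| * wt d ≤ 1 * ‖c‖ := by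
  have hle : ∀ d : Fin 2 →₀ ℕ, |coeff d c.val| / (d 1 + 1) * wt (d + Finsupp.single 1 1) ≤
      |coeff d c.val| * wt d := by
    intro d
    have h1 : wt (d + Finsupp.single 1 1) ≤ wt d := (wt_add_le _ _).trans
      (mul_le_of_le_one_right (wt_pos d).le (wt_le_one _))
    have h2 : |coeff d c.val| / (d 1 + 1) ≤ |coeff d c.val| :=
      div_le_self (abs_nonneg _) (by simp)
    exact mul_le_mul h2 h1 (wt_pos _).le (abs_nonneg _)
  have hs : Summable fun d : Fin 2 →₀ ℕ =>
      |coeff d c.val| / (d 1 + 1) * wt (d + Finsupp.single 1 1) :=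
    Summable.of_nonneg_of_le (fun d => mul_nonneg (by positivity) (wt_pos _).le) hle c.summable
  have h := hasSum_primitive hs.hasSum
  refine ⟨h.summable, ?_⟩
  rw [h.tsum_eq, one_mul]
  exact hs.tsum_le_tsum hle c.summable

/-- The primitive in the second variable, as a bounded operator. -/
noncomputable def primitive : WS →L[ℝ] WS :=
  LinearMap.mkContinuous
    { toFun := fun c => mk (primitiveSeries c.val) (primitive_aux c).1
      map_add' := fun a b => val_injective (by simp)
      map_smul' := fun r a => val_injective (by simp) } 1 fun c => (primitive_aux c).2

@[simp] lemma val_primitive (c : WS) : (primitive c).val = primitiveSeries c.val := rfl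

/-- No derivative is lost: by `wt_add_single_one_mul` the norm of the image is the part of the norm
of `c` carried by the exponents of positive degree in `u`. -/
lemma transfer_aux (c : WS) :
    (Summable fun d => |coeff d (primitiveSeries (pderiv ℝ 0 c.val))| * wt d) ∧
      ∑' d, |coeff d (primitiveSeries (pderiv ℝ 0 c.val))| * wt d ≤ 1 * ‖c‖ := by
  have heq : ∀ d : Fin 2 →₀ ℕ, |coeff (d + Finsupp.single 0 1) c.val| * wt (d + Finsupp.single 0 1) =
      |coeff d (pderiv ℝ 0 c.val)| / (d 1 + 1) * wt (d + Finsupp.single 1 1) := by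
    intro d
    rw [← wt_add_single_one_mul, coeff_pderiv, abs_mul,
      abs_of_pos (by positivity : (0 : ℝ) < (d 0 : ℝ) + 1)]
    ring
  have hs := c.summable.comp_injective (add_single_injective 0)
  have h := hasSum_primitive (hs.hasSum.congr_fun fun d => (heq d).symm)
  refine ⟨h.summable, ?_⟩
  rw [h.tsum_eq, one_mul]
  exact tsum_comp_le_tsum_of_inj c.summable (fun d => mul_nonneg (abs_nonneg _) (wt_pos d).le)
    (add_single_injective 0)

/-- The operator `∂_v⁻¹ ∂_u`, which is bounded for the weighted norm. -/
noncomputable def transfer : WS →L[ℝ] WS :=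
  LinearMap.mkContinuous
    { toFun := fun c => mk (primitiveSeries (pderiv ℝ 0 c.val)) (transfer_aux c).1
      map_add' := fun a b => val_injective (by simp)
      map_smul' := fun r a => val_injective (by simp) } 1 fun c => (transfer_aux c).2

@[simp] lemma val_transfer (c : WS) : (transfer c).val = primitiveSeries (pderiv ℝ 0 c.val) := rfl

lemma pderiv_primitiveSeries (c : Series) : pderiv ℝ 1 (primitiveSeries c) = c := by
  ext d
  rw [coeff_pderiv, coeff_primitiveSeries_add]
  field_simp

/-! ### Rescaling in the second variable. -/

/-- Formal substitution `v ↦ εv`. -/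
noncomputable def scaleSeries (ε : ℝ) (c : Series) : Series := fun d => coeff d c * ε ^ d 1

lemma coeff_scaleSeries (ε : ℝ) (c : Series) (d : Fin 2 →₀ ℕ) :
    coeff d (scaleSeries ε c) = coeff d c * ε ^ d 1 := rfl

/-- Since `0 ^ 0 = 1`, the substitution with `ε = 0` is restriction to the axis `v = 0`, extended
independently of `v`. This is then the fundamental theorem of calculus in `v`. -/
lemma eq_add_primitiveSeries (c : Series) :
    c = scaleSeries 0 c + primitiveSeries (pderiv ℝ 1 c) := by
  ext d
  rw [map_add, coeff_scaleSeries, coeff_primitiveSeries]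
  split_ifs with h
  · simp [h]
  · rw [coeff_pderiv, ← eq_add_single h]
    have h1 : (((d - Finsupp.single 1 1 : Fin 2 →₀ ℕ) 1 : ℕ) : ℝ) + 1 = d 1 := by
      conv_rhs => rw [eq_add_single h]
      simp
    have h2 : (d 1 : ℝ) ≠ 0 := by exact_mod_cast h
    rw [h1]
    field_simp
    simp [h]

/-- The unit interval clamp of a real number. -/
noncomputable def clamp (ε : ℝ) : ℝ := max 0 (min ε 1)

lemma clamp_nonneg (ε : ℝ) : 0 ≤ clamp ε := le_max_left _ _

lemma clamp_le_one (ε : ℝ) : clamp ε ≤ 1 := max_le zero_le_one (min_le_right _ _)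

lemma clamp_of_mem {ε : ℝ} (h0 : 0 ≤ ε) (h1 : ε ≤ 1) : clamp ε = ε := by
  rw [clamp, min_eq_left h1, max_eq_right h0]

lemma clamp_le_abs (ε : ℝ) : clamp ε ≤ |ε| :=
  max_le (abs_nonneg _) ((min_le_left _ _).trans (le_abs_self _))

/-- The substitution `v ↦ εv`, for `ε` in the unit interval. -/
noncomputable def scale (ε : ℝ) (c : WS) : WS :=
  mk (scaleSeries (clamp ε) c.val) (Summable.of_nonneg_of_le
    (fun d => mul_nonneg (abs_nonneg _) (wt_pos d).le) (fun d => by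
      rw [coeff_scaleSeries, abs_mul, abs_of_nonneg (pow_nonneg (clamp_nonneg ε) _)]
      exact mul_le_mul_of_nonneg_right (mul_le_of_le_one_right (abs_nonneg _)
        (pow_le_one₀ (clamp_nonneg ε) (clamp_le_one ε))) (wt_pos d).le) c.summable)

@[simp] lemma val_scale (ε : ℝ) (c : WS) : (scale ε c).val = scaleSeries (clamp ε) c.val := rfl

/-- Terms free of `v` cancel, and every other term carries at least one factor `ε`. Thanks to the
clamp the bound holds for all real `ε`, so limits can be taken over full neighbourhoods of `0`. -/
lemma norm_scale_sub_le (ε : ℝ) (c : WS) : ‖scale ε c - scale 0 c‖ ≤ |ε| * ‖c‖ := by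
  rw [norm_def, norm_def, ← tsum_mul_left]
  refine Summable.tsum_le_tsum (fun d => ?_) (summable _) (c.summable.mul_left _)
  rw [map_sub, map_sub, val_scale, val_scale, coeff_scaleSeries, coeff_scaleSeries, ← mul_sub,
    abs_mul, mul_comm |coeff d c.val|, mul_assoc]
  refine mul_le_mul_of_nonneg_right ?_ (mul_nonneg (abs_nonneg _) (wt_pos d).le)
  rw [clamp_of_mem le_rfl zero_le_one]
  rcases Nat.eq_zero_or_pos (d 1) with h | h
  · simp [h]
  · rw [zero_pow h.ne', sub_zero, abs_of_nonneg (pow_nonneg (clamp_nonneg ε) _)]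
    exact (pow_le_of_le_one (clamp_nonneg ε) (clamp_le_one ε) h.ne').trans (clamp_le_abs ε)

lemma tendsto_scale (c : WS) : Tendsto (fun ε => scale ε c) (𝓝 0) (𝓝 (scale 0 c)) := by
  rw [tendsto_iff_norm_sub_tendsto_zero]
  refine squeeze_zero (fun _ => norm_nonneg _) (fun ε => norm_scale_sub_le ε c) ?_
  have : Tendsto (fun ε : ℝ => |ε| * ‖c‖) (𝓝 0) (𝓝 (|0| * ‖c‖)) :=
    (continuous_abs.mul continuous_const).tendsto 0
  simpa using this

lemma eval_scale {ε : ℝ} (h0 : 0 ≤ ε) (h1 : ε ≤ 1) (c : WS) (x : Plane) :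
    (scale ε c).eval x = c.eval !₂[x 0, ε * x 1] := by
  rw [eval, eval, ev, ev]
  refine tsum_congr fun d => ?_
  rw [val_scale, coeff_scaleSeries, clamp_of_mem h0 h1]
  simp [monom, mul_pow]
  ring

lemma scale_zero_scale (ε : ℝ) (c : WS) : scale 0 (scale ε c) = scale 0 c := by
  apply val_injective
  ext d
  rw [val_scale, val_scale, val_scale, coeff_scaleSeries, coeff_scaleSeries, coeff_scaleSeries,
    clamp_of_mem le_rfl zero_le_one]
  rcases Nat.eq_zero_or_pos (d 1) with h | h
  · simp [h]
  · simp [h.ne']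

lemma eval_primitive_axis (c : Series) {x : Plane} (hx : x 1 = 0) : ev (primitiveSeries c) x = 0 := by
  rw [ev]
  refine (tsum_congr fun d => ?_).trans tsum_zero
  rw [coeff_primitiveSeries]
  split_ifs with h
  · simp
  · simp [monom, hx, h]

end WS

end KossowskiMetrics

namespace KossowskiMetrics

open MvPowerSeries Finset Filter

/-! ### Analytic functions as elements of the algebra -/

lemma eventually_norm_lt {R : ℝ} (hR : 0 < R) : ∀ᶠ x : Plane in 𝓝 0, ‖x‖ < R := by
  filter_upwards [Metric.ball_mem_nhds (0 : Plane) hR] with x hx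
  simpa using hx

/-- The diagonal linear automorphism with given entries. -/
noncomputable def diagEquiv (a b : ℝ) (ha : a ≠ 0) (hb : b ≠ 0) : Plane ≃L[ℝ] Plane :=
  LinearEquiv.toContinuousLinearEquiv
    { toFun := fun x => !₂[a * x 0, b * x 1]
      invFun := fun x => !₂[a⁻¹ * x 0, b⁻¹ * x 1]
      map_add' := fun x y => by ext i; fin_cases i <;> simp [mul_add]
      map_smul' := fun r x => by ext i; fin_cases i <;> simp [mul_left_comm]
      left_inv := fun x => by ext i; fin_cases i <;> simp [ha, hb]
      right_inv := fun x => by ext i; fin_cases i <;> simp [ha, hb] }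

lemma diagEquiv_apply {a b : ℝ} (ha : a ≠ 0) (hb : b ≠ 0) (x : Plane) :
    diagEquiv a b ha hb x = !₂[a * x 0, b * x 1] := rfl

lemma diagEquiv_coordVec {a b : ℝ} (ha : a ≠ 0) (hb : b ≠ 0) (i : Fin 2) :
    diagEquiv a b ha hb (coordVec i) = (if i = 0 then a else b) • coordVec i := by
  rw [diagEquiv_apply]
  ext j
  fin_cases i <;> fin_cases j <;> simp [coordVec]

lemma pder_comp_diagEquiv {a b : ℝ} (ha : a ≠ 0) (hb : b ≠ 0) (φ : Plane → ℝ) (i : Fin 2)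
    (x : Plane) : pder i (fun y => φ (diagEquiv a b ha hb y)) x =
      (if i = 0 then a else b) * pder i φ (diagEquiv a b ha hb x) := by
  have h := (diagEquiv a b ha hb).comp_right_fderiv (f := φ) (x := x)
  rw [pder, show (fun y => φ (diagEquiv a b ha hb y)) = φ ∘ diagEquiv a b ha hb from rfl, h, pder,
    ContinuousLinearMap.comp_apply, ContinuousLinearEquiv.coe_coe, diagEquiv_coordVec, map_smul,
    smul_eq_mul]

lemma tendsto_diagEquiv {a b : ℝ} (ha : a ≠ 0) (hb : b ≠ 0) :
    Tendsto (diagEquiv a b ha hb) (𝓝 0) (𝓝 0) := by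
  have := (diagEquiv a b ha hb).continuous.tendsto 0
  rwa [map_zero] at this

lemma pder_congr {V : Type*} [NormedAddCommGroup V] [NormedSpace ℝ V] {F G : Plane → V} {x : Plane}
    (h : F =ᶠ[𝓝 x] G) (i : Fin 2) : pder i F x = pder i G x := by
  rw [pder, pder, Filter.EventuallyEq.fderiv_eq h]

/-- `c` represents the germ at the origin of `x ↦ φ (ρ x)`. -/
def Represents (ρ : ℝ) (φ : Plane → ℝ) (c : WS) : Prop := ∀ᶠ x : Plane in 𝓝 0, φ (ρ • x) = c.eval x

/-- Replacing `x` by `ρ x` multiplies a coefficient by `ρ ^ deg`, so convergence on the disc of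
radius `ρ` becomes convergence on the unit disc, which suffices for membership in the algebra. -/
lemma eventually_exists_represents {φ : Plane → ℝ} (hφ : AnalyticAt ℝ φ 0) :
    ∀ᶠ ρ in 𝓝[>] (0 : ℝ), ∃ c, Represents ρ φ c := by
  obtain ⟨R, hR, c, hc, hφc⟩ := exists_series_of_analyticAt hφ
  filter_upwards [Ioc_mem_nhdsGT hR] with ρ hρ
  let c' : Series := fun d => coeff d c * ρ ^ deg d
  have hc' : ∀ d, coeff d c' = coeff d c * ρ ^ deg d := fun d => rfl
  have h1 : ConvergesOn 1 c' := by
    refine (hc.mono hρ.1.le hρ.2).congr fun d => ?_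
    rw [hc', one_pow, mul_one, abs_mul, abs_of_nonneg (pow_nonneg hρ.1.le _)]
  refine ⟨WS.ofConvergesOn h1, ?_⟩
  filter_upwards [eventually_norm_lt one_pos] with x hx
  have hx' : ‖ρ • x‖ ≤ R := by
    rw [norm_smul, Real.norm_of_nonneg hρ.1.le]
    calc ρ * ‖x‖ ≤ ρ * 1 := mul_le_mul_of_nonneg_left hx.le hρ.1.le
      _ ≤ R := by rw [mul_one]; exact hρ.2
  rw [hφc _ hx', ev, WS.eval, ev]
  refine tsum_congr fun d => ?_
  rw [show coeff d (WS.ofConvergesOn h1).val = coeff d c * ρ ^ deg d from rfl]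
  simp only [monom, deg, PiLp.smul_apply, smul_eq_mul, mul_pow, pow_add]
  ring

lemma Represents.comp {ρ : ℝ} {φ : Plane → ℝ} {c : WS} (h : Represents ρ φ c) (hρ : ρ ≠ 0) :
    ∀ᶠ x : Plane in 𝓝 0, φ x = c.eval (ρ⁻¹ • x) := by
  have ht : Tendsto (fun x : Plane => ρ⁻¹ • x) (𝓝 0) (𝓝 0) := by
    have := (continuous_const_smul ρ⁻¹).tendsto (0 : Plane)
    rwa [smul_zero] at this
  filter_upwards [ht.eventually h] with x hx
  rw [← hx, smul_inv_smul₀ hρ]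

lemma pderiv_scaleSeries_zero (c : Series) : pderiv ℝ 1 (WS.scaleSeries 0 c) = 0 := by
  ext d
  rw [coeff_pderiv, WS.coeff_scaleSeries]
  simp

lemma ConvergesOn.ev_add {R : ℝ} {a b : Series} (ha : ConvergesOn R a) (hb : ConvergesOn R b)
    {x : Plane} (hx : ‖x‖ ≤ R) : ev (a + b) x = ev a x + ev b x := by
  rw [ev, ev, ev, ← (ha.summable hx).tsum_add (hb.summable hx)]
  exact tsum_congr fun d => by rw [map_add, add_mul]

lemma ev_smul (r : ℝ) (a : Series) (x : Plane) : ev (r • a) x = r * ev a x := by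
  rw [ev, ev, ← tsum_mul_left]
  exact tsum_congr fun d => by rw [map_smul, smul_eq_mul, mul_assoc]

lemma ConvergesOn.add {R : ℝ} (hR : 0 ≤ R) {a b : Series} (ha : ConvergesOn R a)
    (hb : ConvergesOn R b) : ConvergesOn R (a + b) := by
  refine Summable.of_nonneg_of_le (fun d => by positivity) (fun d => ?_) (Summable.add ha hb)
  rw [map_add, ← add_mul]
  exact mul_le_mul_of_nonneg_right (abs_add_le _ _) (by positivity)

lemma ConvergesOn.smul {R : ℝ} (r : ℝ) {a : Series} (ha : ConvergesOn R a) :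
    ConvergesOn R (r • a) := by
  refine (Summable.mul_left |r| ha).congr fun d => ?_
  rw [map_smul, smul_eq_mul, abs_mul, mul_assoc]

lemma WS.pder_eval (c : WS) (i : Fin 2) {x : Plane} (hx : ‖x‖ < 1 / 2) :
    pder i c.eval x = ev (MvPowerSeries.pderiv ℝ i c.val) x := c.convergesOn.pder_ev i hx

lemma WS.convergesOn_pderiv (c : WS) (i : Fin 2) :
    ConvergesOn (1 / 4) (MvPowerSeries.pderiv ℝ i c.val) :=
  c.convergesOn.pderiv (by norm_num) (by norm_num) i

/-- The first order equation `∂_v X = ε ∂_u P + δ Q` in integrated form. -/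
lemma WS.eq_of_pder_eq {X P Q : WS} {ε δ : ℝ}
    (h : ∀ᶠ x : Plane in 𝓝 0, pder 1 X.eval x = ε * pder 0 P.eval x + δ * Q.eval x) :
    X = WS.scale 0 X + ε • WS.transfer P + δ • WS.primitive Q := by
  have hX := X.convergesOn_pderiv 1
  have hP := (P.convergesOn_pderiv 0).smul (-ε)
  have hQ := (Q.convergesOn.mono (by norm_num) (by norm_num : (1 / 4 : ℝ) ≤ 1 / 2)).smul (-δ)
  have h4 : (0 : ℝ) ≤ 1 / 4 := by norm_num
  have h0 := ((hX.add h4 hP).add h4 hQ).eq_zero (by norm_num) (by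
    filter_upwards [h, eventually_norm_lt (by norm_num : (0 : ℝ) < 1 / 4)] with x hx hxR
    rw [(hX.add h4 hP).ev_add hQ hxR.le, hX.ev_add hP hxR.le, ev_smul, ev_smul,
      ← X.pder_eval 1 (hxR.trans (by norm_num)), ← P.pder_eval 0 (hxR.trans (by norm_num)), hx]
    simp only [WS.eval, Pi.zero_apply]
    ring)
  have h1 : MvPowerSeries.pderiv ℝ 1 X.val = ε • MvPowerSeries.pderiv ℝ 0 P.val + δ • Q.val := by
    rw [neg_smul, neg_smul] at h0
    linear_combination (exp := 1) h0
  apply WS.val_injective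
  conv_lhs => rw [WS.eq_add_primitiveSeries X.val, h1, map_add, map_smul, map_smul]
  rw [map_add, map_add, map_smul, map_smul, WS.val_scale, WS.val_transfer, WS.val_primitive,
    WS.clamp_of_mem le_rfl zero_le_one, add_assoc]

lemma WS.pder_eq_of_eq {X Y P Q : WS} {ε δ : ℝ}
    (h : X = WS.scale 0 Y + ε • WS.transfer P + δ • WS.primitive Q) {x : Plane}
    (hx : ‖x‖ < 1 / 4) : pder 1 X.eval x = ε * pder 0 P.eval x + δ * Q.eval x := by
  have h1 : MvPowerSeries.pderiv ℝ 1 X.val = ε • MvPowerSeries.pderiv ℝ 0 P.val + δ • Q.val := by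
    have hv : X.val = WS.scaleSeries 0 Y.val + ε • WS.primitiveSeries (MvPowerSeries.pderiv ℝ 0 P.val)
        + δ • WS.primitiveSeries Q.val := by
      rw [h, map_add, map_add, map_smul, map_smul, WS.val_scale, WS.val_transfer, WS.val_primitive,
        WS.clamp_of_mem le_rfl zero_le_one]
    rw [hv, map_add, map_add, pderiv_scaleSeries_zero,
      Derivation.map_smul, Derivation.map_smul, WS.pderiv_primitiveSeries,
      WS.pderiv_primitiveSeries, zero_add]
  have hP := (P.convergesOn_pderiv 0).smul ε
  have hQ := (Q.convergesOn.mono (by norm_num) (by norm_num : (1 / 4 : ℝ) ≤ 1 / 2)).smul δ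
  rw [X.pder_eval 1 (hx.trans (by norm_num)), P.pder_eval 0 (hx.trans (by norm_num)), h1,
    hP.ev_add hQ hx.le, ev_smul, ev_smul]
  rfl

/-! ### The Cauchy–Kovalevskaya theorem for systems in divergence form -/

/-- At the base parameter the equation is a translation of the unknown, so the partial derivative
there is the identity and invertibility is automatic. The equivalence in the conclusion carries the
uniqueness. -/
lemma exists_implicit_function {X Y : Type*} [NormedAddCommGroup X] [NormedSpace ℝ X]
    [CompleteSpace X] [NormedAddCommGroup Y] [NormedSpace ℝ Y] [CompleteSpace Y]
    (G : Y × X → X) (y₀ : Y) (x₀ : X) (hG : ContDiffAt ℝ 1 G (y₀, x₀))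
    (h0 : ∀ z, G (y₀, z) = z - x₀) :
    ∃ ψ : Y → X, Tendsto ψ (𝓝 y₀) (𝓝 x₀) ∧
      ∀ᶠ v in 𝓝 (y₀, x₀), G v = 0 ↔ ψ v.1 = v.2 := by
  have hs := hG.hasStrictFDerivAt one_ne_zero
  have hid : fderiv ℝ G (y₀, x₀) ∘L .inr ℝ Y X = ContinuousLinearMap.id ℝ X := by
    have h1 : HasFDerivAt (fun z => G (y₀, z)) (fderiv ℝ G (y₀, x₀) ∘L .inr ℝ Y X) x₀ :=
      hs.hasFDerivAt.comp x₀ (hasFDerivAt_prodMk_right y₀ x₀)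
    have h2 : HasFDerivAt (fun z => G (y₀, z)) (ContinuousLinearMap.id ℝ X) x₀ := by
      simp only [h0]
      exact (hasFDerivAt_id x₀).sub_const x₀
    exact h1.unique h2
  have hinv : (fderiv ℝ G (y₀, x₀) ∘L .inr ℝ Y X).IsInvertible := by
    rw [hid]
    exact ⟨ContinuousLinearEquiv.refl ℝ X, rfl⟩
  refine ⟨hs.implicitFunctionOfProdDomain hinv, hs.tendsto_implicitFunctionOfProdDomain hinv, ?_⟩
  have := hs.eventually_apply_eq_iff_implicitFunctionOfProdDomain hinv
  rwa [h0, sub_self] at this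

/-- The data of a system `∂_v U = ∂_u P(c, U) + Q(c, U)` in divergence form, with coefficients
`c`, where `P` and `Q` make sense both for real numbers and for elements of the algebra of
power series. -/
structure DivergenceSystem (κ ι : Type) [Fintype κ] [Fintype ι] where
  /-- The flux, on power series. -/
  fluxSeries : (κ → WS) × (ι → WS) → ι → WS
  /-- The source term, on power series. -/
  sourceSeries : (κ → WS) × (ι → WS) → ι → WS
  /-- The flux. -/
  flux : (κ → ℝ) → (ι → ℝ) → ι → ℝ
  /-- The source term. -/
  source : (κ → ℝ) → (ι → ℝ) → ι → ℝ
  /-- The domain where the flux and the source term on power series are well behaved. -/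
  dom : Set ((κ → WS) × (ι → WS))
  isOpen_dom : IsOpen dom
  contDiffOn_flux : ContDiffOn ℝ 1 fluxSeries dom
  contDiffOn_source : ContDiffOn ℝ 1 sourceSeries dom
  eval_flux : ∀ z ∈ dom, ∀ x : Plane, ‖x‖ ≤ 1 / 2 → ∀ i, (fluxSeries z i).eval x =
    flux (fun k => (z.1 k).eval x) (fun j => (z.2 j).eval x) i
  eval_source : ∀ z ∈ dom, ∀ x : Plane, ‖x‖ ≤ 1 / 2 → ∀ i, (sourceSeries z i).eval x =
    source (fun k => (z.1 k).eval x) (fun j => (z.2 j).eval x) i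

namespace DivergenceSystem

variable {κ ι : Type} [Fintype κ] [Fintype ι] (𝒮 : DivergenceSystem κ ι)

/-- `U` solves the system with coefficients `c` near the origin. -/
def IsSolution (c : κ → Plane → ℝ) (U : ι → Plane → ℝ) : Prop :=
  ∀ i, ∀ᶠ x : Plane in 𝓝 0, pder 1 (U i) x =
    pder 0 (fun y => 𝒮.flux (fun k => c k y) (fun j => U j y) i) x +
      𝒮.source (fun k => c k x) (fun j => U j x) i

/-- The initial values `U` on the axis `v = 0` are admissible for the coefficients `c`. -/
def IsInitial (c : κ → Plane → ℝ) (U : ι → Plane → ℝ) : Prop :=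
  ∀ᶠ ρ in 𝓝[>] (0 : ℝ), ∀ (C : κ → WS) (Y : ι → WS), (∀ k, Represents ρ (c k) (C k)) →
    (∀ j, Represents ρ (U j) (Y j)) →
      ((fun k => WS.scale 0 (C k), fun j => WS.scale 0 (Y j)) : (κ → WS) × (ι → WS)) ∈ 𝒮.dom

/-- The fixed point equation of the scaled system. -/
noncomputable def defect (ρ : ℝ) (Y₀ : ι → WS) (v : (ℝ × (κ → WS)) × (ι → WS)) : ι → WS := fun i =>
  v.2 i - Y₀ i - v.1.1 • WS.transfer (𝒮.fluxSeries (v.1.2, v.2) i) -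
    (v.1.1 * ρ) • WS.primitive (𝒮.sourceSeries (v.1.2, v.2) i)

lemma contDiffAt_defect (ρ : ℝ) (Y₀ : ι → WS) (v : (ℝ × (κ → WS)) × (ι → WS))
    (hv : (v.1.2, v.2) ∈ 𝒮.dom) : ContDiffAt ℝ 1 (𝒮.defect ρ Y₀) v := by
  have hpair : ContDiffAt ℝ 1 (fun v : (ℝ × (κ → WS)) × (ι → WS) => (v.1.2, v.2)) v := by fun_prop
  have hf : ContDiffAt ℝ 1 (fun v : (ℝ × (κ → WS)) × (ι → WS) => 𝒮.fluxSeries (v.1.2, v.2)) v :=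
    (𝒮.contDiffOn_flux.contDiffAt (𝒮.isOpen_dom.mem_nhds hv)).comp v hpair
  have hs : ContDiffAt ℝ 1 (fun v : (ℝ × (κ → WS)) × (ι → WS) => 𝒮.sourceSeries (v.1.2, v.2)) v :=
    (𝒮.contDiffOn_source.contDiffAt (𝒮.isOpen_dom.mem_nhds hv)).comp v hpair
  rw [contDiffAt_pi] at hf hs
  refine contDiffAt_pi.2 fun i => ?_
  have h1 := WS.transfer.contDiff.contDiffAt.comp v (hf i)
  have h2 := WS.primitive.contDiff.contDiffAt.comp v (hs i)
  have h3 : ContDiffAt ℝ 1 (fun v : (ℝ × (κ → WS)) × (ι → WS) => v.1.1) v := by fun_prop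
  have h4 : ContDiffAt ℝ 1 (fun v : (ℝ × (κ → WS)) × (ι → WS) => v.1.1 * ρ) v := by fun_prop
  have h5 : ContDiffAt ℝ 1 (fun v : (ℝ × (κ → WS)) × (ι → WS) => v.2 i - Y₀ i) v := by fun_prop
  exact (h5.sub (h3.smul h1)).sub (h4.smul h2)

/-- The fixed point equation has a unique solution for small parameters. -/
lemma exists_resolvent (ρ : ℝ) (C : κ → WS) (Y₀ : ι → WS)
    (h : ((fun k => WS.scale 0 (C k), Y₀) : (κ → WS) × (ι → WS)) ∈ 𝒮.dom) :
    ∃ Z : ℝ → ι → WS, Tendsto Z (𝓝 0) (𝓝 Y₀) ∧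
      ∀ X : ℝ → ι → WS, Tendsto X (𝓝 0) (𝓝 Y₀) → ∀ᶠ ε in 𝓝 (0 : ℝ),
        (((fun k => WS.scale ε (C k), X ε) : (κ → WS) × (ι → WS)) ∈ 𝒮.dom) ∧
        (𝒮.defect ρ Y₀ ((ε, fun k => WS.scale ε (C k)), X ε) = 0 ↔ Z ε = X ε) := by
  obtain ⟨ψ, hψ, hψ'⟩ := exists_implicit_function (𝒮.defect ρ Y₀) (0, fun k => WS.scale 0 (C k)) Y₀
    (𝒮.contDiffAt_defect ρ Y₀ _ h) (fun z => by ext1 i; simp [defect])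
  have ht : Tendsto (fun ε => fun k => WS.scale ε (C k)) (𝓝 0) (𝓝 fun k => WS.scale 0 (C k)) :=
    tendsto_pi_nhds.2 fun k => WS.tendsto_scale (C k)
  have ht' := (tendsto_id (x := 𝓝 (0 : ℝ))).prodMk_nhds ht
  refine ⟨fun ε => ψ (ε, fun k => WS.scale ε (C k)), hψ.comp ht', fun X hX => ?_⟩
  have h1 := (ht'.prodMk_nhds hX).eventually hψ'
  have h2 := (ht.prodMk_nhds hX).eventually (𝒮.isOpen_dom.mem_nhds h)
  filter_upwards [h1, h2] with ε h1 h2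
  exact ⟨h2, h1⟩

lemma defect_eq_zero_iff (ρ ε : ℝ) (Y₀ : ι → WS) (C : κ → WS) (X : ι → WS) :
    𝒮.defect ρ Y₀ ((ε, C), X) = 0 ↔ ∀ i, X i = Y₀ i + ε • WS.transfer (𝒮.fluxSeries (C, X) i) +
      (ε * ρ) • WS.primitive (𝒮.sourceSeries (C, X) i) := by
  rw [funext_iff]
  refine forall_congr' fun i => ?_
  simp only [defect, Pi.zero_apply]
  rw [sub_sub, sub_sub, sub_eq_zero, add_assoc]

/-- The substitution `(u, v) ↦ (ρ u, ρ ε v)` turns the system into `X = X₀ + ε T(flux) + ε ρ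
V(source)`, where `V` is the primitive in `v` and `T = ∂_v⁻¹ ∂_u`. Both are bounded, so a solution
exists for small `ε`; undoing the substitution at one positive `ε` gives the solution sought. -/
theorem exists_solution {c : κ → Plane → ℝ} (hc : ∀ k, AnalyticAt ℝ (c k) 0)
    {U₀ : ι → Plane → ℝ} (hU₀ : ∀ i, AnalyticAt ℝ (U₀ i) 0) (hI : 𝒮.IsInitial c U₀) :
    ∃ U : ι → Plane → ℝ, (∀ i, AnalyticAt ℝ (U i) 0) ∧ 𝒮.IsSolution c U ∧
      ∀ i, ∀ᶠ x : Plane in 𝓝 0, x 1 = 0 → U i x = U₀ i x := by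
  obtain ⟨ρ, hρ, hC, hY, hρ0⟩ := (hI.and ((eventually_all.2 fun k =>
    eventually_exists_represents (hc k)).and ((eventually_all.2 fun i =>
    eventually_exists_represents (hU₀ i)).and self_mem_nhdsWithin))).exists
  choose C hC using hC
  choose Y hY using hY
  have hρ0' : ρ ≠ 0 := ne_of_gt hρ0
  obtain ⟨Z, hZ, hZ'⟩ := 𝒮.exists_resolvent ρ C _ (hρ C Y hC hY)
  obtain ⟨ε, ⟨hdom, hfix⟩, hε⟩ :=
    (((hZ' Z hZ).filter_mono nhdsWithin_le_nhds).and (Ioc_mem_nhdsGT one_pos)).exists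
  have hε0 : ε ≠ 0 := hε.1.ne'
  have hfix' := (𝒮.defect_eq_zero_iff _ _ _ _ _).1 (hfix.2 rfl)
  set Cε : κ → WS := fun k => WS.scale ε (C k) with hCε
  -- The inverse of the substitution `(u, v) ↦ (ρ u, ρ ε v)`.
  set T := diagEquiv ρ⁻¹ (ρ⁻¹ * ε⁻¹) (inv_ne_zero hρ0') (mul_ne_zero (inv_ne_zero hρ0') (inv_ne_zero hε0))
    with hT
  have hTt : Tendsto T (𝓝 0) (𝓝 0) := tendsto_diagEquiv _ _
  have hsmall : ∀ᶠ x : Plane in 𝓝 0, ‖T x‖ < 1 / 4 :=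
    hTt.eventually (eventually_norm_lt (by norm_num))
  have hcT : ∀ᶠ x : Plane in 𝓝 0, ∀ k, c k x = (Cε k).eval (T x) := by
    refine eventually_all.2 fun k => ?_
    filter_upwards [(hC k).comp hρ0'] with x hx
    rw [hx, hCε, WS.eval_scale hε.1.le hε.2]
    congr 1
    ext i
    fin_cases i
    · simp [hT, diagEquiv_apply]
    · simp [hT, diagEquiv_apply]
      field_simp
  refine ⟨fun i x => (Z ε i).eval (T x), fun i => ?_, fun i => ?_, fun i => ?_⟩
  · have h1 : AnalyticAt ℝ (Z ε i).eval (T 0) :=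
      WS.analyticAt_eval _ (by rw [map_zero, norm_zero]; norm_num)
    exact h1.comp (T.toContinuousLinearMap.analyticAt 0)
  · filter_upwards [hcT.eventually_nhds, hsmall.eventually_nhds] with x hx hxs
    have hxs' := hxs.self_of_nhds
    have hflux : (fun y => 𝒮.flux (fun k => c k y) (fun j => (Z ε j).eval (T y)) i) =ᶠ[𝓝 x]
        fun y => (𝒮.fluxSeries (Cε, Z ε) i).eval (T y) := by
      filter_upwards [hx, hxs] with y hy hys
      rw [𝒮.eval_flux _ hdom _ (hys.le.trans (by norm_num))]
      simp only [hy]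
    have hsource : 𝒮.source (fun k => c k x) (fun j => (Z ε j).eval (T x)) i =
        (𝒮.sourceSeries (Cε, Z ε) i).eval (T x) := by
      rw [𝒮.eval_source _ hdom _ (hxs'.le.trans (by norm_num))]
      simp only [hx.self_of_nhds]
    rw [pder_congr hflux, hsource, pder_comp_diagEquiv, pder_comp_diagEquiv,
      WS.pder_eq_of_eq (hfix' i) hxs']
    simp only [one_ne_zero, if_false, if_true]
    rw [← hT]
    field_simp
  · have hYT := (hY i).comp hρ0'
    filter_upwards [hYT, hsmall] with x hx hxs hx1
    have hTx : (T x) 1 = 0 := by simp [hT, diagEquiv_apply, hx1]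
    have hb : ‖T x‖ ≤ 1 / 2 := hxs.le.trans (by norm_num)
    rw [hfix' i, WS.eval_add _ _ hb, WS.eval_add _ _ hb, WS.eval_smul, WS.eval_smul,
      show (WS.transfer (𝒮.fluxSeries (Cε, Z ε) i)).eval (T x) = 0 from
        WS.eval_primitive_axis _ hTx,
      show (WS.primitive (𝒮.sourceSeries (Cε, Z ε) i)).eval (T x) = 0 from
        WS.eval_primitive_axis _ hTx, WS.eval_scale le_rfl zero_le_one, hx]
    simp only [mul_zero, add_zero, zero_mul]
    congr 1
    ext j
    fin_cases j <;> simp [hT, diagEquiv_apply, hx1]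

/-- A rescaled solution satisfies the same integrated equation and tends to its axis values as `ε →
0`, so for small `ε > 0` it lies on the branch given by the implicit function. Two solutions with
the same axis values therefore agree after rescaling. -/
theorem eventually_eq_of_isSolution {c : κ → Plane → ℝ} (hc : ∀ k, AnalyticAt ℝ (c k) 0)
    {U V : ι → Plane → ℝ} (hU : ∀ i, AnalyticAt ℝ (U i) 0) (hV : ∀ i, AnalyticAt ℝ (V i) 0)
    (hI : 𝒮.IsInitial c U) (hUs : 𝒮.IsSolution c U) (hVs : 𝒮.IsSolution c V)
    (h0 : ∀ i, ∀ᶠ x : Plane in 𝓝 0, x 1 = 0 → U i x = V i x) (i : ι) :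
    U i =ᶠ[𝓝 0] V i := by
  obtain ⟨ρ, hρ, hC, hY, hY', hρ0⟩ := (hI.and ((eventually_all.2 fun k =>
    eventually_exists_represents (hc k)).and ((eventually_all.2 fun i =>
    eventually_exists_represents (hU i)).and ((eventually_all.2 fun i =>
    eventually_exists_represents (hV i)).and self_mem_nhdsWithin)))).exists
  choose C hC using hC
  choose Y hY using hY
  choose Y' hY' using hY'
  have hρ0' : ρ ≠ 0 := ne_of_gt hρ0
  have haxis : ∀ i, WS.scale 0 (Y i) = WS.scale 0 (Y' i) := by
    intro i
    apply WS.eq_of_eval_eq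
    have ht : Tendsto (fun x : Plane => !₂[x 0, 0 * x 1]) (𝓝 0) (𝓝 0) := by
      have hcont : Continuous fun x : Plane => (!₂[x 0, 0 * x 1] : Plane) := by fun_prop
      have := hcont.tendsto 0
      convert this using 2
      ext j
      fin_cases j <;> simp
    have hts : Tendsto (fun x : Plane => ρ • x) (𝓝 0) (𝓝 0) := by
      have := (continuous_const_smul ρ).tendsto (0 : Plane)
      rwa [smul_zero] at this
    -- The hypothesis on the axis is tested at the points `(u, 0)`, which is all that restriction to
    -- the axis sees.
    filter_upwards [ht.eventually (hY i), ht.eventually (hY' i),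
      ht.eventually (hts.eventually (h0 i))] with x h1 h2 h3
    rw [WS.eval_scale le_rfl zero_le_one, WS.eval_scale le_rfl zero_le_one, ← h1, ← h2]
    exact h3 (by simp)
  obtain ⟨Z, hZ, hZ'⟩ := 𝒮.exists_resolvent ρ C _ (hρ C Y hC hY)
  have key : ∀ (W : ι → Plane → ℝ) (X : ι → WS), (∀ i, Represents ρ (W i) (X i)) →
      𝒮.IsSolution c W → (∀ i, WS.scale 0 (Y i) = WS.scale 0 (X i)) →
      ∀ᶠ ε in 𝓝[>] (0 : ℝ), ∀ i, Z ε i = WS.scale ε (X i) := by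
    intro W X hX hW hXY
    have hXt : Tendsto (fun ε => fun i => WS.scale ε (X i)) (𝓝 0) (𝓝 fun i => WS.scale 0 (Y i)) :=
      tendsto_pi_nhds.2 fun i => by rw [hXY i]; exact WS.tendsto_scale (X i)
    filter_upwards [(hZ' _ hXt).filter_mono nhdsWithin_le_nhds, Ioc_mem_nhdsGT one_pos]
      with ε ⟨hdom, hfix⟩ hε
    refine fun i => congrFun (hfix.1 ((𝒮.defect_eq_zero_iff _ _ _ _ _).2 fun i => ?_)) i
    rw [hXY i, ← WS.scale_zero_scale ε]
    apply WS.eq_of_pder_eq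
    have hε0 : ε ≠ 0 := hε.1.ne'
    set S := diagEquiv ρ (ρ * ε) hρ0' (mul_ne_zero hρ0' hε0) with hS
    have hSt : Tendsto S (𝓝 0) (𝓝 0) := tendsto_diagEquiv _ _
    have hrep : ∀ (φ : Plane → ℝ) (a : WS), Represents ρ φ a →
        ∀ᶠ x : Plane in 𝓝 0, (WS.scale ε a).eval x = φ (S x) := by
      intro φ a ha
      filter_upwards [hSt.eventually (ha.comp hρ0')] with x hx
      rw [WS.eval_scale hε.1.le hε.2, hx]
      congr 1
      ext j
      fin_cases j <;> simp [hS, diagEquiv_apply, hρ0', mul_assoc]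
    have hCr := eventually_all.2 fun k => hrep _ _ (hC k)
    have hXr := eventually_all.2 fun j => hrep _ _ (hX j)
    filter_upwards [hCr.eventually_nhds, hXr.eventually_nhds, hSt.eventually (hW i),
      (eventually_norm_lt (by norm_num : (0 : ℝ) < 1 / 2)).eventually_nhds] with x hCx hXx hWx hx
    have e1 : (WS.scale ε (X i)).eval =ᶠ[𝓝 x] fun y => W i (S y) := by
      filter_upwards [hXx] with y hy using hy i
    have e2 : (𝒮.fluxSeries (fun k => WS.scale ε (C k), fun j => WS.scale ε (X j)) i).eval =ᶠ[𝓝 x]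
        fun y => (fun z => 𝒮.flux (fun k => c k z) (fun j => W j z) i) (S y) := by
      filter_upwards [hCx, hXx, hx] with y hCy hXy hy
      rw [𝒮.eval_flux _ hdom _ hy.le]
      simp only [hCy, hXy]
    have e3 : (𝒮.sourceSeries (fun k => WS.scale ε (C k), fun j => WS.scale ε (X j)) i).eval x =
        𝒮.source (fun k => c k (S x)) (fun j => W j (S x)) i := by
      rw [𝒮.eval_source _ hdom _ hx.self_of_nhds.le]
      simp only [hCx.self_of_nhds, hXx.self_of_nhds]
    rw [pder_congr e1, pder_congr e2, e3, pder_comp_diagEquiv,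
      pder_comp_diagEquiv _ _ (fun z => 𝒮.flux (fun k => c k z) (fun j => W j z) i), ← hS, hWx]
    simp only [one_ne_zero, if_false, if_true]
    ring
  obtain ⟨ε, h1, h2, hε⟩ := ((key U Y hY hUs fun _ => rfl).and ((key V Y' hY' hVs haxis).and
    (Ioc_mem_nhdsGT one_pos))).exists
  -- The rescaling multiplies each coefficient by a power of `ε ≠ 0`, hence is injective.
  have h3 : Y i = Y' i := by
    have h := (h1 i).symm.trans (h2 i)
    apply WS.val_injective
    ext d
    have hd := congrArg (fun a : WS => coeff d a.val) h
    simp only [WS.val_scale, WS.coeff_scaleSeries, WS.clamp_of_mem hε.1.le hε.2] at hd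
    exact mul_right_cancel₀ (pow_ne_zero _ hε.1.ne') hd
  filter_upwards [(hY i).comp hρ0', (hY' i).comp hρ0'] with x hx hx'
  rw [hx, hx', h3]

end DivergenceSystem

end KossowskiMetrics

namespace KossowskiMetrics

open Finset Filter

/-! ### Partial derivatives -/

section Pder

variable {V : Type*} [NormedAddCommGroup V] [NormedSpace ℝ V]

lemma pder_add {F G : Plane → V} {x : Plane} (i : Fin 2) (hF : DifferentiableAt ℝ F x)
    (hG : DifferentiableAt ℝ G x) : pder i (fun y => F y + G y) x = pder i F x + pder i G x := by
  simp only [pder]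
  rw [fderiv_fun_add hF hG]
  rfl

lemma pder_sub {F G : Plane → V} {x : Plane} (i : Fin 2) (hF : DifferentiableAt ℝ F x)
    (hG : DifferentiableAt ℝ G x) : pder i (fun y => F y - G y) x = pder i F x - pder i G x := by
  simp only [pder]
  rw [fderiv_fun_sub hF hG]
  rfl

lemma pder_const (c : V) (x : Plane) (i : Fin 2) : pder i (fun _ => c) x = 0 := by
  simp [pder]

lemma pder_smul {φ : Plane → ℝ} {F : Plane → V} {x : Plane} (i : Fin 2)
    (hφ : DifferentiableAt ℝ φ x) (hF : DifferentiableAt ℝ F x) :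
    pder i (fun y => φ y • F y) x = pder i φ x • F x + φ x • pder i F x := by
  simp only [pder]
  rw [fderiv_fun_smul hφ hF]
  simp [add_comm]

lemma pder_mul {φ ψ : Plane → ℝ} {x : Plane} (i : Fin 2)
    (hφ : DifferentiableAt ℝ φ x) (hψ : DifferentiableAt ℝ ψ x) :
    pder i (fun y => φ y * ψ y) x = pder i φ x * ψ x + φ x * pder i ψ x :=
  pder_smul i hφ hψ

lemma pder_sum {ι : Type*} (s : Finset ι) {F : ι → Plane → V} {x : Plane} (i : Fin 2)
    (hF : ∀ j ∈ s, DifferentiableAt ℝ (F j) x) :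
    pder i (fun y => ∑ j ∈ s, F j y) x = ∑ j ∈ s, pder i (F j) x := by
  simp only [pder]
  rw [fderiv_fun_sum hF]
  simp

lemma pder_inner {W : Type*} [NormedAddCommGroup W] [InnerProductSpace ℝ W] {F G : Plane → W}
    {x : Plane} (i : Fin 2) (hF : DifferentiableAt ℝ F x) (hG : DifferentiableAt ℝ G x) :
    pder i (fun y => inner ℝ (F y) (G y)) x =
      inner ℝ (pder i F x) (G x) + inner ℝ (F x) (pder i G x) := by
  simp only [pder]
  rw [fderiv_inner_apply ℝ hF hG, add_comm]

lemma analyticAt_pder [CompleteSpace V] {F : Plane → V} {x : Plane} (hF : AnalyticAt ℝ F x) (i : Fin 2) :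
    AnalyticAt ℝ (pder i F) x :=
  ((ContinuousLinearMap.apply ℝ V (coordVec i)).analyticAt _).comp hF.fderiv

lemma pder_comm [CompleteSpace V] {F : Plane → V} {x : Plane} (hF : AnalyticAt ℝ F x) (i j : Fin 2) :
    pder i (pder j F) x = pder j (pder i F) x := by
  have hd := hF.fderiv.differentiableAt
  have h : ∀ i j : Fin 2, pder i (pder j F) x =
      fderiv ℝ (fderiv ℝ F) x (coordVec i) (coordVec j) := by
    intro i j
    change fderiv ℝ (fun y => fderiv ℝ F y (coordVec j)) x (coordVec i) = _
    rw [fderiv_clm_apply hd (differentiableAt_const _)]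
    simp
  rw [h, h]
  exact (hF.contDiffAt (n := ω)).isSymmSndFDerivAt (by simp) _ _

lemma fderiv_eq_pder {F : Plane → V} (x v : Plane) :
    fderiv ℝ F x v = v 0 • pder 0 F x + v 1 • pder 1 F x := by
  conv_lhs => rw [plane_eq_sum v]
  simp [Fin.sum_univ_two, pder]

lemma pder_comp {F : Plane → V} {T : Plane → Plane} {x : Plane} (i : Fin 2)
    (hF : DifferentiableAt ℝ F (T x)) (hT : DifferentiableAt ℝ T x) :
    pder i (fun y => F (T y)) x =
      (pder i T x) 0 • pder 0 F (T x) + (pder i T x) 1 • pder 1 F (T x) := by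
  rw [← fderiv_eq_pder, pder, show (fun y => F (T y)) = F ∘ T from rfl, fderiv_comp x hF hT]
  rfl

/-- The derivative along the axis depends only on the values on the axis. -/
lemma pder_zero_eq_of_axis {F G : Plane → V} {x : Plane} (hx : x 1 = 0)
    (hF : DifferentiableAt ℝ F x) (hG : DifferentiableAt ℝ G x)
    (h : ∀ᶠ y in 𝓝 x, y 1 = 0 → F y = G y) : pder 0 F x = pder 0 G x := by
  have hline : ∀ H : Plane → V, DifferentiableAt ℝ H x →
      HasDerivAt (fun t : ℝ => H (x + t • coordVec 0)) (pder 0 H x) 0 := by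
    intro H hH
    have h1 : HasDerivAt (fun t : ℝ => x + t • coordVec 0) (coordVec 0) 0 := by
      simpa using ((hasDerivAt_id (0 : ℝ)).smul_const (coordVec 0)).const_add x
    have h2 : HasFDerivAt H (fderiv ℝ H x) (x + (0 : ℝ) • coordVec 0) := by
      simpa using hH.hasFDerivAt
    exact h2.comp_hasDerivAt 0 h1
  have ht : Tendsto (fun t : ℝ => x + t • coordVec 0) (𝓝 0) (𝓝 x) := by
    have hc : Continuous fun t : ℝ => x + t • coordVec 0 := by fun_prop
    simpa using hc.tendsto 0
  refine (hline F hF).unique ((hline G hG).congr_of_eventuallyEq ?_)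
  filter_upwards [ht.eventually h] with t ht
  exact ht (by simp [hx, coordVec])

end Pder

/-! ### Linear equations -/

/-- The linear system `∂_v U_i = ∑ U_j B_{ji}`. -/
noncomputable def linearSystem (n : ℕ) : DivergenceSystem (Fin n × Fin n) (Fin n) where
  fluxSeries _ _ := 0
  sourceSeries z i := ∑ j, z.2 j * z.1 (j, i)
  flux _ _ _ := 0
  source c U i := ∑ j, U j * c (j, i)
  dom := Set.univ
  isOpen_dom := isOpen_univ
  contDiffOn_flux := contDiffOn_const
  contDiffOn_source := by
    refine ContDiff.contDiffOn ?_
    fun_prop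
  eval_flux _ _ x _ _ := WS.eval_zero x
  eval_source z _ x hx i := by
    rw [WS.eval_sum _ _ hx]
    exact Finset.sum_congr rfl fun j _ => WS.eval_mul _ _ hx

lemma linearSystem_isSolution_iff {n : ℕ} (B : Fin n → Fin n → Plane → ℝ) (X : Fin n → Plane → ℝ) :
    (linearSystem n).IsSolution (fun ji => B ji.1 ji.2) X ↔
      ∀ i, ∀ᶠ x : Plane in 𝓝 0, pder 1 (X i) x = ∑ j, X j x * B j i x := by
  simp only [DivergenceSystem.IsSolution, linearSystem, pder_const, zero_add]

lemma exists_linear_solution {n : ℕ} {B : Fin n → Fin n → Plane → ℝ}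
    (hB : ∀ j i, AnalyticAt ℝ (B j i) 0) {X₀ : Fin n → Plane → ℝ}
    (hX₀ : ∀ i, AnalyticAt ℝ (X₀ i) 0) :
    ∃ X : Fin n → Plane → ℝ, (∀ i, AnalyticAt ℝ (X i) 0) ∧
      (∀ i, ∀ᶠ x : Plane in 𝓝 0, pder 1 (X i) x = ∑ j, X j x * B j i x) ∧
      ∀ i, ∀ᶠ x : Plane in 𝓝 0, x 1 = 0 → X i x = X₀ i x := by
  obtain ⟨X, h1, h2, h3⟩ := (linearSystem n).exists_solution
    (c := fun ji => B ji.1 ji.2) (fun ji => hB _ _) hX₀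
    (Eventually.of_forall fun _ _ _ _ _ => Set.mem_univ _)
  exact ⟨X, h1, (linearSystem_isSolution_iff B X).1 h2, h3⟩

lemma eventually_eq_zero_of_linear {n : ℕ} {B : Fin n → Fin n → Plane → ℝ}
    (hB : ∀ j i, AnalyticAt ℝ (B j i) 0) {X : Fin n → Plane → ℝ}
    (hX : ∀ i, AnalyticAt ℝ (X i) 0)
    (h : ∀ i, ∀ᶠ x : Plane in 𝓝 0, pder 1 (X i) x = ∑ j, X j x * B j i x)
    (h0 : ∀ i, ∀ᶠ x : Plane in 𝓝 0, x 1 = 0 → X i x = 0) (i : Fin n) :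
    ∀ᶠ x : Plane in 𝓝 0, X i x = 0 := by
  refine (linearSystem n).eventually_eq_of_isSolution (c := fun ji => B ji.1 ji.2)
    (fun ji => hB _ _) hX (V := fun _ _ => 0) (fun _ => analyticAt_const)
    (Eventually.of_forall fun _ _ _ _ _ => Set.mem_univ _)
    ((linearSystem_isSolution_iff B X).2 h) ((linearSystem_isSolution_iff B _).2 ?_) h0 i
  intro i
  simp [pder_const]

/-! ### Parallel sections of flat connections. -/

/-- The projection `(u, v) ↦ (v, 0)`. -/
noncomputable def toFirstAxis : Plane →L[ℝ] Plane :=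
  LinearMap.toContinuousLinearMap
    { toFun := fun x => !₂[x 1, 0]
      map_add' := fun x y => by ext i; fin_cases i <;> simp
      map_smul' := fun r x => by ext i; fin_cases i <;> simp }

/-- The projection `(u, v) ↦ (0, u)`. -/
noncomputable def toSecondAxis : Plane →L[ℝ] Plane :=
  LinearMap.toContinuousLinearMap
    { toFun := fun x => !₂[0, x 0]
      map_add' := fun x y => by ext i; fin_cases i <;> simp
      map_smul' := fun r x => by ext i; fin_cases i <;> simp }

lemma toFirstAxis_apply (x : Plane) : toFirstAxis x = !₂[x 1, 0] := rfl

lemma toSecondAxis_apply (x : Plane) : toSecondAxis x = !₂[0, x 0] := rfl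

lemma tendsto_clm (T : Plane →L[ℝ] Plane) : Tendsto T (𝓝 0) (𝓝 0) := by
  simpa using T.continuous.tendsto 0

lemma analyticAt_comp_clm {V : Type*} [NormedAddCommGroup V] [NormedSpace ℝ V] {F : Plane → V}
    (hF : AnalyticAt ℝ F 0) (T : Plane →L[ℝ] Plane) : AnalyticAt ℝ (fun x => F (T x)) 0 := by
  have h : AnalyticAt ℝ F (T 0) := by rwa [map_zero]
  exact h.comp (T.analyticAt 0)

/-- A flat linear connection with analytic coefficients has analytic parallel sections. -/
theorem exists_parallel {n : ℕ} {A : Fin 2 → Fin n → Fin n → Plane → ℝ}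
    (hA : ∀ m j i, AnalyticAt ℝ (A m j i) 0)
    (hflat : ∀ j i, ∀ᶠ x : Plane in 𝓝 0, pder 1 (A 0 j i) x + ∑ k, A 1 j k x * A 0 k i x =
      pder 0 (A 1 j i) x + ∑ k, A 0 j k x * A 1 k i x) (x₀ : Fin n → ℝ) :
    ∃ X : Fin n → Plane → ℝ, (∀ i, AnalyticAt ℝ (X i) 0) ∧ (∀ i, X i 0 = x₀ i) ∧
      ∀ m i, ∀ᶠ x : Plane in 𝓝 0, pder m (X i) x = ∑ j, X j x * A m j i x := by
  -- The section is first transported along the axis `v = 0`. The linear theorem integrates in the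
  -- second variable, so the roles of the variables are exchanged by the two axis projections; the
  -- result then serves as initial value for the transport in `v`.
  obtain ⟨Y, hY, hYs, hY0⟩ := exists_linear_solution (B := fun j i x => A 0 j i (toFirstAxis x))
    (fun j i => analyticAt_comp_clm (hA 0 j i) _) (X₀ := fun i _ => x₀ i) (fun _ => analyticAt_const)
  set X₀ : Fin n → Plane → ℝ := fun i x => Y i (toSecondAxis x) with hX₀def
  have hX₀ : ∀ i, AnalyticAt ℝ (X₀ i) 0 := fun i => analyticAt_comp_clm (hY i) _
  obtain ⟨X, hX, hXs, hX0⟩ := exists_linear_solution (hA 1) hX₀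
  have hdiff : ∀ {φ : Plane → ℝ}, AnalyticAt ℝ φ 0 → ∀ᶠ x : Plane in 𝓝 0, AnalyticAt ℝ φ x :=
    fun h => h.eventually_analyticAt
  have hXan : ∀ᶠ x : Plane in 𝓝 0, ∀ i, AnalyticAt ℝ (X i) x :=
    eventually_all.2 fun i => hdiff (hX i)
  have hX₀an : ∀ᶠ x : Plane in 𝓝 0, ∀ i, AnalyticAt ℝ (X₀ i) x :=
    eventually_all.2 fun i => hdiff (hX₀ i)
  have hAan : ∀ᶠ x : Plane in 𝓝 0, ∀ m j i, AnalyticAt ℝ (A m j i) x :=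
    eventually_all.2 fun m => eventually_all.2 fun j => eventually_all.2 fun i => hdiff (hA m j i)
  -- The defect of the equation in `u`. Flatness makes it a solution of the linear equation in `v`,
  -- and it vanishes on the axis by the choice of initial values, so it is zero.
  let D : Fin n → Plane → ℝ := fun i x => pder 0 (X i) x - ∑ j, X j x * A 0 j i x
  have hD : ∀ i, AnalyticAt ℝ (D i) 0 := fun i =>
    (analyticAt_pder (hX i) 0).sub
      (Finset.analyticAt_fun_sum _ fun j _ => (hX j).mul (hA 0 j i))
  have hDs : ∀ i, ∀ᶠ x : Plane in 𝓝 0, pder 1 (D i) x = ∑ j, D j x * A 1 j i x := by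
    intro i
    filter_upwards [hXan, hAan, (eventually_all.2 hXs).eventually_nhds,
      eventually_all.2 fun j => hflat j i] with x hx ha hs hf
    have hd : ∀ j, DifferentiableAt ℝ (X j) x := fun j => (hx j).differentiableAt
    have hda : ∀ m j i, DifferentiableAt ℝ (A m j i) x := fun m j i => (ha m j i).differentiableAt
    have e1 : pder 1 (D i) x = pder 1 (pder 0 (X i)) x -
        ∑ j, (pder 1 (X j) x * A 0 j i x + X j x * pder 1 (A 0 j i) x) := by
      rw [pder_sub 1 (analyticAt_pder (hx i) 0).differentiableAt
        (DifferentiableAt.fun_sum fun j _ => (hd j).fun_mul (hda 0 j i)),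
        pder_sum _ 1 fun j _ => (hd j).fun_mul (hda 0 j i)]
      congr 1
      exact Finset.sum_congr rfl fun j _ => pder_mul 1 (hd j) (hda 0 j i)
    have e2 : pder 1 (pder 0 (X i)) x =
        ∑ j, (pder 0 (X j) x * A 1 j i x + X j x * pder 0 (A 1 j i) x) := by
      rw [pder_comm (hx i)]
      have : pder 1 (X i) =ᶠ[𝓝 x] fun y => ∑ j, X j y * A 1 j i y := by
        filter_upwards [hs] with y hy using hy i
      rw [pder_congr this, pder_sum _ 0 fun j _ => (hd j).fun_mul (hda 1 j i)]
      exact Finset.sum_congr rfl fun j _ => pder_mul 0 (hd j) (hda 1 j i)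
    have hs' := hs.self_of_nhds
    have e3 : ∑ j, X j x * (pder 1 (A 0 j i) x + ∑ k, A 1 j k x * A 0 k i x) =
        ∑ j, X j x * (pder 0 (A 1 j i) x + ∑ k, A 0 j k x * A 1 k i x) :=
      Finset.sum_congr rfl fun j _ => by rw [hf j]
    have e4 : ∀ P Q : Fin n → Fin n → Plane → ℝ, ∑ j, X j x * ∑ k, P j k x * Q k i x =
        ∑ j, (∑ k, X k x * P k j x) * Q j i x := by
      intro P Q
      simp only [Finset.mul_sum, Finset.sum_mul]
      rw [Finset.sum_comm]
      simp only [mul_assoc]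
    simp only [mul_add, Finset.sum_add_distrib] at e3
    rw [e4, e4] at e3
    rw [e1, e2]
    simp only [hs', D, sub_mul, Finset.sum_sub_distrib, Finset.sum_add_distrib]
    linarith
  have hD0 : ∀ i, ∀ᶠ x : Plane in 𝓝 0, x 1 = 0 → D i x = 0 := by
    intro i
    filter_upwards [hXan, hX₀an, (eventually_all.2 hX0).eventually_nhds,
      (tendsto_clm toSecondAxis).eventually (eventually_all.2 hYs),
      (tendsto_clm toSecondAxis).eventually (hY i).eventually_analyticAt] with x hx hx0 h0 hys hya hx1
    have e1 : pder 0 (X i) x = pder 0 (X₀ i) x := by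
      refine pder_zero_eq_of_axis hx1 (hx i).differentiableAt (hx0 i).differentiableAt ?_
      filter_upwards [h0] with y hy using hy i
    have e2 : pder 0 (X₀ i) x = pder 1 (Y i) (toSecondAxis x) := by
      rw [hX₀def, pder_comp 0 hya.differentiableAt toSecondAxis.differentiableAt, pder,
        ContinuousLinearMap.fderiv]
      simp [toSecondAxis_apply, coordVec]
    have hxe : toFirstAxis (toSecondAxis x) = x := by
      rw [toFirstAxis_apply, toSecondAxis_apply]
      ext j
      fin_cases j <;> simp [hx1]
    simp only [D]
    rw [e1, e2, hys i, sub_eq_zero]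
    refine Finset.sum_congr rfl fun j _ => ?_
    rw [hxe, h0.self_of_nhds j hx1]
  have hDz := eventually_eq_zero_of_linear (hA 1) hD hDs hD0
  refine ⟨X, hX, fun i => ?_, fun m i => ?_⟩
  · have h1 := (hX0 i).self_of_nhds (by simp)
    have h2 := (hY0 i).self_of_nhds (by simp)
    rw [h1, hX₀def]
    simp only [map_zero]
    exact h2
  · fin_cases m
    · filter_upwards [hDz i] with x hx using sub_eq_zero.1 hx
    · exact hXs i

/-! ### The Gauss–Codazzi system -/

/-- The system `L_v = ∂_u (αL + βM) + bM - aN`, `M_v = ∂_u N + a(αL + βM) - bL` where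
`N = (k + M(αL + βM)) / L`. The coefficients are `(α, β, a, b, k)`. -/
noncomputable def gaussCodazziSystem : DivergenceSystem (Fin 5) (Fin 2) where
  fluxSeries z := ![z.1 0 * z.2 0 + z.1 1 * z.2 1,
    (z.1 4 + z.2 1 * (z.1 0 * z.2 0 + z.1 1 * z.2 1)) * Ring.inverse (z.2 0)]
  sourceSeries z := ![z.1 3 * z.2 1 -
      z.1 2 * ((z.1 4 + z.2 1 * (z.1 0 * z.2 0 + z.1 1 * z.2 1)) * Ring.inverse (z.2 0)),
    z.1 2 * (z.1 0 * z.2 0 + z.1 1 * z.2 1) - z.1 3 * z.2 0]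
  flux c U := ![c 0 * U 0 + c 1 * U 1, (c 4 + U 1 * (c 0 * U 0 + c 1 * U 1)) * (U 0)⁻¹]
  source c U := ![c 3 * U 1 - c 2 * ((c 4 + U 1 * (c 0 * U 0 + c 1 * U 1)) * (U 0)⁻¹),
    c 2 * (c 0 * U 0 + c 1 * U 1) - c 3 * U 0]
  dom := {z | IsUnit (z.2 0)}
  isOpen_dom := Units.isOpen.preimage (by fun_prop)
  contDiffOn_flux := by
    intro z hz
    refine ContDiffAt.contDiffWithinAt ?_
    have hinv : ContDiffAt ℝ 1 (fun z : (Fin 5 → WS) × (Fin 2 → WS) => Ring.inverse (z.2 0)) z := by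
      obtain ⟨u, hu⟩ := hz
      have h1 := contDiffAt_ringInverse ℝ u (n := 1)
      rw [hu] at h1
      exact h1.comp z (f := fun z : (Fin 5 → WS) × (Fin 2 → WS) => z.2 0) (by fun_prop)
    refine contDiffAt_pi.2 fun i => ?_
    fin_cases i
    · simp only [Fin.zero_eta, Matrix.cons_val_zero]
      fun_prop
    · simp only [Fin.mk_one, Matrix.cons_val_one, Matrix.cons_val_zero]
      exact ContDiffAt.mul (by fun_prop) hinv
  contDiffOn_source := by
    intro z hz
    refine ContDiffAt.contDiffWithinAt ?_
    have hinv : ContDiffAt ℝ 1 (fun z : (Fin 5 → WS) × (Fin 2 → WS) => Ring.inverse (z.2 0)) z := by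
      obtain ⟨u, hu⟩ := hz
      have h1 := contDiffAt_ringInverse ℝ u (n := 1)
      rw [hu] at h1
      exact h1.comp z (f := fun z : (Fin 5 → WS) × (Fin 2 → WS) => z.2 0) (by fun_prop)
    refine contDiffAt_pi.2 fun i => ?_
    fin_cases i
    · simp only [Fin.zero_eta, Matrix.cons_val_zero]
      refine ContDiffAt.sub (by fun_prop) (ContDiffAt.mul (by fun_prop) (ContDiffAt.mul (by fun_prop) hinv))
    · simp only [Fin.mk_one, Matrix.cons_val_one, Matrix.cons_val_zero]
      fun_prop
  eval_flux z hz x hx i := by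
    have hz' : IsUnit (z.2 0) := hz
    fin_cases i <;> simp [WS.eval_add _ _ hx, WS.eval_mul _ _ hx, WS.eval_inverse hz' hx]
  eval_source z hz x hx i := by
    have hz' : IsUnit (z.2 0) := hz
    fin_cases i <;> simp [WS.eval_add _ _ hx, WS.eval_sub _ _ hx, WS.eval_mul _ _ hx,
      WS.eval_inverse hz' hx]

/-- Being nonzero at the origin does not by itself make an element invertible in the algebra at a
given scale. For small `ρ` the germ `1 / L` is represented at the same scale, and its restriction to
the axis is the required inverse. -/
lemma gaussCodazziSystem_isInitial (c : Fin 5 → Plane → ℝ) {U : Fin 2 → Plane → ℝ}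
    (hU : AnalyticAt ℝ (U 0) 0) (h0 : U 0 0 ≠ 0) : gaussCodazziSystem.IsInitial c U := by
  filter_upwards [eventually_exists_represents (hU.inv h0), self_mem_nhdsWithin] with ρ ⟨R, hR⟩ hρ
  intro C Y _ hY
  have hρ' : (0 : ℝ) < ρ := hρ
  change IsUnit (WS.scale 0 (Y 0))
  refine IsUnit.of_mul_eq_one (WS.scale 0 R) (WS.eq_of_eval_eq ?_)
  have ht : Tendsto (fun x : Plane => (!₂[x 0, 0 * x 1] : Plane)) (𝓝 0) (𝓝 0) := by
    have hcont : Continuous fun x : Plane => (!₂[x 0, 0 * x 1] : Plane) := by fun_prop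
    have h := hcont.tendsto 0
    have h00 : (!₂[(0 : Plane) 0, 0 * (0 : Plane) 1] : Plane) = 0 := by
      ext j
      fin_cases j <;> simp
    rwa [h00] at h
  have hts : Tendsto (fun x : Plane => ρ • x) (𝓝 0) (𝓝 0) := by
    have := (continuous_const_smul ρ).tendsto (0 : Plane)
    rwa [smul_zero] at this
  filter_upwards [ht.eventually hR, ht.eventually (hY 0),
    ht.eventually (hts.eventually (hU.continuousAt.eventually_ne h0)),
    eventually_norm_lt (by norm_num : (0 : ℝ) < 1 / 2)] with x h1 h2 h3 hx
  rw [WS.eval_mul _ _ hx.le, WS.eval_one, WS.eval_scale le_rfl zero_le_one,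
    WS.eval_scale le_rfl zero_le_one, ← h1, ← h2]
  exact mul_inv_cancel₀ h3

end KossowskiMetrics

namespace KossowskiMetrics

open Finset Filter

/-! ### The initial value problem for the Gauss–Codazzi equations. -/

/-- `L, M` solve the Gauss–Codazzi equations with coefficients `α, β, a, b, k` near the origin. -/
def IsGaussCodazzi (α β a b k L M : Plane → ℝ) : Prop :=
  (∀ᶠ x : Plane in 𝓝 0, pder 1 L x = pder 0 (fun y => α y * L y + β y * M y) x +
    (b x * M x - a x * ((k x + M x * (α x * L x + β x * M x)) * (L x)⁻¹))) ∧
  ∀ᶠ x : Plane in 𝓝 0, pder 1 M x =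
    pder 0 (fun y => (k y + M y * (α y * L y + β y * M y)) * (L y)⁻¹) x +
      (a x * (α x * L x + β x * M x) - b x * L x)

lemma gaussCodazziSystem_isSolution_iff (α β a b k : Plane → ℝ) (U : Fin 2 → Plane → ℝ) :
    gaussCodazziSystem.IsSolution ![α, β, a, b, k] U ↔ IsGaussCodazzi α β a b k (U 0) (U 1) := by
  rw [DivergenceSystem.IsSolution, Fin.forall_fin_two]
  rfl

theorem exists_gaussCodazzi {α β a b k L₀ M₀ : Plane → ℝ} (hα : AnalyticAt ℝ α 0)
    (hβ : AnalyticAt ℝ β 0) (ha : AnalyticAt ℝ a 0) (hb : AnalyticAt ℝ b 0) (hk : AnalyticAt ℝ k 0)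
    (hL₀ : AnalyticAt ℝ L₀ 0) (hM₀ : AnalyticAt ℝ M₀ 0) (h0 : L₀ 0 ≠ 0) :
    ∃ L M : Plane → ℝ, AnalyticAt ℝ L 0 ∧ AnalyticAt ℝ M 0 ∧ IsGaussCodazzi α β a b k L M ∧
      (∀ᶠ x : Plane in 𝓝 0, x 1 = 0 → L x = L₀ x) ∧ ∀ᶠ x : Plane in 𝓝 0, x 1 = 0 → M x = M₀ x := by
  obtain ⟨U, h1, h2, h3⟩ := gaussCodazziSystem.exists_solution (c := ![α, β, a, b, k])
    (U₀ := ![L₀, M₀]) (by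
      intro i
      fin_cases i <;> assumption) (by
      intro i
      fin_cases i <;> assumption) (gaussCodazziSystem_isInitial _ (U := ![L₀, M₀]) hL₀ h0)
  exact ⟨U 0, U 1, h1 0, h1 1, (gaussCodazziSystem_isSolution_iff _ _ _ _ _ _).1 h2, h3 0, h3 1⟩

theorem eventually_eq_of_isGaussCodazzi {α β a b k L M L' M' : Plane → ℝ} (hα : AnalyticAt ℝ α 0)
    (hβ : AnalyticAt ℝ β 0) (ha : AnalyticAt ℝ a 0) (hb : AnalyticAt ℝ b 0) (hk : AnalyticAt ℝ k 0)
    (hL : AnalyticAt ℝ L 0) (hM : AnalyticAt ℝ M 0) (hL' : AnalyticAt ℝ L' 0)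
    (hM' : AnalyticAt ℝ M' 0) (h0 : L 0 ≠ 0) (h : IsGaussCodazzi α β a b k L M)
    (h' : IsGaussCodazzi α β a b k L' M') (hLL : ∀ᶠ x : Plane in 𝓝 0, x 1 = 0 → L x = L' x)
    (hMM : ∀ᶠ x : Plane in 𝓝 0, x 1 = 0 → M x = M' x) :
    L =ᶠ[𝓝 0] L' ∧ M =ᶠ[𝓝 0] M' := by
  have key := gaussCodazziSystem.eventually_eq_of_isSolution (c := ![α, β, a, b, k])
    (U := ![L, M]) (V := ![L', M']) (by
      intro i
      fin_cases i <;> assumption) (by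
      intro i
      fin_cases i <;> assumption) (by
      intro i
      fin_cases i <;> assumption) (gaussCodazziSystem_isInitial _ (U := ![L, M]) hL h0)
    ((gaussCodazziSystem_isSolution_iff _ _ _ _ _ _).2 h)
    ((gaussCodazziSystem_isSolution_iff _ _ _ _ _ _).2 h') (by
      intro i
      fin_cases i
      · exact hLL
      · exact hMM)
  exact ⟨key 0, key 1⟩

/-! ### Germs of analytic functions -/

/-- Formal power series over a field form a domain, and an analytic germ is determined by its
series. -/
lemma eventually_zero_of_mul_eventually_zero {φ ψ : Plane → ℝ} (hφ : AnalyticAt ℝ φ 0)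
    (hψ : AnalyticAt ℝ ψ 0) (h : ∀ᶠ x in 𝓝 0, φ x * ψ x = 0) :
    (∀ᶠ x in 𝓝 0, φ x = 0) ∨ ∀ᶠ x in 𝓝 0, ψ x = 0 := by
  obtain ⟨ρ, ⟨a, ha⟩, ⟨b, hb⟩, hρ⟩ := ((eventually_exists_represents hφ).and
    ((eventually_exists_represents hψ).and self_mem_nhdsWithin)).exists
  have hρ' : ρ ≠ 0 := ne_of_gt hρ
  have hts : Tendsto (fun x : Plane => ρ • x) (𝓝 0) (𝓝 0) := by
    have := (continuous_const_smul ρ).tendsto (0 : Plane)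
    rwa [smul_zero] at this
  have hab : a * b = 0 := by
    apply WS.eq_of_eval_eq
    filter_upwards [ha, hb, hts.eventually h, eventually_norm_lt (by norm_num : (0 : ℝ) < 1 / 2)]
      with x h1 h2 h3 hx
    rw [WS.eval_mul _ _ hx.le, ← h1, ← h2, h3, WS.eval_zero]
  have hv : a.val * b.val = 0 := by rw [← map_mul, hab, map_zero]
  have hz : ∀ c : WS, c.val = 0 → c = 0 := fun c hc => WS.val_injective (by rw [hc, map_zero])
  rcases mul_eq_zero.1 hv with h0 | h0
  · left
    filter_upwards [ha.comp hρ'] with x hx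
    rw [hx, hz a h0, WS.eval_zero]
  · right
    filter_upwards [hb.comp hρ'] with x hx
    rw [hx, hz b h0, WS.eval_zero]

lemma eventually_zero_of_mul {φ ψ : Plane → ℝ} (hφ : AnalyticAt ℝ φ 0)
    (hψ : AnalyticAt ℝ ψ 0) (hne : ¬ ∀ᶠ x in 𝓝 0, φ x = 0) (h : ∀ᶠ x in 𝓝 0, φ x * ψ x = 0) :
    ∀ᶠ x in 𝓝 0, ψ x = 0 :=
  (eventually_zero_of_mul_eventually_zero hφ hψ h).resolve_left hne

/-- Vanishing on the axis kills every coefficient with exponent `0` in `v`; the quotient is the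
shifted series, which converges on the same disc. -/
lemma exists_eq_coord_mul {φ : Plane → ℝ} (hφ : AnalyticAt ℝ φ 0)
    (h : ∀ᶠ x : Plane in 𝓝 0, x 1 = 0 → φ x = 0) :
    ∃ ψ : Plane → ℝ, AnalyticAt ℝ ψ 0 ∧ ∀ᶠ x : Plane in 𝓝 0, φ x = x 1 * ψ x := by
  obtain ⟨R, hR, c, hc, hφc⟩ := exists_series_of_analyticAt hφ
  have hc0 : WS.scaleSeries 0 c = 0 := by
    have hs : ConvergesOn R (WS.scaleSeries 0 c) := by
      refine Summable.of_nonneg_of_le (fun d => by positivity) (fun d => ?_) hc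
      rw [WS.coeff_scaleSeries, abs_mul]
      refine mul_le_mul_of_nonneg_right (mul_le_of_le_one_right (abs_nonneg _) ?_) (by positivity)
      rw [abs_pow, abs_zero]
      exact pow_le_one₀ le_rfl zero_le_one
    refine hs.eq_zero hR ?_
    have ht : Tendsto (fun x : Plane => (!₂[x 0, 0] : Plane)) (𝓝 0) (𝓝 0) := by
      have hcont : Continuous fun x : Plane => (!₂[x 0, 0] : Plane) := by fun_prop
      have h := hcont.tendsto 0
      have h00 : (!₂[(0 : Plane) 0, 0] : Plane) = 0 := by
        ext j
        fin_cases j <;> simp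
      rwa [h00] at h
    filter_upwards [ht.eventually h, ht.eventually (eventually_norm_lt hR)] with x hx hxR
    have h1 := hx (by simp)
    rw [hφc _ hxR.le] at h1
    refine Eq.trans ?_ h1
    rw [ev, ev]
    refine tsum_congr fun d => ?_
    rw [WS.coeff_scaleSeries]
    rcases Nat.eq_zero_or_pos (d 1) with hd | hd
    · simp [monom, hd]
    · simp [monom, hd.ne']
  have hcoef : ∀ d : Fin 2 →₀ ℕ, d 1 = 0 → MvPowerSeries.coeff d c = 0 := by
    intro d hd
    have := congrArg (MvPowerSeries.coeff d) hc0
    rwa [WS.coeff_scaleSeries, hd, pow_zero, mul_one, map_zero] at this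
  let c' : Series := fun d => MvPowerSeries.coeff (d + Finsupp.single 1 1) c
  have hc'd : ∀ d, MvPowerSeries.coeff d c' = MvPowerSeries.coeff (d + Finsupp.single 1 1) c :=
    fun _ => rfl
  have hc' : ConvergesOn R c' := by
    refine ((hc.comp_injective (add_single_injective 1)).mul_left R⁻¹).congr fun d => ?_
    simp only [Function.comp, deg_add_single, hc'd]
    field_simp
    ring
  refine ⟨ev c', hc'.analyticAt (by simpa using hR), ?_⟩
  filter_upwards [eventually_norm_lt hR] with x hx
  rw [hφc x hx.le, ev, ev, ← tsum_mul_left, ← (add_single_injective 1).tsum_eq]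
  · refine tsum_congr fun d => ?_
    rw [hc'd, monom_add]
    have : monom (Finsupp.single 1 1) x = x 1 := by simp [monom]
    rw [this]
    ring
  · intro d hd
    by_contra hr
    have hd1 : d 1 = 0 := by
      by_contra h1
      exact hr ⟨d - Finsupp.single 1 1, (eq_add_single h1).symm⟩
    exact hd (by simp [hcoef d hd1])

/-- The analytic inverse function theorem in the plane. -/
lemma exists_local_inverse {Ψ : Plane → Plane} {x₀ : Plane} (hΨ : AnalyticAt ℝ Ψ x₀)
    (hinj : Function.Injective (fderiv ℝ Ψ x₀)) :
    ∃ e : OpenPartialHomeomorph Plane Plane, x₀ ∈ e.source ∧ (∀ x, e x = Ψ x) ∧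
      ContDiffOn ℝ ω e e.source ∧ ContDiffOn ℝ ω e.symm e.target := by
  let L : Plane ≃L[ℝ] Plane :=
    (LinearEquiv.ofInjectiveEndo (fderiv ℝ Ψ x₀ : Plane →ₗ[ℝ] Plane) hinj).toContinuousLinearEquiv
  have hL : (L : Plane →L[ℝ] Plane) = fderiv ℝ Ψ x₀ := by
    ext1 v
    rfl
  have hs : HasStrictFDerivAt Ψ (L : Plane →L[ℝ] Plane) x₀ := by
    rw [hL]
    exact hΨ.hasStrictFDerivAt
  let e₀ := hs.toOpenPartialHomeomorph Ψ
  have he₀ : ∀ x, e₀ x = Ψ x := fun x => rfl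
  have hx₀ : x₀ ∈ e₀.source := hs.mem_toOpenPartialHomeomorph_source
  refine ⟨e₀.restrContDiff ℝ ω (by simp), ?_, he₀, OpenPartialHomeomorph.contDiffOn_restrContDiff_source ℝ e₀ _,
    OpenPartialHomeomorph.contDiffOn_restrContDiff_target ℝ e₀ _⟩
  have h1 : ContDiffAt ℝ ω e₀ x₀ := hΨ.contDiffAt
  refine ⟨hx₀, h1, ?_⟩
  exact (e₀.analyticAt_symm' hx₀ hΨ hL.symm).contDiffAt

/-- As its gradient is nonzero, `lam` can be taken as second coordinate, which reduces the claim to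
division by a coordinate. -/
lemma exists_div {φ lam : Plane → ℝ} (hφ : AnalyticAt ℝ φ 0) (hlam : AnalyticAt ℝ lam 0)
    (h0 : lam 0 = 0) (hd : fderiv ℝ lam 0 ≠ 0) (h : ∀ᶠ x in 𝓝 0, lam x = 0 → φ x = 0) :
    ∃ ψ : Plane → ℝ, AnalyticAt ℝ ψ 0 ∧ ∀ᶠ x in 𝓝 0, φ x = lam x * ψ x := by
  -- The coordinate `i` is kept, and `lam` replaces the other one, in which its derivative does not
  -- vanish.
  obtain ⟨i, hi⟩ : ∃ i : Fin 2, pder (1 - i) lam 0 ≠ 0 := by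
    by_contra! H
    apply hd
    ext v
    rw [fderiv_eq_pder]
    have h0 := H 1
    have h1 := H 0
    simp only [sub_self, sub_zero] at h0 h1
    simp [h0, h1]
  have hΨ' : HasFDerivAt (fun x : Plane => (!₂[x i, lam x] : Plane))
      ((EuclideanSpace.equiv (Fin 2) ℝ).symm.toContinuousLinearMap.comp
        (ContinuousLinearMap.pi ![(EuclideanSpace.proj i : Plane →L[ℝ] ℝ), fderiv ℝ lam 0])) 0 := by
    refine (EuclideanSpace.equiv (Fin 2) ℝ).symm.toContinuousLinearMap.hasFDerivAt.comp
      (f := fun x : Plane => ![x i, lam x]) (0 : Plane) ?_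
    refine hasFDerivAt_pi.2 fun j => ?_
    fin_cases j
    · exact (EuclideanSpace.proj i : Plane →L[ℝ] ℝ).hasFDerivAt
    · exact hlam.differentiableAt.hasFDerivAt
  have hΨ : AnalyticAt ℝ (fun x : Plane => (!₂[x i, lam x] : Plane)) 0 := by
    refine ((EuclideanSpace.equiv (Fin 2) ℝ).symm.toContinuousLinearMap.analyticAt _).comp
      (f := fun x : Plane => ![x i, lam x]) ?_
    refine analyticAt_pi_iff.2 fun j => ?_
    fin_cases j
    · exact (EuclideanSpace.proj i : Plane →L[ℝ] ℝ).analyticAt _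
    · exact hlam
  have hinj : Function.Injective (fderiv ℝ (fun x : Plane => (!₂[x i, lam x] : Plane)) 0) := by
    rw [hΨ'.fderiv, injective_iff_map_eq_zero]
    intro v hv
    have hv0 : v i = 0 := congrArg (fun w : Plane => w 0) hv
    have hv1 : fderiv ℝ lam 0 v = 0 := congrArg (fun w : Plane => w 1) hv
    rw [fderiv_eq_pder] at hv1
    ext j
    fin_cases i <;> fin_cases j <;> simp_all
  obtain ⟨e, he0, hee, hes, het⟩ := exists_local_inverse hΨ hinj
  have he00 : e 0 = 0 := by
    rw [hee]
    ext j
    fin_cases j <;> simp [h0]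
  have h0t : (0 : Plane) ∈ e.target := by
    have := e.map_source he0
    rwa [he00] at this
  have hsymm0 : e.symm 0 = 0 := by
    have := e.left_inv he0
    rwa [he00] at this
  have hsan : AnalyticAt ℝ e.symm 0 := (het.contDiffAt (e.open_target.mem_nhds h0t)).analyticAt
  have hts : Tendsto e.symm (𝓝 0) (𝓝 0) := by
    have := hsan.continuousAt.tendsto
    rwa [hsymm0] at this
  have hte : Tendsto e (𝓝 0) (𝓝 0) := by
    have := (e.continuousAt he0).tendsto
    rwa [he00] at this
  have hφs : AnalyticAt ℝ (fun x => φ (e.symm x)) 0 := by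
    have h1 : AnalyticAt ℝ φ (e.symm 0) := by rwa [hsymm0]
    exact h1.comp hsan
  obtain ⟨ψ, hψ, hψe⟩ := exists_eq_coord_mul hφs (by
    filter_upwards [hts.eventually h, e.open_target.mem_nhds h0t] with x hx hxt hx1
    apply hx
    have h2 := e.right_inv hxt
    rw [hee] at h2
    have h3 := congrArg (fun w : Plane => w 1) h2
    simpa [hx1] using h3)
  refine ⟨fun x => ψ (e x), ?_, ?_⟩
  · have h1 : AnalyticAt ℝ ψ (e 0) := by rwa [he00]
    have h2 : AnalyticAt ℝ e 0 := (funext hee : (e : Plane → Plane) = _) ▸ hΨ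
    exact h1.comp h2
  · filter_upwards [hte.eventually hψe, e.open_source.mem_nhds he0] with x hx hxs
    rw [e.left_inv hxs] at hx
    rw [hx, hee]
    rfl

end KossowskiMetrics

namespace KossowskiMetrics

open Finset Filter

/-! ### Orthonormal frames -/

lemma eq_sum_of_orthonormal {e : Fin 3 → Space} (h : Orthonormal ℝ e) (w : Space) :
    w = ∑ i, inner ℝ (e i) w • e i := by
  have hspan : ⊤ ≤ Submodule.span ℝ (Set.range e) := by
    rw [h.linearIndependent.span_eq_top_of_card_eq_finrank' (by simp)]
  have := (OrthonormalBasis.mk h hspan).sum_repr' w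
  simp only [OrthonormalBasis.coe_mk] at this
  exact this.symm

/-- The cross product in Euclidean space. -/
noncomputable def cross (x y : Space) : Space := WithLp.toLp 2 (crossProduct x.ofLp y.ofLp)

lemma inner_space (x y : Space) : inner ℝ x y = x 0 * y 0 + x 1 * y 1 + x 2 * y 2 := by
  simp [PiLp.inner_apply, Fin.sum_univ_three, mul_comm]

lemma cross_apply_zero (x y : Space) : cross x y 0 = x 1 * y 2 - x 2 * y 1 := by
  simp [cross, crossProduct]

lemma cross_apply_one (x y : Space) : cross x y 1 = x 2 * y 0 - x 0 * y 2 := by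
  simp [cross, crossProduct]

lemma cross_apply_two (x y : Space) : cross x y 2 = x 0 * y 1 - x 1 * y 0 := by
  simp [cross, crossProduct]

lemma inner_cross_left (x y : Space) : inner ℝ x (cross x y) = 0 := by
  rw [inner_space, cross_apply_zero, cross_apply_one, cross_apply_two]
  ring

lemma inner_cross_right (x y : Space) : inner ℝ y (cross x y) = 0 := by
  rw [inner_space, cross_apply_zero, cross_apply_one, cross_apply_two]
  ring

lemma inner_cross_cross (x y z w : Space) : inner ℝ (cross x y) (cross z w) =
    inner ℝ x z * inner ℝ y w - inner ℝ x w * inner ℝ y z := by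
  simp only [inner_space, cross_apply_zero, cross_apply_one, cross_apply_two]
  ring

lemma norm_cross_sq (x y : Space) : ‖cross x y‖ ^ 2 =
    inner ℝ x x * inner ℝ y y - inner ℝ x y ^ 2 := by
  rw [← real_inner_self_eq_norm_sq, inner_cross_cross, real_inner_comm x y]
  ring

lemma analyticAt_cross {F G : Plane → Space} {x : Plane} (hF : AnalyticAt ℝ F x)
    (hG : AnalyticAt ℝ G x) : AnalyticAt ℝ (fun y => cross (F y) (G y)) x := by
  have hcoord : ∀ {H : Plane → Space}, AnalyticAt ℝ H x → ∀ i, AnalyticAt ℝ (fun y => H y i) x :=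
    fun {H} hH i => ((EuclideanSpace.proj i : Space →L[ℝ] ℝ).analyticAt _).comp hH
  refine ((EuclideanSpace.equiv (Fin 3) ℝ).symm.toContinuousLinearMap.analyticAt _).comp
    (f := fun y => (cross (F y) (G y)).ofLp) ?_
  refine analyticAt_pi_iff.2 fun j => ?_
  have h := fun (i k : Fin 3) => (hcoord hF i).mul (hcoord hG k)
  fin_cases j
  · exact ((h 1 2).sub (h 2 1)).congr (Eventually.of_forall fun y => (cross_apply_zero _ _).symm)
  · exact ((h 2 0).sub (h 0 2)).congr (Eventually.of_forall fun y => (cross_apply_one _ _).symm)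
  · exact ((h 0 1).sub (h 1 0)).congr (Eventually.of_forall fun y => (cross_apply_two _ _).symm)

/-- The determinant of three vectors. -/
noncomputable def det3 (e : Fin 3 → Space) : ℝ := Matrix.det (Matrix.of fun i => (e i).ofLp)

lemma det3_sq_of_orthonormal {e : Fin 3 → Space} (h : Orthonormal ℝ e) : det3 e ^ 2 = 1 := by
  have hm : (Matrix.of fun i => (e i).ofLp) * (Matrix.of fun i => (e i).ofLp).transpose = 1 := by
    ext i j
    have := orthonormal_iff_ite.1 h i j
    rw [inner_space] at this
    rw [Matrix.mul_apply, Fin.sum_univ_three, Matrix.one_apply]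
    exact this
  have hd := congrArg Matrix.det hm
  rw [Matrix.det_mul, Matrix.det_transpose, Matrix.det_one] at hd
  rw [det3, pow_two]
  exact hd

lemma det3_smul_combination (e : Fin 3 → Space) (P : Matrix (Fin 3) (Fin 3) ℝ) :
    det3 (fun i => ∑ j, P i j • e j) = P.det * det3 e := by
  rw [det3, det3, ← Matrix.det_mul]
  congr 1

/-! ### Constancy -/

section Const

variable {V : Type*} [NormedAddCommGroup V] [NormedSpace ℝ V]

lemma eventually_const_of_pder_eq_zero [CompleteSpace V] {F : Plane → V} (hF : AnalyticAt ℝ F 0)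
    (h : ∀ m : Fin 2, ∀ᶠ x : Plane in 𝓝 0, pder m F x = 0) : ∀ᶠ x : Plane in 𝓝 0, F x = F 0 := by
  obtain ⟨r, hr, hb⟩ := Metric.eventually_nhds_iff_ball.1
    (hF.eventually_analyticAt.and (eventually_all.2 h))
  filter_upwards [Metric.ball_mem_nhds (0 : Plane) hr] with x hx
  refine (convex_ball (0 : Plane) r).is_const_of_fderivWithin_eq_zero (𝕜 := ℝ)
    (fun y hy => (hb y hy).1.differentiableAt.differentiableWithinAt) (fun y hy => ?_) hx
    (Metric.mem_ball_self hr)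
  rw [fderivWithin_of_isOpen Metric.isOpen_ball hy]
  ext v
  rw [fderiv_eq_pder, (hb y hy).2 0, (hb y hy).2 1]
  simp

/-- Points of the first axis. -/
noncomputable def axisPt (t : ℝ) : Plane := !₂[t, 0]

lemma axisPt_eq (t : ℝ) : axisPt t = t • coordVec 0 := by
  ext i
  fin_cases i <;> simp [axisPt, coordVec]

lemma axisPt_zero : axisPt 0 = 0 := by simp [axisPt_eq]

lemma tendsto_axisPt : Tendsto axisPt (𝓝 0) (𝓝 0) := by
  have hc : Continuous axisPt := by
    simp only [funext axisPt_eq]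
    fun_prop
  have := hc.tendsto 0
  rwa [axisPt_zero] at this

lemma hasDerivAt_comp_axisPt {F : Plane → V} {t : ℝ} (hF : DifferentiableAt ℝ F (axisPt t)) :
    HasDerivAt (fun t => F (axisPt t)) (pder 0 F (axisPt t)) t := by
  have h1 : HasDerivAt axisPt (coordVec 0) t := by
    simp only [funext axisPt_eq]
    simpa using (hasDerivAt_id t).smul_const (coordVec 0)
  exact hF.hasFDerivAt.comp_hasDerivAt t h1

lemma iteratedDeriv_comp_axisPt [CompleteSpace V] {F : Plane → V} (hF : AnalyticAt ℝ F 0) (n : ℕ) :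
    ∀ᶠ t in 𝓝 (0 : ℝ), iteratedDeriv n (fun t => F (axisPt t)) t = ((pder 0)^[n] F) (axisPt t) := by
  have han : ∀ n : ℕ, AnalyticAt ℝ ((pder 0)^[n] F) 0 := by
    intro n
    induction n with
    | zero => exact hF
    | succ n ih =>
      rw [Function.iterate_succ_apply']
      exact analyticAt_pder ih 0
  induction n with
  | zero => simp
  | succ n ih =>
    filter_upwards [ih.eventually_nhds, tendsto_axisPt.eventually (han n).eventually_analyticAt]
      with t ht hta
    rw [iteratedDeriv_succ, Filter.EventuallyEq.deriv_eq ht, Function.iterate_succ_apply']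
    exact (hasDerivAt_comp_axisPt hta.differentiableAt).deriv

end Const

/-! ### Connection forms -/

/-- The connection coefficients of a moving frame. -/
noncomputable def conn (e : Fin 3 → Plane → Space) (m : Fin 2) (j i : Fin 3) (x : Plane) : ℝ :=
  inner ℝ (e j x) (pder m (e i) x)

section Frame

variable {e : Fin 3 → Plane → Space}

lemma analyticAt_inner {F G : Plane → Space} {x : Plane} (hF : AnalyticAt ℝ F x)
    (hG : AnalyticAt ℝ G x) : AnalyticAt ℝ (fun y => inner ℝ (F y) (G y)) x := by
  have hcoord : ∀ {H : Plane → Space}, AnalyticAt ℝ H x → ∀ i, AnalyticAt ℝ (fun y => H y i) x :=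
    fun {H} hH i => ((EuclideanSpace.proj i : Space →L[ℝ] ℝ).analyticAt _).comp hH
  simp only [inner_space]
  have h := fun i => (hcoord hF i).mul (hcoord hG i)
  exact ((h 0).add (h 1)).add (h 2)

lemma analyticAt_conn (he : ∀ i, AnalyticAt ℝ (e i) 0) (m : Fin 2) (j i : Fin 3) :
    AnalyticAt ℝ (conn e m j i) 0 := analyticAt_inner (he j) (analyticAt_pder (he i) m)

lemma eventually_analyticAt_frame (he : ∀ i, AnalyticAt ℝ (e i) 0) :
    ∀ᶠ x : Plane in 𝓝 0, ∀ i, AnalyticAt ℝ (e i) x :=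
  eventually_all.2 fun i => (he i).eventually_analyticAt

lemma conn_antisymm (he : ∀ i, AnalyticAt ℝ (e i) 0)
    (ho : ∀ᶠ x in 𝓝 0, Orthonormal ℝ fun i => e i x) :
    ∀ᶠ x : Plane in 𝓝 0, ∀ m j i, conn e m j i x = -conn e m i j x := by
  filter_upwards [eventually_analyticAt_frame he, ho.eventually_nhds] with x hx hox m j i
  have hc : (fun y => inner ℝ (e j y) (e i y)) =ᶠ[𝓝 x] fun _ => if j = i then (1 : ℝ) else 0 := by
    filter_upwards [hox] with y hy using orthonormal_iff_ite.1 hy j i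
  have h := pder_congr hc m
  rw [pder_const, pder_inner m (hx j).differentiableAt (hx i).differentiableAt,
    real_inner_comm (e i x) (pder m (e j) x)] at h
  simp only [conn]
  linarith

lemma pder_frame (ho : ∀ᶠ x in 𝓝 0, Orthonormal ℝ fun i => e i x) :
    ∀ᶠ x : Plane in 𝓝 0, ∀ m i, pder m (e i) x = ∑ j, conn e m j i x • e j x := by
  filter_upwards [ho] with x hx m i
  exact eq_sum_of_orthonormal hx _

/-- The second partial derivatives of the frame vectors commute; expanding the derivative of `e j`
in the frame and using antisymmetry produces the quadratic terms. -/
lemma conn_flat (he : ∀ i, AnalyticAt ℝ (e i) 0)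
    (ho : ∀ᶠ x in 𝓝 0, Orthonormal ℝ fun i => e i x) :
    ∀ᶠ x : Plane in 𝓝 0, ∀ j i, pder 1 (conn e 0 j i) x + ∑ k, conn e 1 j k x * conn e 0 k i x =
      pder 0 (conn e 1 j i) x + ∑ k, conn e 0 j k x * conn e 1 k i x := by
  filter_upwards [eventually_analyticAt_frame he, conn_antisymm he ho, pder_frame ho, ho]
    with x hx ha hp hox j i
  have key : ∀ m n : Fin 2, pder m (conn e n j i) x =
      inner ℝ (e j x) (pder m (pder n (e i)) x) - ∑ k, conn e m j k x * conn e n k i x := by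
    intro m n
    have h1 : pder m (conn e n j i) x = inner ℝ (pder m (e j) x) (pder n (e i) x) +
        inner ℝ (e j x) (pder m (pder n (e i)) x) :=
      pder_inner m (hx j).differentiableAt (analyticAt_pder (hx i) n).differentiableAt
    have h2 : inner ℝ (pder m (e j) x) (pder n (e i) x) = -∑ k, conn e m j k x * conn e n k i x := by
      rw [hp m j, sum_inner, ← Finset.sum_neg_distrib]
      refine Finset.sum_congr rfl fun k _ => ?_
      rw [real_inner_smul_left, ha m k j, neg_mul]
      rfl
    rw [h1, h2]
    ring
  rw [key, key, pder_comm (hx i) 0 1]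
  ring

end Frame

end KossowskiMetrics

namespace KossowskiMetrics

open Finset Filter

/-! ### Adapted frames in the plane -/

/-- `s, q, l` are the coefficients of an orthonormal coframe `s du + q dv`, `l dv` whose connection
form is analytic, with `du`-coefficient `a`. -/
structure IsCoframe (s q l a : Plane → ℝ) : Prop where
  analyticAt_s : AnalyticAt ℝ s 0
  analyticAt_q : AnalyticAt ℝ q 0
  analyticAt_l : AnalyticAt ℝ l 0
  analyticAt_a : AnalyticAt ℝ a 0
  s_pos : 0 < s 0
  l_ne_zero : ¬ ∀ᶠ x in 𝓝 0, l x = 0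
  mul_eq : ∀ᶠ x in 𝓝 0, a x * l x = pder 0 q x - pder 1 s x

/-- The `dv`-coefficient of the connection form. -/
noncomputable def connV (s q l a : Plane → ℝ) (x : Plane) : ℝ :=
  (q x * a x + pder 0 l x) * (s x)⁻¹

/-- The curvature density. -/
noncomputable def curvDensity (s q l a : Plane → ℝ) (x : Plane) : ℝ :=
  pder 1 a x - pder 0 (connV s q l a) x

/-- `e` is an orthonormal frame along `f` whose first two vectors are dual to the coframe. -/
structure IsAdapted (s q l : Plane → ℝ) (f : Plane → Space) (e : Fin 3 → Plane → Space) : Prop where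
  analyticAt_map : AnalyticAt ℝ f 0
  analyticAt_frame : ∀ i, AnalyticAt ℝ (e i) 0
  orthonormal : ∀ᶠ x in 𝓝 0, Orthonormal ℝ fun i => e i x
  pder_zero : ∀ᶠ x in 𝓝 0, pder 0 f x = s x • e 0 x
  pder_one : ∀ᶠ x in 𝓝 0, pder 1 f x = q x • e 0 x + l x • e 1 x

section

variable {s q l a : Plane → ℝ} {f : Plane → Space} {e : Fin 3 → Plane → Space}

namespace IsCoframe

lemma eventually_analyticAt (h : IsCoframe s q l a) : ∀ᶠ x in 𝓝 0,
    AnalyticAt ℝ s x ∧ AnalyticAt ℝ q x ∧ AnalyticAt ℝ l x ∧ AnalyticAt ℝ a x :=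
  h.analyticAt_s.eventually_analyticAt.and (h.analyticAt_q.eventually_analyticAt.and
    (h.analyticAt_l.eventually_analyticAt.and h.analyticAt_a.eventually_analyticAt))

lemma eventually_pos (h : IsCoframe s q l a) : ∀ᶠ x in 𝓝 0, 0 < s x :=
  h.analyticAt_s.continuousAt.eventually_const_lt h.s_pos

lemma analyticAt_inv (h : IsCoframe s q l a) : AnalyticAt ℝ (fun x => (s x)⁻¹) 0 :=
  h.analyticAt_s.inv h.s_pos.ne'

lemma analyticAt_connV (h : IsCoframe s q l a) : AnalyticAt ℝ (connV s q l a) 0 :=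
  ((h.analyticAt_q.mul h.analyticAt_a).add (analyticAt_pder h.analyticAt_l 0)).mul h.analyticAt_inv

lemma analyticAt_curvDensity (h : IsCoframe s q l a) : AnalyticAt ℝ (curvDensity s q l a) 0 :=
  (analyticAt_pder h.analyticAt_a 1).sub (analyticAt_pder h.analyticAt_connV 0)

lemma analyticAt_q_div (h : IsCoframe s q l a) : AnalyticAt ℝ (fun x => q x * (s x)⁻¹) 0 :=
  h.analyticAt_q.mul h.analyticAt_inv

lemma analyticAt_l_div (h : IsCoframe s q l a) : AnalyticAt ℝ (fun x => l x * (s x)⁻¹) 0 :=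
  h.analyticAt_l.mul h.analyticAt_inv

end IsCoframe

lemma conn_self (he : ∀ i, AnalyticAt ℝ (e i) 0)
    (ho : ∀ᶠ x in 𝓝 0, Orthonormal ℝ fun i => e i x) :
    ∀ᶠ x : Plane in 𝓝 0, ∀ m i, conn e m i i x = 0 := by
  filter_upwards [conn_antisymm he ho] with x hx m i
  linarith [hx m i i]

/-- Symmetry of the second derivatives of the map in terms of the frame. -/
lemma IsAdapted.torsion_free (h : IsCoframe s q l a) (hf : IsAdapted s q l f e) :
    ∀ᶠ x in 𝓝 0, ∀ j, pder 1 s x * (if j = 0 then 1 else 0) + s x * conn e 1 j 0 x =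
      pder 0 q x * (if j = 0 then 1 else 0) + q x * conn e 0 j 0 x +
        (pder 0 l x * (if j = 1 then 1 else 0) + l x * conn e 0 j 1 x) := by
  filter_upwards [h.eventually_analyticAt, eventually_analyticAt_frame hf.analyticAt_frame,
    hf.analyticAt_map.eventually_analyticAt, hf.orthonormal, hf.pder_zero.eventually_nhds,
    hf.pder_one.eventually_nhds] with x ⟨hs, hq, hl, _⟩ he hfx ho h0 h1 j
  have hd := fun i => (he i).differentiableAt
  have e1 : pder 1 (pder 0 f) x = pder 1 s x • e 0 x + s x • pder 1 (e 0) x := by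
    rw [pder_congr h0, pder_smul 1 hs.differentiableAt (hd 0)]
  have e2 : pder 0 (pder 1 f) x = pder 0 q x • e 0 x + q x • pder 0 (e 0) x +
      (pder 0 l x • e 1 x + l x • pder 0 (e 1) x) := by
    rw [pder_congr h1, pder_add 0 (hq.differentiableAt.fun_smul (hd 0))
      (hl.differentiableAt.fun_smul (hd 1)), pder_smul 0 hq.differentiableAt (hd 0),
      pder_smul 0 hl.differentiableAt (hd 1)]
  rw [pder_comm hfx, e2] at e1
  have e3 := congrArg (fun v => inner ℝ (e j x) v) e1
  have ho' := orthonormal_iff_ite.1 ho j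
  simp only [inner_add_right, real_inner_smul_right, ho'] at e3
  exact e3.symm

/-- The `e₀` component of `torsion_free` only gives the equality after multiplication by `l`. This
factor may vanish at semi-definite points, but it is a nonzero germ and can be cancelled in the
domain of analytic germs. -/
lemma IsAdapted.conn_zero_eq (h : IsCoframe s q l a) (hf : IsAdapted s q l f e) :
    ∀ᶠ x in 𝓝 0, conn e 0 1 0 x = a x := by
  have hz : ∀ᶠ x in 𝓝 0, conn e 0 1 0 x - a x = 0 := by
    refine eventually_zero_of_mul h.analyticAt_l
      ((analyticAt_conn hf.analyticAt_frame 0 1 0).sub h.analyticAt_a) h.l_ne_zero ?_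
    filter_upwards [hf.torsion_free h, h.mul_eq,
      conn_antisymm hf.analyticAt_frame hf.orthonormal,
      conn_self hf.analyticAt_frame hf.orthonormal] with x h1 h2 h3 h4
    have h5 := h1 0
    simp only [h4, if_true, zero_ne_one, if_false] at h5
    rw [h3 0 0 1] at h5
    linear_combination h5 - h2
  filter_upwards [hz] with x hx using sub_eq_zero.1 hx

lemma IsAdapted.conn_one_eq (h : IsCoframe s q l a) (hf : IsAdapted s q l f e) :
    ∀ᶠ x in 𝓝 0, conn e 1 1 0 x = connV s q l a x := by
  filter_upwards [hf.torsion_free h, hf.conn_zero_eq h, h.eventually_pos,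
    conn_self hf.analyticAt_frame hf.orthonormal] with x h1 h2 h3 h4
  have h5 := h1 1
  simp only [h4, if_true, one_ne_zero, if_false, h2] at h5
  rw [connV]
  field_simp
  linarith

/-- The normal component of `f_uv = f_vu`, which expresses the symmetry of the second fundamental
form. -/
lemma IsAdapted.conn_mixed_eq (h : IsCoframe s q l a) (hf : IsAdapted s q l f e) :
    ∀ᶠ x in 𝓝 0, conn e 1 2 0 x =
      q x * (s x)⁻¹ * conn e 0 2 0 x + l x * (s x)⁻¹ * conn e 0 2 1 x := by
  filter_upwards [hf.torsion_free h, h.eventually_pos] with x h1 h3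
  have h5 := h1 2
  simp only [Fin.reduceEq, if_false] at h5
  field_simp
  linarith

/-- The Gauss equation. -/
lemma IsAdapted.gauss (h : IsCoframe s q l a) (hf : IsAdapted s q l f e) :
    ∀ᶠ x in 𝓝 0, conn e 0 2 0 x * conn e 1 2 1 x =
      curvDensity s q l a x + conn e 0 2 1 x * conn e 1 2 0 x := by
  filter_upwards [conn_flat hf.analyticAt_frame hf.orthonormal, (hf.conn_zero_eq h).eventually_nhds,
    (hf.conn_one_eq h).eventually_nhds, conn_antisymm hf.analyticAt_frame hf.orthonormal,
    conn_self hf.analyticAt_frame hf.orthonormal] with x h1 h2 h3 h4 h5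
  have h6 := h1 1 0
  rw [pder_congr h2, pder_congr h3] at h6
  simp only [Fin.sum_univ_three, h5] at h6
  rw [h4 1 1 2, h4 0 1 2] at h6
  rw [curvDensity]
  linear_combination -h6

/-- Where `L ≠ 0`, the Gauss equation determines the remaining coefficient `N`. The entries `(2, 0)`
and `(2, 1)` of the flatness equation are the Codazzi equations, and substituting `N` and the mixed
coefficient closes them up in `(L, M)`. -/
lemma IsAdapted.isGaussCodazzi (h : IsCoframe s q l a) (hf : IsAdapted s q l f e)
    (hL : conn e 0 2 0 0 ≠ 0) :
    (∀ᶠ x in 𝓝 0, conn e 1 2 1 x = (curvDensity s q l a x + conn e 0 2 1 x *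
      (q x * (s x)⁻¹ * conn e 0 2 0 x + l x * (s x)⁻¹ * conn e 0 2 1 x)) * (conn e 0 2 0 x)⁻¹) ∧
    IsGaussCodazzi (fun x => q x * (s x)⁻¹) (fun x => l x * (s x)⁻¹) a (connV s q l a)
      (curvDensity s q l a) (conn e 0 2 0) (conn e 0 2 1) := by
  have hL' : ∀ᶠ x in 𝓝 0, conn e 0 2 0 x ≠ 0 :=
    (analyticAt_conn hf.analyticAt_frame 0 2 0).continuousAt.eventually_ne hL
  have hN : ∀ᶠ x in 𝓝 0, conn e 1 2 1 x = (curvDensity s q l a x + conn e 0 2 1 x *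
      (q x * (s x)⁻¹ * conn e 0 2 0 x + l x * (s x)⁻¹ * conn e 0 2 1 x)) * (conn e 0 2 0 x)⁻¹ := by
    filter_upwards [hf.gauss h, hf.conn_mixed_eq h, hL'] with x h1 h2 h3
    rw [← h2, ← h1]
    field_simp
  refine ⟨hN, ?_, ?_⟩
  · filter_upwards [conn_flat hf.analyticAt_frame hf.orthonormal, hN,
      (hf.conn_mixed_eq h).eventually_nhds, hf.conn_zero_eq h, hf.conn_one_eq h,
      conn_antisymm hf.analyticAt_frame hf.orthonormal,
      conn_self hf.analyticAt_frame hf.orthonormal] with x h1 hNx hMx h2 h3 h4 h5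
    have h6 := h1 2 0
    rw [pder_congr hMx] at h6
    simp only [Fin.sum_univ_three, h5, h2, h3, hNx] at h6
    linear_combination h6
  · filter_upwards [conn_flat hf.analyticAt_frame hf.orthonormal, hN.eventually_nhds,
      hf.conn_mixed_eq h, hf.conn_zero_eq h, hf.conn_one_eq h,
      conn_antisymm hf.analyticAt_frame hf.orthonormal,
      conn_self hf.analyticAt_frame hf.orthonormal] with x h1 hNx hMx h2 h3 h4 h5
    have h6 := h1 2 1
    rw [pder_congr hNx] at h6
    simp only [Fin.sum_univ_three, h5] at h6
    rw [h4 0 0 1, h4 1 0 1, h2, h3, hMx] at h6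
    linear_combination h6

/-! ### Uniqueness of adapted frames -/

/-- Let `Q` carry one frame at the origin to the other. The differences `e' i - Q (e i)` satisfy the
common linear system, whose matrix is antisymmetric, so the sum of their squared norms is constant,
hence zero. Then `f' - Q ∘ f` has zero derivative. The map `Q` may reverse orientation, which
matters when the torsion vanishes. -/
lemma eventually_eq_rigid_motion {f' : Plane → Space} {e' : Fin 3 → Plane → Space}
    (hf : IsAdapted s q l f e) (hf' : IsAdapted s q l f' e')
    (hc : ∀ᶠ x in 𝓝 0, ∀ m j i, conn e m j i x = conn e' m j i x) :
    ∃ Φ : Space ≃ᵢ Space, f' =ᶠ[𝓝 0] Φ ∘ f := by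
  have ho := hf.orthonormal.self_of_nhds
  have ho' := hf'.orthonormal.self_of_nhds
  have hspan : ∀ {b : Fin 3 → Space}, Orthonormal ℝ b → ⊤ ≤ Submodule.span ℝ (Set.range b) := by
    intro b hb
    rw [hb.linearIndependent.span_eq_top_of_card_eq_finrank' (by simp)]
  let Q : Space ≃ₗᵢ[ℝ] Space := (OrthonormalBasis.mk ho (hspan ho)).equiv
    (OrthonormalBasis.mk ho' (hspan ho')) (Equiv.refl _)
  have hQ : ∀ i, Q (e i 0) = e' i 0 := by
    intro i
    have := (OrthonormalBasis.mk ho (hspan ho)).equiv_apply_basis (OrthonormalBasis.mk ho' (hspan ho'))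
      (Equiv.refl _) i
    simpa using this
  have hpQ : ∀ {F : Plane → Space} {x : Plane} (m : Fin 2), DifferentiableAt ℝ F x →
      pder m (fun y => Q (F y)) x = Q (pder m F x) := by
    intro F x m hF
    have h1 := (Q.toContinuousLinearEquiv.toContinuousLinearMap.hasFDerivAt.comp x hF.hasFDerivAt).fderiv
    rw [pder, pder, show (fun y => Q (F y)) = Q.toContinuousLinearEquiv.toContinuousLinearMap ∘ F from rfl,
      h1]
    rfl
  have hQan : ∀ {F : Plane → Space} {x : Plane}, AnalyticAt ℝ F x → AnalyticAt ℝ (fun y => Q (F y)) x :=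
    fun {F x} hF => (Q.toContinuousLinearEquiv.toContinuousLinearMap.analyticAt _).comp hF
  let d : Fin 3 → Plane → Space := fun i x => e' i x - Q (e i x)
  have hd : ∀ i, AnalyticAt ℝ (d i) 0 := fun i =>
    (hf'.analyticAt_frame i).sub (hQan (hf.analyticAt_frame i))
  have hdp : ∀ᶠ x in 𝓝 0, ∀ m i, pder m (d i) x = ∑ j, conn e m j i x • d j x := by
    filter_upwards [eventually_analyticAt_frame hf.analyticAt_frame,
      eventually_analyticAt_frame hf'.analyticAt_frame, pder_frame hf.orthonormal,
      pder_frame hf'.orthonormal, hc] with x h1 h2 h3 h4 h5 m i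
    rw [pder_sub m (h2 i).differentiableAt (hQan (h1 i)).differentiableAt,
      hpQ m (h1 i).differentiableAt, h3, h4, map_sum, ← Finset.sum_sub_distrib]
    refine Finset.sum_congr rfl fun j _ => ?_
    rw [map_smul, h5, smul_sub]
  let φ : Plane → ℝ := fun x => ∑ i, inner ℝ (d i x) (d i x)
  have hφ : AnalyticAt ℝ φ 0 := Finset.analyticAt_fun_sum _ fun i _ => analyticAt_inner (hd i) (hd i)
  have hφp : ∀ m : Fin 2, ∀ᶠ x in 𝓝 0, pder m φ x = 0 := by
    intro m
    filter_upwards [eventually_all.2 fun i => (hd i).eventually_analyticAt, hdp,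
      conn_antisymm hf.analyticAt_frame hf.orthonormal,
      conn_self hf.analyticAt_frame hf.orthonormal] with x h1 h2 h3 h4
    have hdd := fun i => (h1 i).differentiableAt
    rw [pder_sum _ m fun i _ => (hdd i).inner ℝ (hdd i)]
    simp only [pder_inner m (hdd _) (hdd _), h2, Fin.sum_univ_three, h4, inner_add_left,
      inner_add_right, real_inner_smul_left, real_inner_smul_right]
    rw [h3 m 0 1, h3 m 0 2, h3 m 1 2, real_inner_comm (d 1 x) (d 0 x), real_inner_comm (d 2 x) (d 0 x),
      real_inner_comm (d 2 x) (d 1 x)]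
    ring
  have hd0 : ∀ᶠ x in 𝓝 0, ∀ i, e' i x = Q (e i x) := by
    have h0 : φ 0 = 0 := by simp [φ, d, hQ]
    filter_upwards [eventually_const_of_pder_eq_zero hφ hφp] with x hx i
    rw [h0] at hx
    have h1 := (Finset.sum_eq_zero_iff_of_nonneg fun i _ => real_inner_self_nonneg).1 hx i
      (Finset.mem_univ i)
    exact sub_eq_zero.1 (inner_self_eq_zero.1 h1)
  have hconst := eventually_const_of_pder_eq_zero (hf'.analyticAt_map.sub (hQan hf.analyticAt_map)) (by
    intro m
    filter_upwards [hf.analyticAt_map.eventually_analyticAt, hf'.analyticAt_map.eventually_analyticAt,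
      hf.pder_zero, hf.pder_one, hf'.pder_zero, hf'.pder_one, hd0] with x h1 h2 h3 h4 h5 h6 h7
    have h8 := pder_sub m h2.differentiableAt (hQan h1).differentiableAt
    refine h8.trans ?_
    rw [hpQ m h1.differentiableAt]
    fin_cases m
    · simp [h3, h5, h7]
    · simp [h4, h6, h7])
  refine ⟨Q.toIsometryEquiv.trans (IsometryEquiv.addRight (f' 0 - Q (f 0))), ?_⟩
  filter_upwards [hconst] with x hx
  have hx' : f' x - Q (f x) = f' 0 - Q (f 0) := hx
  change f' x = Q (f x) + (f' 0 - Q (f 0))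
  rw [← hx']
  abel

/-- Two adapted frames with the same second fundamental form along the axis differ by a rigid
motion. -/
theorem IsAdapted.congruent {f' : Plane → Space} {e' : Fin 3 → Plane → Space}
    (h : IsCoframe s q l a) (hf : IsAdapted s q l f e) (hf' : IsAdapted s q l f' e')
    (hL : ∀ᶠ x : Plane in 𝓝 0, x 1 = 0 → conn e 0 2 0 x = conn e' 0 2 0 x)
    (hM : ∀ᶠ x : Plane in 𝓝 0, x 1 = 0 → conn e 0 2 1 x = conn e' 0 2 1 x)
    (hL0 : conn e 0 2 0 0 ≠ 0) : ∃ Φ : Space ≃ᵢ Space, f' =ᶠ[𝓝 0] Φ ∘ f := by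
  have hL0' : conn e' 0 2 0 0 ≠ 0 := by
    rw [← hL.self_of_nhds (by simp)]
    exact hL0
  obtain ⟨hN, hGC⟩ := hf.isGaussCodazzi h hL0
  obtain ⟨hN', hGC'⟩ := hf'.isGaussCodazzi h hL0'
  obtain ⟨hLL, hMM⟩ := eventually_eq_of_isGaussCodazzi h.analyticAt_q_div h.analyticAt_l_div
    h.analyticAt_a h.analyticAt_connV h.analyticAt_curvDensity
    (analyticAt_conn hf.analyticAt_frame 0 2 0) (analyticAt_conn hf.analyticAt_frame 0 2 1)
    (analyticAt_conn hf'.analyticAt_frame 0 2 0) (analyticAt_conn hf'.analyticAt_frame 0 2 1)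
    hL0 hGC hGC' hL hM
  refine eventually_eq_rigid_motion hf hf' ?_
  filter_upwards [hLL, hMM, hN, hN', hf.conn_zero_eq h, hf'.conn_zero_eq h, hf.conn_one_eq h,
    hf'.conn_one_eq h, hf.conn_mixed_eq h, hf'.conn_mixed_eq h,
    conn_antisymm hf.analyticAt_frame hf.orthonormal, conn_self hf.analyticAt_frame hf.orthonormal,
    conn_antisymm hf'.analyticAt_frame hf'.orthonormal,
    conn_self hf'.analyticAt_frame hf'.orthonormal] with x h1 h2 h3 h4 h5 h6 h7 h8 h9 h10 h11 h12 h13 h14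
  have k1 : ∀ m, conn e m 1 0 x = conn e' m 1 0 x := by
    rw [Fin.forall_fin_two]
    exact ⟨by rw [h5, h6], by rw [h7, h8]⟩
  have k2 : ∀ m, conn e m 2 0 x = conn e' m 2 0 x := by
    rw [Fin.forall_fin_two]
    exact ⟨h1, by rw [h9, h10, h1, h2]⟩
  have k3 : ∀ m, conn e m 2 1 x = conn e' m 2 1 x := by
    rw [Fin.forall_fin_two]
    exact ⟨h2, by rw [h3, h4, h1, h2]⟩
  intro m j i
  fin_cases j <;> fin_cases i
  · exact (h12 m 0).trans (h14 m 0).symm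
  · exact (h11 m 0 1).trans ((congrArg Neg.neg (k1 m)).trans (h13 m 0 1).symm)
  · exact (h11 m 0 2).trans ((congrArg Neg.neg (k2 m)).trans (h13 m 0 2).symm)
  · exact k1 m
  · exact (h12 m 1).trans (h14 m 1).symm
  · exact (h11 m 1 2).trans ((congrArg Neg.neg (k3 m)).trans (h13 m 1 2).symm)
  · exact k2 m
  · exact k3 m
  · exact (h12 m 2).trans (h14 m 2).symm

end

end KossowskiMetrics

namespace KossowskiMetrics

open Finset Filter

/-! ### Curvature and torsion along the axis -/

lemma torsion_eq_det3 (c : ℝ → Space) (t : ℝ) : torsion c t =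
    det3 ![iteratedDeriv 1 c t, iteratedDeriv 2 c t, iteratedDeriv 3 c t] /
      ‖cross (iteratedDeriv 1 c t) (iteratedDeriv 2 c t)‖ ^ 2 := by
  rw [torsion, det3, cross]
  congr 3
  ext i j
  fin_cases i <;> rfl

section

variable {s q l a : Plane → ℝ} {f : Plane → Space} {e : Fin 3 → Plane → Space}

/-- The first three derivatives in the direction of the axis, in terms of the frame. -/
lemma IsAdapted.iterate_pder (hs : AnalyticAt ℝ s 0) (hf : IsAdapted s q l f e) :
    ∀ᶠ x in 𝓝 0, (pder 0)^[1] f x = s x • e 0 x ∧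
      (pder 0)^[2] f x = pder 0 s x • e 0 x + (s x * conn e 0 1 0 x) • e 1 x +
        (s x * conn e 0 2 0 x) • e 2 x ∧
      ∃ r : ℝ, (pder 0)^[3] f x = r • e 0 x +
        (2 * pder 0 s x * conn e 0 1 0 x + s x * pder 0 (conn e 0 1 0) x -
          s x * conn e 0 2 0 x * conn e 0 2 1 x) • e 1 x +
        (2 * pder 0 s x * conn e 0 2 0 x + s x * pder 0 (conn e 0 2 0) x +
          s x * conn e 0 1 0 x * conn e 0 2 1 x) • e 2 x := by
  have h2 : ∀ᶠ x in 𝓝 0, pder 0 (pder 0 f) x = pder 0 s x • e 0 x +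
      (s x * conn e 0 1 0 x) • e 1 x + (s x * conn e 0 2 0 x) • e 2 x := by
    filter_upwards [hs.eventually_analyticAt, eventually_analyticAt_frame hf.analyticAt_frame,
      hf.pder_zero.eventually_nhds, pder_frame hf.orthonormal,
      conn_self hf.analyticAt_frame hf.orthonormal] with x h1 h2 h3 h4 h5
    rw [pder_congr h3, pder_smul 0 h1.differentiableAt (h2 0).differentiableAt, h4,
      Fin.sum_univ_three, h5]
    module
  filter_upwards [hs.eventually_analyticAt, eventually_analyticAt_frame hf.analyticAt_frame,
    hf.pder_zero, h2.eventually_nhds, pder_frame hf.orthonormal,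
    conn_self hf.analyticAt_frame hf.orthonormal, conn_antisymm hf.analyticAt_frame hf.orthonormal,
    (analyticAt_conn hf.analyticAt_frame 0 1 0).eventually_analyticAt,
    (analyticAt_conn hf.analyticAt_frame 0 2 0).eventually_analyticAt]
    with x h1 he h3 h4 h5 h6 h7 ha hL
  refine ⟨h3, h4.self_of_nhds, ?_⟩
  have hd := fun i => (he i).differentiableAt
  have hs' := h1.differentiableAt
  have hsp := (analyticAt_pder h1 0).differentiableAt
  have e1 : pder 0 (pder 0 (pder 0 f)) x =
      pder 0 (pder 0 s) x • e 0 x + pder 0 s x • pder 0 (e 0) x +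
      ((pder 0 s x * conn e 0 1 0 x + s x * pder 0 (conn e 0 1 0) x) • e 1 x +
        (s x * conn e 0 1 0 x) • pder 0 (e 1) x) +
      ((pder 0 s x * conn e 0 2 0 x + s x * pder 0 (conn e 0 2 0) x) • e 2 x +
        (s x * conn e 0 2 0 x) • pder 0 (e 2) x) := by
    have d0 := hsp.fun_smul (hd 0)
    have d1 := (hs'.fun_mul ha.differentiableAt).fun_smul (hd 1)
    have d2 := (hs'.fun_mul hL.differentiableAt).fun_smul (hd 2)
    rw [pder_congr h4, pder_add 0 (d0.fun_add d1) d2, pder_add 0 d0 d1, pder_smul 0 hsp (hd 0),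
      pder_smul 0 (hs'.fun_mul ha.differentiableAt) (hd 1),
      pder_smul 0 (hs'.fun_mul hL.differentiableAt) (hd 2), pder_mul 0 hs' ha.differentiableAt,
      pder_mul 0 hs' hL.differentiableAt]
  refine ⟨pder 0 (pder 0 s) x - s x * conn e 0 1 0 x ^ 2 - s x * conn e 0 2 0 x ^ 2, ?_⟩
  change pder 0 (pder 0 (pder 0 f)) x = _
  rw [e1, h5, h5, h5]
  simp only [Fin.sum_univ_three, h6]
  rw [h7 0 0 1, h7 0 0 2, h7 0 1 2]
  module

lemma inner_frame_combination {e : Fin 3 → Space} (ho : Orthonormal ℝ e) (a b c a' b' c' : ℝ) :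
    inner ℝ (a • e 0 + b • e 1 + c • e 2) (a' • e 0 + b' • e 1 + c' • e 2) =
      a * a' + b * b' + c * c' := by
  have h := orthonormal_iff_ite.1 ho
  simp only [inner_add_left, inner_add_right, real_inner_smul_left, real_inner_smul_right, h]
  simp
  ring

/-- The coefficient matrix of the three vectors is block triangular, so `s'` and `r` drop out. The
factor `det3 e` is the only place where the orientation of the frame enters. -/
lemma torsion_of_frame {e : Fin 3 → Space} (ho : Orthonormal ℝ e) {s s' a L A B r : ℝ}
    (hs : s ≠ 0) (haL : a ^ 2 + L ^ 2 ≠ 0) {v₁ v₂ v₃ : Space} (h1 : v₁ = s • e 0)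
    (h2 : v₂ = s' • e 0 + (s * a) • e 1 + (s * L) • e 2)
    (h3 : v₃ = r • e 0 + A • e 1 + B • e 2) :
    det3 ![v₁, v₂, v₃] / ‖cross v₁ v₂‖ ^ 2 = det3 e * (a * B - L * A) / (s ^ 2 * (a ^ 2 + L ^ 2)) := by
  have hdet : det3 ![v₁, v₂, v₃] = s ^ 2 * (a * B - L * A) * det3 e := by
    have := det3_smul_combination e !![s, 0, 0; s', s * a, s * L; r, A, B]
    have hv : ![v₁, v₂, v₃] = fun i => ∑ j, !![s, 0, 0; s', s * a, s * L; r, A, B] i j • e j := by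
      funext i
      fin_cases i
      · simp [Fin.sum_univ_three, h1]
      · simp [Fin.sum_univ_three, h2]
      · simp [Fin.sum_univ_three, h3]
    rw [hv, this, Matrix.det_fin_three]
    congr 1
    simp
    ring
  have h1' : v₁ = s • e 0 + (0 : ℝ) • e 1 + (0 : ℝ) • e 2 := by rw [h1]; module
  have hcr : ‖cross v₁ v₂‖ ^ 2 = s ^ 4 * (a ^ 2 + L ^ 2) := by
    rw [norm_cross_sq, h1', h2, inner_frame_combination ho, inner_frame_combination ho,
      inner_frame_combination ho]
    ring
  rw [hdet, hcr]
  field_simp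

/-- Normal curvature and torsion of the image of the axis. -/
lemma IsAdapted.axis (hs : AnalyticAt ℝ s 0) (hs0 : 0 < s 0) (hf : IsAdapted s q l f e) :
    ∀ᶠ t in 𝓝 (0 : ℝ),
      inner ℝ (iteratedDeriv 2 (fun t => f (axisPt t)) t) (e 2 (axisPt t)) =
        s (axisPt t) * conn e 0 2 0 (axisPt t) ∧
      ‖iteratedDeriv 1 (fun t => f (axisPt t)) t‖ ^ 2 = s (axisPt t) ^ 2 ∧
      (conn e 0 2 0 (axisPt t) ≠ 0 → torsion (fun t => f (axisPt t)) t =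
        det3 (fun i => e i (axisPt t)) *
        ((conn e 0 1 0 (axisPt t) ^ 2 + conn e 0 2 0 (axisPt t) ^ 2) * conn e 0 2 1 (axisPt t) +
          (conn e 0 1 0 (axisPt t) * pder 0 (conn e 0 2 0) (axisPt t) -
            conn e 0 2 0 (axisPt t) * pder 0 (conn e 0 1 0) (axisPt t))) /
        (s (axisPt t) * (conn e 0 1 0 (axisPt t) ^ 2 + conn e 0 2 0 (axisPt t) ^ 2))) := by
  filter_upwards [iteratedDeriv_comp_axisPt hf.analyticAt_map 1,
    iteratedDeriv_comp_axisPt hf.analyticAt_map 2, iteratedDeriv_comp_axisPt hf.analyticAt_map 3,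
    tendsto_axisPt.eventually (hf.iterate_pder hs), tendsto_axisPt.eventually hf.orthonormal,
    tendsto_axisPt.eventually (hs.continuousAt.eventually_const_lt hs0)]
    with t h1 h2 h3 ⟨p1, p2, r, p3⟩ ho hst
  rw [p1] at h1
  rw [p2] at h2
  rw [p3] at h3
  have hoi := orthonormal_iff_ite.1 ho
  refine ⟨?_, ?_, fun hL => ?_⟩
  · rw [h2]
    simp only [inner_add_left, real_inner_smul_left, hoi]
    simp
  · rw [h1, norm_smul, ho.1 0, mul_one, Real.norm_eq_abs, sq_abs]
  · have haL : conn e 0 1 0 (axisPt t) ^ 2 + conn e 0 2 0 (axisPt t) ^ 2 ≠ 0 := by positivity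
    rw [torsion_eq_det3, torsion_of_frame ho hst.ne' haL h1 h2 h3]
    have := hst.ne'
    field_simp
    ring

/-! ### Planar realizations -/

/-- `f` with unit normal `ν` realizes the metric `(s du + q dv)² + (l dv)²`, with normal curvature
`e^w` and torsion `μ` along the first axis. -/
structure IsPlanarRealization (s q l : Plane → ℝ) (w μ : ℝ → ℝ) (f ν : Plane → Space) : Prop where
  analyticAt_map : AnalyticAt ℝ f 0
  analyticAt_normal : AnalyticAt ℝ ν 0
  norm_normal : ∀ᶠ x in 𝓝 0, ‖ν x‖ = 1
  inner_normal : ∀ᶠ x in 𝓝 0, ∀ i, inner ℝ (pder i f x) (ν x) = 0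
  inner_zero_zero : ∀ᶠ x in 𝓝 0, inner ℝ (pder 0 f x) (pder 0 f x) = s x ^ 2
  inner_zero_one : ∀ᶠ x in 𝓝 0, inner ℝ (pder 0 f x) (pder 1 f x) = s x * q x
  inner_one_one : ∀ᶠ x in 𝓝 0, inner ℝ (pder 1 f x) (pder 1 f x) = q x ^ 2 + l x ^ 2
  normal_curvature : ∀ᶠ t in 𝓝 (0 : ℝ),
    inner ℝ (iteratedDeriv 2 (fun t => f (axisPt t)) t) (ν (axisPt t)) /
      ‖iteratedDeriv 1 (fun t => f (axisPt t)) t‖ ^ 2 = Real.exp (w t)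
  torsion_eq : ∀ᶠ t in 𝓝 (0 : ℝ), torsion (fun t => f (axisPt t)) t = μ t

lemma eq_inner_smul_cross {x y v : Space} (hx : inner ℝ x x = (1 : ℝ)) (hy : inner ℝ y y = (1 : ℝ))
    (hxy : inner ℝ x y = (0 : ℝ)) (hvx : inner ℝ v x = (0 : ℝ)) (hvy : inner ℝ v y = (0 : ℝ)) :
    v = inner ℝ v (cross x y) • cross x y := by
  have ho : Orthonormal ℝ ![x, y, cross x y] := by
    rw [orthonormal_iff_ite]
    have hcc : inner ℝ (cross x y) (cross x y) = (1 : ℝ) := by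
      rw [inner_cross_cross, hx, hy, hxy]
      ring
    have hyx : inner ℝ y x = (0 : ℝ) := by rw [real_inner_comm, hxy]
    have hcx : inner ℝ (cross x y) x = (0 : ℝ) := by rw [real_inner_comm, inner_cross_left]
    have hcy : inner ℝ (cross x y) y = (0 : ℝ) := by rw [real_inner_comm, inner_cross_right]
    intro i j
    fin_cases i <;> fin_cases j <;>
      simp [-inner_self_eq_norm_sq_to_K, hx, hy, hxy, hyx, hcx, hcy, hcc, inner_cross_left, inner_cross_right]
  have h := eq_sum_of_orthonormal ho v
  simp only [Fin.sum_univ_three, Matrix.cons_val_zero, Matrix.cons_val_one, Matrix.cons_val] at h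
  rw [real_inner_comm, hvx, real_inner_comm, hvy] at h
  conv_lhs => rw [h]
  rw [real_inner_comm v]
  simp

/-- A realization has an adapted frame whose last vector is the normal. -/
lemma IsPlanarRealization.exists_frame {w μ : ℝ → ℝ} {ν : Plane → Space} (h : IsCoframe s q l a)
    (hf : IsPlanarRealization s q l w μ f ν) :
    ∃ e : Fin 3 → Plane → Space, IsAdapted s q l f e ∧ e 2 = ν := by
  -- Here `e₀` is the normalized `f_u`, `n` completes it and the normal to an orthonormal frame, and
  -- `y` is the part of `f_v` orthogonal to `e₀`, hence a multiple `c` of `n`.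
  let e₀ : Plane → Space := fun x => (s x)⁻¹ • pder 0 f x
  let n : Plane → Space := fun x => cross (ν x) (e₀ x)
  let y : Plane → Space := fun x => pder 1 f x - q x • e₀ x
  let c : Plane → ℝ := fun x => inner ℝ (y x) (n x)
  have he₀ : AnalyticAt ℝ e₀ 0 := h.analyticAt_inv.smul (analyticAt_pder hf.analyticAt_map 0)
  have hn : AnalyticAt ℝ n 0 := analyticAt_cross hf.analyticAt_normal he₀
  have hy : AnalyticAt ℝ y 0 := (analyticAt_pder hf.analyticAt_map 1).sub (h.analyticAt_q.smul he₀)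
  have hc : AnalyticAt ℝ c 0 := analyticAt_inner hy hn
  have key : ∀ᶠ x in 𝓝 0, pder 0 f x = s x • e₀ x ∧ inner ℝ (e₀ x) (e₀ x) = (1 : ℝ) ∧
      inner ℝ (ν x) (ν x) = (1 : ℝ) ∧ inner ℝ (ν x) (e₀ x) = (0 : ℝ) ∧ y x = c x • n x ∧
      c x ^ 2 = l x ^ 2 := by
    filter_upwards [h.eventually_pos, hf.norm_normal, hf.inner_normal, hf.inner_zero_zero,
      hf.inner_zero_one, hf.inner_one_one] with x hs hν hin h00 h01 h11
    have p0 : pder 0 f x = s x • e₀ x := by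
      simp only [e₀]
      rw [smul_inv_smul₀ hs.ne']
    have p1 : inner ℝ (e₀ x) (e₀ x) = (1 : ℝ) := by
      simp only [e₀, real_inner_smul_left, real_inner_smul_right, h00]
      field_simp
    have p2 : inner ℝ (ν x) (ν x) = (1 : ℝ) := by rw [real_inner_self_eq_norm_sq, hν, one_pow]
    have p3 : inner ℝ (ν x) (e₀ x) = (0 : ℝ) := by
      simp only [e₀, real_inner_smul_right]
      rw [real_inner_comm, hin 0, mul_zero]
    have p5 : inner ℝ (e₀ x) (pder 1 f x) = q x := by
      simp only [e₀, real_inner_smul_left, h01]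
      field_simp
    have p6 : inner ℝ (y x) (ν x) = (0 : ℝ) := by
      simp only [y]
      rw [inner_sub_left, real_inner_smul_left, hin 1, real_inner_comm, p3]
      ring
    have p7 : inner ℝ (y x) (e₀ x) = (0 : ℝ) := by
      simp only [y]
      rw [inner_sub_left, real_inner_smul_left, p1, real_inner_comm, p5]
      ring
    have p8 : y x = c x • n x := eq_inner_smul_cross p2 p1 p3 p6 p7
    have p9 : inner ℝ (y x) (y x) = l x ^ 2 := by
      have : inner ℝ (y x) (y x) = inner ℝ (y x) (pder 1 f x) := by
        conv_lhs => rw [show y x = pder 1 f x - q x • e₀ x from rfl, inner_sub_right,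
          real_inner_smul_right, ← show y x = pder 1 f x - q x • e₀ x from rfl, p7]
        ring
      rw [this]
      simp only [y]
      rw [inner_sub_left, real_inner_smul_left, h11, p5]
      ring
    refine ⟨p0, p1, p2, p3, p8, ?_⟩
    have p10 : inner ℝ (n x) (n x) = (1 : ℝ) := by
      simp only [n]
      rw [inner_cross_cross, p1, p2, p3]
      ring
    rw [← p9, p8, real_inner_smul_left, real_inner_smul_right, p10]
    ring
  -- The metric gives only `c² = l²`. As germs form a domain, `(c - l)(c + l) = 0` yields `c = ± l`
  -- with one sign near the origin, even across zeros of `l`; the sign is absorbed in the second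
  -- frame vector.
  obtain ⟨τ, hτ, hτc⟩ : ∃ τ : ℝ, τ * τ = 1 ∧ ∀ᶠ x in 𝓝 0, c x = τ * l x := by
    rcases eventually_zero_of_mul_eventually_zero (hc.sub h.analyticAt_l) (hc.add h.analyticAt_l) (by
      filter_upwards [key] with x hx
      simp only [Pi.sub_apply, Pi.add_apply]
      linear_combination hx.2.2.2.2.2) with h1 | h1
    · refine ⟨1, by norm_num, ?_⟩
      filter_upwards [h1] with x hx
      simp only [Pi.sub_apply] at hx
      linarith
    · refine ⟨-1, by norm_num, ?_⟩
      filter_upwards [h1] with x hx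
      simp only [Pi.add_apply] at hx
      linarith
  refine ⟨![e₀, fun x => τ • n x, ν], ⟨hf.analyticAt_map, ?_, ?_, ?_, ?_⟩, rfl⟩
  · intro i
    fin_cases i
    · exact he₀
    · exact (analyticAt_const : AnalyticAt ℝ (fun _ : Plane => τ) 0).smul hn
    · exact hf.analyticAt_normal
  · filter_upwards [key] with x ⟨_, p1, p2, p3, _, _⟩
    rw [orthonormal_iff_ite]
    have hnn : inner ℝ (n x) (n x) = (1 : ℝ) := by
      simp only [n]
      rw [inner_cross_cross, p1, p2, p3]
      ring
    have p3' : inner ℝ (e₀ x) (ν x) = (0 : ℝ) := by rw [real_inner_comm, p3]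
    have q1 : inner ℝ (ν x) (n x) = (0 : ℝ) := inner_cross_left _ _
    have q2 : inner ℝ (e₀ x) (n x) = (0 : ℝ) := inner_cross_right _ _
    have q1' : inner ℝ (n x) (ν x) = (0 : ℝ) := by rw [real_inner_comm, q1]
    have q2' : inner ℝ (n x) (e₀ x) = (0 : ℝ) := by rw [real_inner_comm, q2]
    intro i j
    fin_cases i <;> fin_cases j <;>
      simp [-inner_self_eq_norm_sq_to_K, p1, p2, p3, p3', q1, q2, q1', q2', hnn,
        real_inner_smul_left, real_inner_smul_right, hτ]
  · filter_upwards [key] with x hx using hx.1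
  · filter_upwards [key, hτc] with x ⟨_, _, _, _, p, _⟩ hx
    rw [hx] at p
    have : pder 1 f x = y x + q x • e₀ x := by simp [y]
    rw [this, p]
    simp only [Matrix.cons_val_zero, Matrix.cons_val_one]
    module

end

end KossowskiMetrics

namespace KossowskiMetrics

open Finset Filter

/-! ### The initial values on the axis -/

lemma eventually_of_axis {P : Plane → Prop} (h : ∀ᶠ t in 𝓝 (0 : ℝ), P (axisPt t)) :
    ∀ᶠ x : Plane in 𝓝 0, x 1 = 0 → P x := by
  have hc : Tendsto (fun x : Plane => x 0) (𝓝 0) (𝓝 0) :=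
    ((EuclideanSpace.proj 0 : Plane →L[ℝ] ℝ).continuous.tendsto 0)
  filter_upwards [hc.eventually h] with x hx h1
  have : axisPt (x 0) = x := by
    ext i
    fin_cases i
    · rfl
    · exact h1.symm
  rwa [this] at hx

/-- The value on the axis of the second fundamental form on `e₀, ∂_u`. -/
noncomputable def normalInit (s : Plane → ℝ) (w : ℝ → ℝ) (x : Plane) : ℝ :=
  s x * Real.exp (w (x 0))

/-- The value on the axis of the second fundamental form on `e₁, ∂_u`. -/
noncomputable def mixedInit (σ : ℝ) (s a : Plane → ℝ) (w μ : ℝ → ℝ) (x : Plane) : ℝ :=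
  σ * s x * μ (x 0) -
    (a x * pder 0 (normalInit s w) x - normalInit s w x * pder 0 a x) *
      (a x ^ 2 + normalInit s w x ^ 2)⁻¹

section

variable {s q l a : Plane → ℝ} {f : Plane → Space} {e : Fin 3 → Plane → Space} {w μ : ℝ → ℝ}

lemma analyticAt_comp_fst {φ : ℝ → ℝ} (h : AnalyticAt ℝ φ 0) :
    AnalyticAt ℝ (fun x : Plane => φ (x 0)) 0 :=
  AnalyticAt.comp (g := φ) (f := fun x : Plane => x 0) h
    ((EuclideanSpace.proj 0 : Plane →L[ℝ] ℝ).analyticAt 0)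

lemma analyticAt_normalInit (hs : AnalyticAt ℝ s 0) (hw : AnalyticAt ℝ w 0) :
    AnalyticAt ℝ (normalInit s w) 0 :=
  hs.mul (analyticAt_comp_fst hw).rexp

lemma normalInit_pos {x : Plane} (hs : 0 < s x) : 0 < normalInit s w x :=
  mul_pos hs (Real.exp_pos _)

lemma analyticAt_mixedInit (σ : ℝ) (hs : AnalyticAt ℝ s 0) (hs0 : 0 < s 0) (ha : AnalyticAt ℝ a 0)
    (hw : AnalyticAt ℝ w 0) (hμ : AnalyticAt ℝ μ 0) : AnalyticAt ℝ (mixedInit σ s a w μ) 0 := by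
  have hL := analyticAt_normalInit hs hw
  have hpos := normalInit_pos (w := w) hs0
  refine ((analyticAt_const.mul hs).mul (analyticAt_comp_fst hμ)).sub
    (((ha.mul (analyticAt_pder hL 0)).sub (hL.mul (analyticAt_pder ha 0))).mul
      (((ha.pow 2).add (hL.pow 2)).inv ?_))
  simp only [Pi.add_apply, Pi.pow_apply]
  positivity

/-- A continuous function with values `± 1` is locally constant. -/
lemma IsAdapted.eventually_det3_eq (hf : IsAdapted s q l f e) :
    ∀ᶠ x in 𝓝 0, det3 (fun i => e i x) = det3 (fun i => e i 0) := by
  have heq : ∀ x, det3 (fun i => e i x) = inner ℝ (e 0 x) (cross (e 1 x) (e 2 x)) := by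
    intro x
    rw [det3, inner_space, cross_apply_zero, cross_apply_one, cross_apply_two, Matrix.det_fin_three]
    simp only [Matrix.of_apply]
    ring
  have hc : ContinuousAt (fun x => det3 (fun i => e i x)) 0 := by
    simp only [heq]
    exact (analyticAt_inner (hf.analyticAt_frame 0)
      (analyticAt_cross (hf.analyticAt_frame 1) (hf.analyticAt_frame 2))).continuousAt
  have h0 := det3_sq_of_orthonormal hf.orthonormal.self_of_nhds
  filter_upwards [hf.orthonormal, hc.eventually (Metric.ball_mem_nhds _ one_pos)] with x h1 h2
  have h3 := det3_sq_of_orthonormal h1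
  rw [Real.dist_eq, abs_lt] at h2
  rcases mul_self_eq_one_iff.1 (by rw [← sq, h0] : _ * (det3 fun i => e i 0) = 1) with h | h <;>
    rcases mul_self_eq_one_iff.1 (by rw [← sq, h3] : _ * (det3 fun i => e i x) = 1) with h' | h' <;>
    rw [h, h'] at h2 ⊢ <;> norm_num at h2

/-- Along the axis, the second fundamental form is determined by the normal curvature, the torsion
and the orientation of the frame. -/
lemma IsAdapted.conn_axis (h : IsCoframe s q l a) (hw : AnalyticAt ℝ w 0)
    (hf : IsAdapted s q l f e) (hr : IsPlanarRealization s q l w μ f (e 2)) :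
    (∀ᶠ x : Plane in 𝓝 0, x 1 = 0 → conn e 0 2 0 x = normalInit s w x) ∧
    ∀ᶠ x : Plane in 𝓝 0, x 1 = 0 →
      conn e 0 2 1 x = mixedInit (det3 fun i => e i 0) s a w μ x := by
  have hL : ∀ᶠ x : Plane in 𝓝 0, x 1 = 0 → conn e 0 2 0 x = normalInit s w x := by
    refine eventually_of_axis ?_
    filter_upwards [hf.axis h.analyticAt_s h.s_pos, hr.normal_curvature,
      tendsto_axisPt.eventually h.eventually_pos] with t ⟨h1, h2, _⟩ h3 hs
    rw [h1, h2] at h3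
    rw [normalInit, show axisPt t 0 = t from rfl, ← h3]
    field_simp
  refine ⟨hL, eventually_of_axis ?_⟩
  have hdL : ∀ᶠ x : Plane in 𝓝 0, x 1 = 0 → pder 0 (conn e 0 2 0) x = pder 0 (normalInit s w) x := by
    filter_upwards [hL.eventually_nhds,
      (analyticAt_conn hf.analyticAt_frame 0 2 0).eventually_analyticAt,
      (analyticAt_normalInit h.analyticAt_s hw).eventually_analyticAt] with x h1 h2 h3 hx
    exact pder_zero_eq_of_axis hx h2.differentiableAt h3.differentiableAt h1
  filter_upwards [hf.axis h.analyticAt_s h.s_pos, tendsto_axisPt.eventually hL,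
    tendsto_axisPt.eventually hdL, tendsto_axisPt.eventually (hf.conn_zero_eq h).eventually_nhds,
    tendsto_axisPt.eventually hf.eventually_det3_eq, hr.torsion_eq,
    tendsto_axisPt.eventually h.eventually_pos] with t ⟨_, _, h1⟩ h2 h3 h4 h5 h6 hs
  have hpos := normalInit_pos (w := w) hs
  have h2' := h2 rfl
  have h7 := h1 (by rw [h2']; exact hpos.ne')
  have hσ := det3_sq_of_orthonormal hf.orthonormal.self_of_nhds
  rw [h6, h2', h3 rfl, h4.self_of_nhds, pder_congr h4, h5] at h7
  rw [mixedInit, show axisPt t 0 = t from rfl, h7]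
  set σ := det3 fun i => e i 0
  have haL : a (axisPt t) ^ 2 + normalInit s w (axisPt t) ^ 2 ≠ 0 := by positivity
  have hs' := hs.ne'
  field_simp
  -- With `σ² = 1`, multiplying the torsion formula by `σ` solves it for `M`, which is how
  -- `mixedInit` arises.
  rw [hσ]
  ring

/-- Planar realizations whose frames have the same orientation, or with vanishing torsion, differ
by a rigid motion. -/
lemma IsAdapted.congruent_of_realization (h : IsCoframe s q l a) (hw : AnalyticAt ℝ w 0)
    {f' : Plane → Space} {e' : Fin 3 → Plane → Space} (hf : IsAdapted s q l f e)
    (hf' : IsAdapted s q l f' e') (hr : IsPlanarRealization s q l w μ f (e 2))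
    (hr' : IsPlanarRealization s q l w μ f' (e' 2))
    (hor : (det3 fun i => e i 0) = (det3 fun i => e' i 0) ∨ ∀ᶠ t in 𝓝 0, μ t = 0) :
    ∃ Φ : Space ≃ᵢ Space, f' =ᶠ[𝓝 0] Φ ∘ f := by
  obtain ⟨h1, h2⟩ := hf.conn_axis h hw hr
  obtain ⟨h1', h2'⟩ := hf'.conn_axis h hw hr'
  refine hf.congruent h hf' ?_ ?_ ?_
  · filter_upwards [h1, h1'] with x hx hx' hx1
    rw [hx hx1, hx' hx1]
  · rcases hor with hor | hor
    · filter_upwards [h2, h2'] with x hx hx' hx1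
      rw [hx hx1, hx' hx1, hor]
    -- The orientation sign occurs in `mixedInit` only as a factor of `μ`, so it disappears when `μ`
    -- does.
    · have hc : Tendsto (fun x : Plane => x 0) (𝓝 0) (𝓝 0) :=
        ((EuclideanSpace.proj 0 : Plane →L[ℝ] ℝ).continuous.tendsto 0)
      filter_upwards [h2, h2', hc.eventually hor] with x hx hx' hx0 hx1
      rw [hx hx1, hx' hx1, mixedInit, mixedInit, hx0]
      simp
  · rw [h1.self_of_nhds (by simp)]
    exact (normalInit_pos h.s_pos).ne'

/-! ### Existence of adapted frames -/

/-- The connection matrix of the frame, bordered by the coframe. -/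
noncomputable def borderedConn (s q l a b L M M' N : Plane → ℝ) :
    Fin 2 → Matrix (Fin 4) (Fin 4) (Plane → ℝ) :=
  ![!![0, -a, -L, s; a, 0, -M, 0; L, M, 0, 0; 0, 0, 0, 0],
    !![0, -b, -M', q; b, 0, -N, l; M', N, 0, 0; 0, 0, 0, 0]]

/-- The hypotheses are the Gauss equation `h1`, the Codazzi equations `h2` and `h3`, and the three
components `h4`, `h5`, `h6` of the closedness of `df`. Bordering by the coframe makes the map a
fourth unknown, so that all integrability conditions become a single flatness condition. -/
lemma borderedConn_flat {b L M M' N : Plane → ℝ} {x : Plane}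
    (h1 : pder 1 a x - N x * L x = pder 0 b x - M x * M' x)
    (h2 : pder 1 L x + N x * a x = pder 0 M' x + M x * b x)
    (h3 : pder 1 M x - M' x * a x = pder 0 N x - L x * b x)
    (h4 : pder 1 s x = pder 0 q x - a x * l x)
    (h5 : b x * s x = pder 0 l x + a x * q x) (h6 : M' x * s x = L x * q x + M x * l x)
    (j i : Fin 4) :
    pder 1 (borderedConn s q l a b L M M' N 0 j i) x +
      ∑ k, borderedConn s q l a b L M M' N 1 j k x * borderedConn s q l a b L M M' N 0 k i x =
    pder 0 (borderedConn s q l a b L M M' N 1 j i) x +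
      ∑ k, borderedConn s q l a b L M M' N 0 j k x * borderedConn s q l a b L M M' N 1 k i x := by
  have hneg : ∀ (m : Fin 2) (F : Plane → ℝ), pder m (-F) x = -pder m F x := fun m F => by
    rw [pder, fderiv_neg]
    rfl
  have hzero : ∀ (m : Fin 2), pder m (0 : Plane → ℝ) x = 0 := fun m => by simp [pder]
  fin_cases j <;> fin_cases i <;>
    simp [borderedConn, Fin.sum_univ_four, hneg, hzero] <;> linarith

/-- A bordered connection with vanishing curvature comes from an adapted frame. -/
lemma exists_isAdapted {b L M M' N : Plane → ℝ} {σ : ℝ} (hσ : σ ^ 2 = 1)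
    (hA : ∀ m j i, AnalyticAt ℝ (borderedConn s q l a b L M M' N m j i) 0)
    (hflat : ∀ j i, ∀ᶠ x in 𝓝 0, pder 1 (borderedConn s q l a b L M M' N 0 j i) x +
      ∑ k, borderedConn s q l a b L M M' N 1 j k x * borderedConn s q l a b L M M' N 0 k i x =
    pder 0 (borderedConn s q l a b L M M' N 1 j i) x +
      ∑ k, borderedConn s q l a b L M M' N 0 j k x * borderedConn s q l a b L M M' N 1 k i x) :
    ∃ (f : Plane → Space) (e : Fin 3 → Plane → Space), IsAdapted s q l f e ∧
      (det3 fun i => e i 0) = σ ∧ (∀ᶠ x in 𝓝 0, conn e 0 2 0 x = L x) ∧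
      ∀ᶠ x in 𝓝 0, conn e 0 2 1 x = M x := by
  -- There is one parallel section for each coordinate of space. The initial values describe the
  -- frame with determinant `σ` at the origin, with `f` vanishing there.
  choose X hX hX0 hXd using fun c : Fin 3 => exists_parallel hA hflat
    ((!![1, 0, 0, 0; 0, 1, 0, 0; 0, 0, σ, 0] : Matrix (Fin 3) (Fin 4) ℝ) c)
  let V : Fin 4 → Plane → Space := fun i x => WithLp.toLp 2 fun c => X c i x
  have hV : ∀ {x : Plane} i, (∀ c, AnalyticAt ℝ (X c i) x) → AnalyticAt ℝ (V i) x := fun i h =>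
    ((EuclideanSpace.equiv (Fin 3) ℝ).symm.toContinuousLinearMap.analyticAt _).comp
      (f := fun y c => X c i y) (analyticAt_pi_iff.2 h)
  have hXan : ∀ᶠ x in 𝓝 0, ∀ c i, AnalyticAt ℝ (X c i) x :=
    eventually_all.2 fun c => eventually_all.2 fun i => (hX c i).eventually_analyticAt
  have hXd' : ∀ᶠ x in 𝓝 0, ∀ c m i, pder m (X c i) x =
      ∑ j, X c j x * borderedConn s q l a b L M M' N m j i x :=
    eventually_all.2 fun c => eventually_all.2 fun m => eventually_all.2 fun i => hXd c m i
  have hVd : ∀ᶠ x in 𝓝 0, ∀ m i, pder m (V i) x =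
      ∑ j, borderedConn s q l a b L M M' N m j i x • V j x := by
    filter_upwards [hXan, hXd'] with x h1 h2 m i
    ext c
    have h3 : pder m (X c i) x = (pder m (V i) x) c :=
      congrArg (fun T : Plane →L[ℝ] ℝ => T (coordVec m))
        ((EuclideanSpace.proj c : Space →L[ℝ] ℝ).hasFDerivAt.comp x
          (hV i fun c => h1 c i).differentiableAt.hasFDerivAt).fderiv
    rw [← h3, h2]
    simp [V, mul_comm, Fin.sum_univ_four]
  -- Antisymmetry of the upper left block keeps the rows orthonormal. For a square matrix the
  -- columns, which are the frame vectors, are then orthonormal too.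
  have hrows : ∀ c d : Fin 3, ∀ᶠ x in 𝓝 0, ∑ i : Fin 3, X c i.castSucc x * X d i.castSucc x =
      if c = d then 1 else 0 := by
    intro c d
    have hφ : AnalyticAt ℝ (fun x => ∑ i : Fin 3, X c i.castSucc x * X d i.castSucc x) 0 :=
      Finset.analyticAt_fun_sum _ fun i _ => (hX c _).mul (hX d _)
    have h0 := eventually_const_of_pder_eq_zero hφ (by
      intro m
      filter_upwards [hXan, hXd'] with x h1 h2
      have hd := fun c i => (h1 c i).differentiableAt
      rw [pder_sum _ m fun i _ => (hd c _).fun_mul (hd d _)]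
      simp only [pder_mul m (hd c _) (hd d _), h2, Fin.sum_univ_three, Fin.sum_univ_four]
      fin_cases m <;> simp [borderedConn] <;> ring)
    filter_upwards [h0] with x hx
    rw [hx]
    simp only [hX0, Fin.sum_univ_three]
    fin_cases c <;> fin_cases d <;> simp [← sq, hσ]
  have hrows' := eventually_all.2 fun c => eventually_all.2 fun d => hrows c d
  have ho : ∀ᶠ x in 𝓝 0, Orthonormal ℝ fun i : Fin 3 => V i.castSucc x := by
    filter_upwards [hrows'] with x hx
    let Q : Matrix (Fin 3) (Fin 3) ℝ := Matrix.of fun c i => X c i.castSucc x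
    have hQ : Q * Q.transpose = 1 := by
      ext c d
      rw [Matrix.mul_apply, Matrix.one_apply, ← hx c d]
      rfl
    rw [orthonormal_iff_ite]
    intro i j
    have h1 := congrArg (fun R : Matrix (Fin 3) (Fin 3) ℝ => R i j) (mul_eq_one_comm.1 hQ)
    simp only [Matrix.mul_apply, Fin.sum_univ_three, Matrix.one_apply] at h1
    rw [inner_space]
    exact h1
  have hconn : ∀ᶠ x in 𝓝 0, ∀ m (j i : Fin 3), conn (fun i => V i.castSucc) m j i x =
      borderedConn s q l a b L M M' N m j.castSucc i.castSucc x := by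
    filter_upwards [hVd, ho] with x h1 h2 m j i
    have h3 := orthonormal_iff_ite.1 h2 j
    have hlast : borderedConn s q l a b L M M' N m 3 i.castSucc x = 0 := by
      fin_cases m <;> fin_cases i <;> rfl
    rw [conn, h1, Fin.sum_univ_castSucc]
    change inner ℝ _ (_ + borderedConn s q l a b L M M' N m 3 i.castSucc x • _) = _
    rw [hlast, zero_smul, add_zero, inner_sum]
    simp only [real_inner_smul_right, h3]
    simp
  refine ⟨V 3, fun i => V i.castSucc, ⟨hV 3 fun c => hX c 3, fun i => hV _ fun c => hX c _, ho, ?_, ?_⟩,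
    ?_, ?_, ?_⟩
  · filter_upwards [hVd] with x hx
    rw [hx, Fin.sum_univ_four]
    simp [borderedConn]
  · filter_upwards [hVd] with x hx
    rw [hx, Fin.sum_univ_four]
    simp [borderedConn]
  · rw [det3, Matrix.det_fin_three]
    simp [V, hX0]
  · filter_upwards [hconn] with x hx
    rw [hx]
    rfl
  · filter_upwards [hconn] with x hx
    rw [hx]
    rfl

/-- An adapted frame with the prescribed second fundamental form on the axis gives a
realization. -/
lemma IsAdapted.isPlanarRealization (h : IsCoframe s q l a) (hw : AnalyticAt ℝ w 0)
    (hf : IsAdapted s q l f e)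
    (hL : ∀ᶠ x : Plane in 𝓝 0, x 1 = 0 → conn e 0 2 0 x = normalInit s w x)
    (hM : ∀ᶠ x : Plane in 𝓝 0, x 1 = 0 →
      conn e 0 2 1 x = mixedInit (det3 fun i => e i 0) s a w μ x) :
    IsPlanarRealization s q l w μ f (e 2) := by
  have hp : ∀ᶠ x in 𝓝 0, pder 0 f x = s x • e 0 x + (0 : ℝ) • e 1 x + (0 : ℝ) • e 2 x ∧
      pder 1 f x = q x • e 0 x + l x • e 1 x + (0 : ℝ) • e 2 x := by
    filter_upwards [hf.pder_zero, hf.pder_one] with x h0 h1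
    rw [h0, h1]
    exact ⟨by module, by module⟩
  have hdL : ∀ᶠ x : Plane in 𝓝 0, x 1 = 0 → pder 0 (conn e 0 2 0) x = pder 0 (normalInit s w) x := by
    filter_upwards [hL.eventually_nhds,
      (analyticAt_conn hf.analyticAt_frame 0 2 0).eventually_analyticAt,
      (analyticAt_normalInit h.analyticAt_s hw).eventually_analyticAt] with x h1 h2 h3 hx
    exact pder_zero_eq_of_axis hx h2.differentiableAt h3.differentiableAt h1
  refine ⟨hf.analyticAt_map, hf.analyticAt_frame 2, ?_, ?_, ?_, ?_, ?_, ?_, ?_⟩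
  · filter_upwards [hf.orthonormal] with x hx using hx.1 2
  · filter_upwards [hf.orthonormal, hp] with x hx ⟨h0, h1⟩
    have hi := orthonormal_iff_ite.1 hx
    rw [Fin.forall_fin_two, h0, h1]
    simp only [inner_add_left, real_inner_smul_left, hi]
    simp
  · filter_upwards [hf.orthonormal, hp] with x hx ⟨h0, h1⟩
    rw [h0, inner_frame_combination hx]
    ring
  · filter_upwards [hf.orthonormal, hp] with x hx ⟨h0, h1⟩
    rw [h0, h1, inner_frame_combination hx]
    ring
  · filter_upwards [hf.orthonormal, hp] with x hx ⟨h0, h1⟩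
    rw [h1, inner_frame_combination hx]
    ring
  · filter_upwards [hf.axis h.analyticAt_s h.s_pos, tendsto_axisPt.eventually hL,
      tendsto_axisPt.eventually h.eventually_pos] with t ⟨h1, h2, _⟩ h3 hs
    rw [h1, h2, h3 rfl, normalInit, show axisPt t 0 = t from rfl]
    field_simp
  · filter_upwards [hf.axis h.analyticAt_s h.s_pos, tendsto_axisPt.eventually hL,
      tendsto_axisPt.eventually hdL, tendsto_axisPt.eventually (hf.conn_zero_eq h).eventually_nhds,
      tendsto_axisPt.eventually hf.eventually_det3_eq, tendsto_axisPt.eventually hM,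
      tendsto_axisPt.eventually h.eventually_pos] with t ⟨_, _, h1⟩ h2 h3 h4 h5 h6 hs
    have hpos := normalInit_pos (w := w) hs
    have h2' := h2 rfl
    rw [h1 (by rw [h2']; exact hpos.ne'), h2', h3 rfl, h4.self_of_nhds, pder_congr h4, h5, h6 rfl,
      mixedInit, show axisPt t 0 = t from rfl]
    have hσ := det3_sq_of_orthonormal hf.orthonormal.self_of_nhds
    set σ := det3 fun i => e i 0
    have haL : a (axisPt t) ^ 2 + normalInit s w (axisPt t) ^ 2 ≠ 0 := by positivity
    have hs' := hs.ne'
    field_simp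
    ring_nf
    rw [hσ]
    ring

/-- Planar realizations exist, with both orientations of the frame. -/
theorem exists_isPlanarRealization (h : IsCoframe s q l a) (hw : AnalyticAt ℝ w 0)
    (hμ : AnalyticAt ℝ μ 0) {σ : ℝ} (hσ : σ ^ 2 = 1) :
    ∃ (f : Plane → Space) (e : Fin 3 → Plane → Space), IsAdapted s q l f e ∧
      (det3 fun i => e i 0) = σ ∧ IsPlanarRealization s q l w μ f (e 2) := by
  obtain ⟨L, M, hL, hM, ⟨hGC1, hGC2⟩, hL0, hM0⟩ := exists_gaussCodazzi h.analyticAt_q_div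
    h.analyticAt_l_div h.analyticAt_a h.analyticAt_connV h.analyticAt_curvDensity
    (analyticAt_normalInit h.analyticAt_s hw)
    (analyticAt_mixedInit σ h.analyticAt_s h.s_pos h.analyticAt_a hw hμ)
    (normalInit_pos h.s_pos).ne'
  have hLne : L 0 ≠ 0 := by
    rw [hL0.self_of_nhds (by simp)]
    exact (normalInit_pos h.s_pos).ne'
  -- `M'` and `N` are the values forced by the symmetry of the second fundamental form and by the
  -- Gauss equation.
  set M' : Plane → ℝ := fun x => q x * (s x)⁻¹ * L x + l x * (s x)⁻¹ * M x with hM'def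
  set N : Plane → ℝ := fun x => (curvDensity s q l a x + M x * M' x) * (L x)⁻¹ with hNdef
  have hM' : AnalyticAt ℝ M' 0 := (h.analyticAt_q_div.mul hL).add (h.analyticAt_l_div.mul hM)
  have hN : AnalyticAt ℝ N 0 := (h.analyticAt_curvDensity.add (hM.mul hM')).mul (hL.inv hLne)
  have hz : AnalyticAt ℝ (0 : Plane → ℝ) 0 := analyticAt_const
  have hs := h.analyticAt_s
  have hq := h.analyticAt_q
  have hl := h.analyticAt_l
  have ha := h.analyticAt_a
  have hb := h.analyticAt_connV
  have han := ha.neg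
  have hLn := hL.neg
  have hMn := hM.neg
  have hbn := hb.neg
  have hMn' := hM'.neg
  have hNn := hN.neg
  obtain ⟨f, e, hf, hdet, h1, h2⟩ := exists_isAdapted (s := s) (q := q) (l := l) (a := a)
    (b := connV s q l a) (L := L) (M := M) (M' := M') (N := N) hσ (by
      intro m j i
      fin_cases m <;> fin_cases j <;> fin_cases i <;> assumption) (by
      intro j i
      filter_upwards [hGC1, hGC2, h.mul_eq, h.eventually_pos,
        hL.continuousAt.eventually_ne hLne] with x g1 g2 g3 g4 g5
      refine borderedConn_flat ?_ ?_ ?_ ?_ ?_ ?_ j i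
      · have : N x * L x = curvDensity s q l a x + M x * M' x := by
          simp only [hNdef]
          field_simp
        rw [this, curvDensity]
        ring
      · rw [g1]
        simp only [hNdef, hM'def]
        ring
      · rw [g2]
        simp only [hNdef, hM'def]
        ring
      · linarith
      · rw [connV]
        field_simp
        ring
      · simp only [hM'def]
        field_simp)
  refine ⟨f, e, hf, hdet, hf.isPlanarRealization h hw ?_ ?_⟩
  · filter_upwards [h1, hL0] with x h3 h4 hx
    rw [h3, h4 hx]
  · filter_upwards [h2, hM0] with x h3 h4 hx
    rw [h3, h4 hx, hdet]

end

end KossowskiMetrics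

namespace KossowskiMetrics

open Finset Filter

/-! ### Local coordinates -/

lemma bilin_eq (B : Plane →ₗ[ℝ] Plane →ₗ[ℝ] ℝ) (v w : Plane) :
    B v w = v 0 * w 0 * B (coordVec 0) (coordVec 0) + v 0 * w 1 * B (coordVec 0) (coordVec 1) +
      v 1 * w 0 * B (coordVec 1) (coordVec 0) + v 1 * w 1 * B (coordVec 1) (coordVec 1) := by
  have h : ∀ v : Plane, v = v 0 • coordVec 0 + v 1 • coordVec 1 := by
    intro v
    ext i
    fin_cases i <;> simp [coordVec]
  conv_lhs => rw [h v, h w]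
  simp only [map_add, map_smul, LinearMap.add_apply, LinearMap.smul_apply, smul_eq_mul]
  ring

section

variable {M : Type*} [TopologicalSpace M] [ChartedSpace Plane M]

/-- The differential of the inverse of a chart. -/
noncomputable def symmDeriv (e : OpenPartialHomeomorph M Plane) (x : Plane) : Plane →L[ℝ] Plane :=
  mfderiv 𝓘(ℝ, Plane) 𝓘(ℝ, Plane) e.symm x

lemma exists_bilin (g : FormField M) (e : OpenPartialHomeomorph M Plane) (x : Plane) :
    ∃ B : Plane →ₗ[ℝ] Plane →ₗ[ℝ] ℝ, ∀ v w, inChart g e x v w = B v w :=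
  let B : Plane →ₗ[ℝ] Plane →ₗ[ℝ] ℝ := g (e.symm x)
  ⟨B.compl₁₂ (symmDeriv e x).toLinearMap (symmDeriv e x).toLinearMap, fun _ _ => rfl⟩

lemma IsKossowskiMetric.inChart_eq {g : FormField M} (hg : IsKossowskiMetric g)
    (e : OpenPartialHomeomorph M Plane) (x v w : Plane) :
    inChart g e x v w = v 0 * w 0 * coeffE (inChart g e) x +
      (v 0 * w 1 + v 1 * w 0) * coeffF (inChart g e) x + v 1 * w 1 * coeffG (inChart g e) x := by
  obtain ⟨B, hB⟩ := exists_bilin g e x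
  have hs : inChart g e x (coordVec 1) (coordVec 0) = inChart g e x (coordVec 0) (coordVec 1) :=
    hg.symm _ _ _
  rw [coeffE, coeffF, coeffG]
  rw [hB, hB] at hs
  simp only [hB]
  rw [bilin_eq, hs]
  ring

variable {e : OpenPartialHomeomorph M Plane} {p : M}

lemma IsChartAt.mem_target (he : IsChartAt e p) : e p ∈ e.target := e.map_source he.2

lemma IsChartAt.eventually_target (he : IsChartAt e p) : ∀ᶠ x in 𝓝 (e p), x ∈ e.target :=
  e.open_target.mem_nhds he.mem_target

lemma IsChartAt.eventually_iff (he : IsChartAt e p) {P : M → Prop} :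
    (∀ᶠ y in 𝓝 p, P y) ↔ ∀ᶠ x in 𝓝 (e p), P (e.symm x) :=
  (e.eventually_nhds' P he.2).symm

lemma IsChartAt.symm_apply (he : IsChartAt e p) : e.symm (e p) = p := e.left_inv he.2

lemma IsChartAt.of_mem_target (he : IsChartAt e p) {x : Plane} (hx : x ∈ e.target) :
    IsChartAt e (e.symm x) := ⟨he.1, e.map_target hx⟩

lemma IsChartAt.contMDiffAt_symm (he : IsChartAt e p) {x : Plane} (hx : x ∈ e.target) :
    ContMDiffAt 𝓘(ℝ, Plane) 𝓘(ℝ, Plane) ω e.symm x :=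
  contMDiffAt_symm_of_mem_maximalAtlas he.1 hx

lemma IsChartAt.contMDiffAt (he : IsChartAt e p) : ContMDiffAt 𝓘(ℝ, Plane) 𝓘(ℝ, Plane) ω e p :=
  contMDiffAt_of_mem_maximalAtlas he.1 he.2

lemma IsChartAt.analyticAt (he : IsChartAt e p) {F : M → Space}
    (hF : ContMDiffAt 𝓘(ℝ, Plane) 𝓘(ℝ, Space) ω F p) : AnalyticAt ℝ (F ∘ e.symm) (e p) := by
  have h1 : ContMDiffAt 𝓘(ℝ, Plane) 𝓘(ℝ, Space) ω F (e.symm (e p)) := by rwa [he.symm_apply]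
  exact (contMDiffAt_iff_contDiffAt.1
    (h1.comp (e p) (he.contMDiffAt_symm he.mem_target))).analyticAt

lemma IsChartAt.contMDiffAt_comp (he : IsChartAt e p) {F : Plane → Space}
    (hF : AnalyticAt ℝ F (e p)) : ContMDiffAt 𝓘(ℝ, Plane) 𝓘(ℝ, Space) ω (F ∘ e) p :=
  ContMDiffAt.comp p (contMDiffAt_iff_contDiffAt.2 hF.contDiffAt) he.contMDiffAt

lemma IsChartAt.fderiv_eq (he : IsChartAt e p) {F : M → Space} {x : Plane} (hx : x ∈ e.target)
    (hF : ContMDiffAt 𝓘(ℝ, Plane) 𝓘(ℝ, Space) ω F (e.symm x)) (v : Plane) :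
    fderiv ℝ (F ∘ e.symm) x v = dmap F (e.symm x) (symmDeriv e x v) := by
  rw [← mfderiv_eq_fderiv, mfderiv_comp x (hF.mdifferentiableAt (by simp))
    ((he.contMDiffAt_symm hx).mdifferentiableAt (by simp))]
  rfl

lemma IsChartAt.injective_symmDeriv (he : IsChartAt e p) {x : Plane} (hx : x ∈ e.target) :
    Function.Injective (symmDeriv e x) := by
  have h1 : MDifferentiableAt 𝓘(ℝ, Plane) 𝓘(ℝ, Plane) e (e.symm x) :=
    (he.of_mem_target hx).contMDiffAt.mdifferentiableAt (by simp)
  have h2 : MDifferentiableAt 𝓘(ℝ, Plane) 𝓘(ℝ, Plane) e.symm x :=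
    (he.contMDiffAt_symm hx).mdifferentiableAt (by simp)
  have h3 := mfderiv_comp x h1 h2
  have h4 : (e ∘ e.symm) =ᶠ[𝓝 x] id := by
    filter_upwards [e.open_target.mem_nhds hx] with y hy using e.right_inv hy
  rw [h4.mfderiv_eq, mfderiv_id] at h3
  intro v w hvw
  let D : Plane →L[ℝ] Plane := mfderiv 𝓘(ℝ, Plane) 𝓘(ℝ, Plane) e (e.symm x)
  have h5 : ∀ v : Plane, v = D (symmDeriv e x v) :=
    fun v => congrArg (fun T : Plane →L[ℝ] Plane => T v) h3
  rw [h5 v, hvw, ← h5 w]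

lemma IsChartAt.surjective_symmDeriv (he : IsChartAt e p) {x : Plane} (hx : x ∈ e.target) :
    Function.Surjective (symmDeriv e x) :=
  (LinearMap.injective_iff_surjective (f := (symmDeriv e x).toLinearMap)).1
    (he.injective_symmDeriv hx)

lemma IsChartAt.eventually_contMDiffAt (he : IsChartAt e p) {F : M → Space}
    [IsManifold 𝓘(ℝ, Plane) ω M] (hF : ContMDiffAt 𝓘(ℝ, Plane) 𝓘(ℝ, Space) ω F p) :
    ∀ᶠ x in 𝓝 (e p), ContMDiffAt 𝓘(ℝ, Plane) 𝓘(ℝ, Space) ω F (e.symm x) :=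
  he.eventually_iff.1 ((contMDiffAt_iff_contMDiffAt_nhds (by simp)).1 hF)

variable [IsManifold 𝓘(ℝ, Plane) ω M]

lemma IsChartAt.isUnitNormalAt_iff (he : IsChartAt e p) {f ν : M → Space}
    (hf : ContMDiffAt 𝓘(ℝ, Plane) 𝓘(ℝ, Space) ω f p) : IsUnitNormalAt f ν p ↔
      ContMDiffAt 𝓘(ℝ, Plane) 𝓘(ℝ, Space) ω ν p ∧ ∀ᶠ x in 𝓝 (e p), ‖(ν ∘ e.symm) x‖ = 1 ∧
        ∀ v, inner ℝ (fderiv ℝ (f ∘ e.symm) x v) ((ν ∘ e.symm) x) = 0 := by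
  rw [IsUnitNormalAt, he.eventually_iff]
  refine and_congr_right fun _ => eventually_congr ?_
  filter_upwards [he.eventually_target, he.eventually_contMDiffAt hf] with x hx hfx
  refine and_congr_right fun _ => ⟨fun h v => ?_, fun h v => ?_⟩
  · rw [he.fderiv_eq hx hfx]
    exact h _
  · obtain ⟨v', rfl⟩ := he.surjective_symmDeriv hx v
    have := h v'
    rwa [he.fderiv_eq hx hfx] at this

lemma IsChartAt.isFirstFundamentalFormAt_iff (he : IsChartAt e p) {f : M → Space} {g : FormField M}
    (hf : ContMDiffAt 𝓘(ℝ, Plane) 𝓘(ℝ, Space) ω f p) : IsFirstFundamentalFormAt f g p ↔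
      ∀ᶠ x in 𝓝 (e p), ∀ v w, inner ℝ (fderiv ℝ (f ∘ e.symm) x v) (fderiv ℝ (f ∘ e.symm) x w) =
        inChart g e x v w := by
  rw [IsFirstFundamentalFormAt, he.eventually_iff]
  refine eventually_congr ?_
  filter_upwards [he.eventually_target, he.eventually_contMDiffAt hf] with x hx hfx
  refine ⟨fun h v w => ?_, fun h v w => ?_⟩
  · rw [he.fderiv_eq hx hfx, he.fderiv_eq hx hfx]
    exact h _ _
  · obtain ⟨v', rfl⟩ := he.surjective_symmDeriv hx v
    obtain ⟨w', rfl⟩ := he.surjective_symmDeriv hx w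
    have := h v' w'
    rwa [he.fderiv_eq hx hfx, he.fderiv_eq hx hfx] at this

/-- Composing a chart with an analytic change of coordinates. -/
lemma IsChartAt.trans (he : IsChartAt e p) {e₁ : OpenPartialHomeomorph Plane Plane}
    (h : e p ∈ e₁.source) (h1 : ContDiffOn ℝ ω e₁ e₁.source)
    (h2 : ContDiffOn ℝ ω e₁.symm e₁.target) : IsChartAt (e.trans e₁) p := by
  refine ⟨(IsManifold.mem_maximalAtlas_iff_contMDiffOn _).2 ⟨?_, ?_⟩, ?_⟩
  · refine (contMDiffOn_iff_contDiffOn.2 h1).comp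
      ((contMDiffOn_of_mem_maximalAtlas he.1).mono ?_) ?_
    · exact fun x hx => by simp at hx; exact hx.1
    · exact fun x hx => by simp at hx; exact hx.2
  · refine (contMDiffOn_symm_of_mem_maximalAtlas he.1).comp
      ((contMDiffOn_iff_contDiffOn.2 h2).mono ?_) ?_
    · exact fun x hx => by simp at hx; exact hx.1
    · exact fun x hx => by simp at hx; exact hx.2
  · simp [he.2, h]

/-- A chart in which a given curve is the first axis. -/
lemma exists_chart_along {γ : ℝ → M} (hγ : ContMDiffAt 𝓘(ℝ, ℝ) 𝓘(ℝ, Plane) ω γ 0)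
    (hγ' : mfderiv 𝓘(ℝ, ℝ) 𝓘(ℝ, Plane) γ 0 (1 : ℝ) ≠ 0) :
    ∃ e : OpenPartialHomeomorph M Plane, IsChartAt e (γ 0) ∧ e (γ 0) = 0 ∧
      ∀ᶠ t in 𝓝 0, γ t = e.symm (axisPt t) := by
  let e₀ := chartAt Plane (γ 0)
  have he₀ : IsChartAt e₀ (γ 0) := ⟨IsManifold.chart_mem_maximalAtlas _, mem_chart_source _ _⟩
  let c : ℝ → Plane := fun t => e₀ (γ t)
  have hc : AnalyticAt ℝ c 0 :=
    (contMDiffAt_iff_contDiffAt.1 (he₀.contMDiffAt.comp 0 hγ)).analyticAt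
  have hsrc : ∀ᶠ t in 𝓝 (0 : ℝ), γ t ∈ e₀.source :=
    hγ.continuousAt.eventually (e₀.open_source.mem_nhds he₀.2)
  have hc' : deriv c 0 ≠ 0 := by
    intro h0
    have hγe : γ =ᶠ[𝓝 0] e₀.symm ∘ c := by
      filter_upwards [hsrc] with t ht using (e₀.left_inv ht).symm
    have h1 := mfderiv_comp (I := 𝓘(ℝ, ℝ)) (I' := 𝓘(ℝ, Plane)) (I'' := 𝓘(ℝ, Plane)) (0 : ℝ)
      ((he₀.contMDiffAt_symm he₀.mem_target).mdifferentiableAt (by simp) :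
        MDifferentiableAt 𝓘(ℝ, Plane) 𝓘(ℝ, Plane) e₀.symm (c 0))
      hc.differentiableAt.mdifferentiableAt
    rw [← hγe.mfderiv_eq] at h1
    apply hγ'
    have h2 : mfderiv 𝓘(ℝ, ℝ) 𝓘(ℝ, Plane) c 0 (1 : ℝ) = deriv c 0 := by
      rw [mfderiv_eq_fderiv]
      rfl
    have h3 := congrArg (fun T : ℝ →L[ℝ] Plane => T 1) h1
    refine h3.trans ?_
    change symmDeriv e₀ (c 0) (mfderiv 𝓘(ℝ, ℝ) 𝓘(ℝ, Plane) c 0 (1 : ℝ)) = 0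
    rw [h2, h0, map_zero]
  set d := deriv c 0 with hd
  -- The velocity turned by a right angle. The map `(u, v) ↦ c u + v n` is then a local
  -- diffeomorphism, and its inverse straightens the curve while keeping its parameter.
  let n : Plane := !₂[-d 1, d 0]
  let Ψ : Plane → Plane := fun x => c (x 0) + x 1 • n
  have hΨ : AnalyticAt ℝ Ψ 0 := by
    refine AnalyticAt.add (AnalyticAt.comp (g := c) (f := fun x : Plane => x 0) hc
      ((EuclideanSpace.proj 0 : Plane →L[ℝ] ℝ).analyticAt 0))
      (((EuclideanSpace.proj 1 : Plane →L[ℝ] ℝ).analyticAt 0).smul analyticAt_const)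
  have hΨ' : HasFDerivAt Ψ (((ContinuousLinearMap.toSpanSingleton ℝ d).comp
      (EuclideanSpace.proj 0 : Plane →L[ℝ] ℝ)) +
      (EuclideanSpace.proj 1 : Plane →L[ℝ] ℝ).smulRight n) 0 := by
    refine HasFDerivAt.add (HasFDerivAt.comp (g := c) (f := fun x : Plane => x 0) (0 : Plane) ?_
      (EuclideanSpace.proj 0 : Plane →L[ℝ] ℝ).hasFDerivAt)
      ((EuclideanSpace.proj 1 : Plane →L[ℝ] ℝ).hasFDerivAt.smul_const n)
    exact hc.differentiableAt.hasDerivAt.hasFDerivAt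
  have hinj : Function.Injective (fderiv ℝ Ψ 0) := by
    rw [hΨ'.fderiv, injective_iff_map_eq_zero]
    intro v hv
    have hv0 : v 0 * d 0 + v 1 * (-d 1) = 0 := by
      simpa [n] using congrArg (fun w : Plane => w 0) hv
    have hv1 : v 0 * d 1 + v 1 * d 0 = 0 := by
      simpa [n] using congrArg (fun w : Plane => w 1) hv
    have hdd : d 0 ^ 2 + d 1 ^ 2 ≠ 0 := by
      intro h
      apply hc'
      have h0 : d 0 = 0 := by nlinarith [sq_nonneg (d 0), sq_nonneg (d 1)]
      have h1 : d 1 = 0 := by nlinarith [sq_nonneg (d 0), sq_nonneg (d 1)]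
      ext i
      fin_cases i
      · exact h0
      · exact h1
    have k0 : v 0 * (d 0 ^ 2 + d 1 ^ 2) = 0 := by linear_combination d 0 * hv0 + d 1 * hv1
    have k1 : v 1 * (d 0 ^ 2 + d 1 ^ 2) = 0 := by linear_combination d 0 * hv1 - d 1 * hv0
    ext i
    fin_cases i
    · exact (mul_eq_zero.1 k0).resolve_right hdd
    · exact (mul_eq_zero.1 k1).resolve_right hdd
  obtain ⟨e₁, h0, h1, h2, h3⟩ := exists_local_inverse hΨ hinj
  have hax : ∀ t, e₁ (axisPt t) = e₀ (γ t) := by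
    intro t
    rw [h1]
    simp [Ψ, axisPt, c]
  have hax0 : e₀ (γ 0) = e₁ 0 := by rw [← hax, axisPt_zero]
  have he : IsChartAt (e₀.trans e₁.symm) (γ 0) :=
    he₀.trans (by rw [hax0]; exact e₁.map_source h0) h3 (by simpa using h2)
  refine ⟨e₀.trans e₁.symm, he, ?_, ?_⟩
  · simp only [OpenPartialHomeomorph.coe_trans, Function.comp_apply, hax0]
    exact e₁.left_inv h0
  · filter_upwards [hsrc] with t ht
    simp only [OpenPartialHomeomorph.coe_trans_symm, OpenPartialHomeomorph.symm_symm,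
      Function.comp_apply, hax]
    exact (e₀.left_inv ht).symm

end

end KossowskiMetrics

namespace KossowskiMetrics

open Finset Filter

/-! ### Kossowski metrics in local coordinates -/

lemma exists_sqrt {φ : Plane → ℝ} (h : AnalyticAt ℝ φ 0) (h0 : 0 < φ 0) :
    ∃ s : Plane → ℝ, AnalyticAt ℝ s 0 ∧ (∀ x, 0 < s x) ∧ ∀ᶠ x in 𝓝 0, φ x = s x ^ 2 := by
  have hl : AnalyticAt ℝ (fun x => Real.log (φ x) * 2⁻¹) 0 :=
    (AnalyticAt.comp (g := Real.log) (f := φ) (analyticAt_log h0) h).mul analyticAt_const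
  refine ⟨fun x => Real.exp (Real.log (φ x) * 2⁻¹), hl.rexp, fun x => Real.exp_pos _, ?_⟩
  filter_upwards [h.continuousAt.eventually_const_lt h0] with x hx
  rw [← Real.exp_nat_mul]
  push_cast
  rw [mul_comm (2 : ℝ), inv_mul_cancel_right₀ two_ne_zero, Real.exp_log hx]

lemma not_eventually_eq_zero {lam : Plane → ℝ} {x : Plane}
    (h : lam x ≠ 0 ∨ fderiv ℝ lam x ≠ 0) : ¬ ∀ᶠ y in 𝓝 x, lam y = 0 := by
  intro h0
  rcases h with h | h
  · exact h h0.self_of_nhds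
  · apply h
    have : lam =ᶠ[𝓝 x] fun _ => 0 := h0
    rw [this.fderiv_eq]
    simp

/-- An orthonormal coframe of a metric whose area density is analytic. -/
lemma exists_isCoframe {E F H lam : Plane → ℝ} (hE : AnalyticAt ℝ E 0) (hF : AnalyticAt ℝ F 0)
    (hlam : AnalyticAt ℝ lam 0) (hE0 : 0 < E 0)
    (hd : ∀ᶠ x in 𝓝 0, E x * H x - F x ^ 2 = lam x ^ 2)
    (hlam0 : lam 0 ≠ 0 ∨ lam 0 = 0 ∧ fderiv ℝ lam 0 ≠ 0)
    (hadm : ∀ᶠ x in 𝓝 0, lam x = 0 →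
      pder 0 F x - F x * (E x)⁻¹ * pder 0 E x / 2 - pder 1 E x / 2 = 0) :
    ∃ s q l a : Plane → ℝ, IsCoframe s q l a ∧
      ∀ᶠ x in 𝓝 0, E x = s x ^ 2 ∧ F x = s x * q x ∧ H x = q x ^ 2 + l x ^ 2 := by
  obtain ⟨s, hs, hpos, hsE⟩ := exists_sqrt hE hE0
  have hsi : AnalyticAt ℝ (fun x => (s x)⁻¹) 0 := hs.inv (hpos 0).ne'
  let q : Plane → ℝ := fun x => F x * (s x)⁻¹
  let l : Plane → ℝ := fun x => lam x * (s x)⁻¹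
  have hq : AnalyticAt ℝ q 0 := hF.mul hsi
  have hl : AnalyticAt ℝ l 0 := hlam.mul hsi
  -- The product `s φ` is the expression in `hadm`, so `φ` vanishes on the zero set of `lam`.
  let φ : Plane → ℝ := fun x => pder 0 q x - pder 1 s x
  have hφ : AnalyticAt ℝ φ 0 := (analyticAt_pder hq 0).sub (analyticAt_pder hs 1)
  have hφ0 : ∀ᶠ x in 𝓝 0, lam x = 0 → φ x = 0 := by
    filter_upwards [hadm, hs.eventually_analyticAt, hq.eventually_analyticAt, hsE.eventually_nhds]
      with x h1 h2 h3 h4 hx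
    have hs' := h2.differentiableAt
    have hsx := (hpos x).ne'
    have k1 : ∀ i, pder i E x = 2 * s x * pder i s x := by
      intro i
      have : E =ᶠ[𝓝 x] fun y => s y * s y := by
        filter_upwards [h4] with y hy
        rw [hy, sq]
      rw [pder_congr this, pder_mul i hs' hs']
      ring
    have k2 : pder 0 F x = pder 0 s x * q x + s x * pder 0 q x := by
      have : F = fun y => s y * q y := by
        funext y
        have := (hpos y).ne'
        simp only [q]
        field_simp
      conv_lhs => rw [this]
      exact pder_mul 0 hs' h3.differentiableAt
    have k3 : F x = s x * q x := by
      simp only [q]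
      field_simp
    have h5 := h1 hx
    rw [k1, k1, k2, h4.self_of_nhds, k3] at h5
    have h6 : s x * φ x = 0 := by
      simp only [φ]
      field_simp at h5
      linear_combination h5
    exact (mul_eq_zero.1 h6).resolve_left hsx
  have hlz : ¬ ∀ᶠ x in 𝓝 0, l x = 0 := by
    intro h
    refine not_eventually_eq_zero (hlam0.imp_right And.right) ?_
    filter_upwards [h] with x hx
    exact (mul_eq_zero.1 hx).resolve_right (inv_ne_zero (hpos x).ne')
  -- If `lam` is nonzero at the origin, this is an ordinary quotient; otherwise the nonvanishing
  -- gradient permits analytic division by `lam`.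
  obtain ⟨a, ha, haφ⟩ : ∃ a : Plane → ℝ, AnalyticAt ℝ a 0 ∧ ∀ᶠ x in 𝓝 0, a x * l x = φ x := by
    rcases hlam0 with h0 | ⟨h0, h1⟩
    · have hl0 : l 0 ≠ 0 := mul_ne_zero h0 (inv_ne_zero (hpos 0).ne')
      refine ⟨fun x => φ x * (l x)⁻¹, hφ.mul (hl.inv hl0), ?_⟩
      filter_upwards [hl.continuousAt.eventually_ne hl0] with x hx
      field_simp
    · obtain ⟨ψ, hψ, he⟩ := exists_div hφ hlam h0 h1 hφ0
      refine ⟨fun x => s x * ψ x, hs.mul hψ, ?_⟩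
      filter_upwards [he] with x hx
      have := (hpos x).ne'
      rw [hx]
      simp only [l]
      field_simp
  refine ⟨s, q, l, a, ⟨hs, hq, hl, ha, hpos 0, hlz, haφ⟩, ?_⟩
  filter_upwards [hsE, hd] with x h1 h2
  have := (hpos x).ne'
  refine ⟨h1, ?_, ?_⟩
  · simp only [q]
    field_simp
  · simp only [q, l]
    rw [h1] at h2
    field_simp
    linarith

section

variable {M : Type*} [TopologicalSpace M] [ChartedSpace Plane M]
  {e e' : OpenPartialHomeomorph M Plane} {p : M} {g : FormField M}

lemma IsRegularPoint.discr_pos (hg : IsKossowskiMetric g) (he : IsChartAt e p) {x : Plane}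
    (hx : x ∈ e.target) (h : IsRegularPoint g (e.symm x)) : 0 < discr (inChart g e) x := by
  have hpos : ∀ v : Plane, v ≠ 0 → 0 < inChart g e x v v := fun v hv =>
    h _ fun h0 => hv (he.injective_symmDeriv hx (by rw [map_zero]; exact h0))
  have hE : 0 < coeffE (inChart g e) x := hpos _ (by simp [coordVec])
  have h1 := hpos (!₂[-coeffF (inChart g e) x, coeffE (inChart g e) x]) (by
    intro h0
    exact hE.ne' (congrArg (fun v : Plane => v 1) h0))
  rw [hg.inChart_eq] at h1
  simp only [Matrix.cons_val_zero, Matrix.cons_val_one] at h1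
  have h2 : 0 < coeffE (inChart g e) x * discr (inChart g e) x := by
    rw [discr]
    linarith
  exact (mul_pos_iff_of_pos_left hE).1 h2

lemma isRegularPoint_of_discr_pos (hg : IsKossowskiMetric g) (he : IsChartAt e p) {x : Plane}
    (hx : x ∈ e.target) (h : 0 < discr (inChart g e) x) : IsRegularPoint g (e.symm x) := by
  intro v hv
  refine lt_of_le_of_ne (hg.nonneg _ v) fun h0 => hv ?_
  obtain ⟨v', rfl⟩ := he.surjective_symmDeriv hx v
  have h1 : inChart g e x v' v' = 0 := h0.symm
  rw [hg.inChart_eq] at h1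
  rw [discr] at h
  set E := coeffE (inChart g e) x
  set F := coeffF (inChart g e) x
  set H := coeffG (inChart g e) x
  have h2 : (E * v' 0 + F * v' 1) ^ 2 + (E * H - F ^ 2) * v' 1 ^ 2 = 0 := by
    linear_combination E * h1
  have h3 : v' 1 = 0 := by
    have : (E * H - F ^ 2) * v' 1 ^ 2 = 0 := by nlinarith [sq_nonneg (E * v' 0 + F * v' 1), sq_nonneg (v' 1)]
    simpa [h.ne'] using this
  have hE : E ≠ 0 := by
    intro h0
    rw [h0] at h
    nlinarith [sq_nonneg F]
  have h4 : v' 0 = 0 := by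
    rw [h3] at h2
    simpa [hE] using h2
  have h5 : v' = 0 := by
    ext i
    fin_cases i
    · exact h4
    · exact h3
  rw [h5]
  exact map_zero _

lemma IsChartAt.analyticAt_coeff (hg : IsKossowskiMetric g) (he : IsChartAt e p) {x : Plane}
    (hx : x ∈ e.target) (v w : Plane) : AnalyticAt ℝ (fun x => inChart g e x v w) x :=
  hg.analytic e he.1 v w x hx

lemma IsChartAt.analyticAt_discr (hg : IsKossowskiMetric g) (he : IsChartAt e p) {x : Plane}
    (hx : x ∈ e.target) : AnalyticAt ℝ (discr (inChart g e)) x :=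
  ((he.analyticAt_coeff hg hx _ _).mul (he.analyticAt_coeff hg hx _ _)).sub
    ((he.analyticAt_coeff hg hx _ _).pow 2)

/-- The equation expressing admissibility in coordinates with `E ≠ 0`. -/
lemma IsAdmissibleAt.coeff_eq (hg : IsKossowskiMetric g) (he : IsChartAt e p) {x : Plane}
    (hx : x ∈ e.target) (h : IsAdmissibleAt (inChart g e) x) (hE : coeffE (inChart g e) x ≠ 0)
    (hd : discr (inChart g e) x = 0) :
    pder 0 (coeffF (inChart g e)) x - coeffF (inChart g e) x * (coeffE (inChart g e) x)⁻¹ *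
      pder 0 (coeffE (inChart g e)) x / 2 - pder 1 (coeffE (inChart g e)) x / 2 = 0 := by
  set c := coeffF (inChart g e) x * (coeffE (inChart g e) x)⁻¹ with hc
  -- Where the discriminant vanishes, `∂_v - (F / E) ∂_u` lies in the radical. Admissibility is
  -- tested on `Θ(∂_u, ∂_u, Z)` with constant fields, so that all brackets vanish.
  let Z : Plane := coordVec 1 - c • coordVec 0
  have hZ0 : Z 0 = -c := by simp [Z, coordVec]
  have hZ1 : Z 1 = 1 := by simp [Z, coordVec]
  have hcE : c * coeffE (inChart g e) x = coeffF (inChart g e) x := by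
    rw [hc]
    field_simp
  have hrad : ∀ v, inChart g e x Z v = 0 := by
    intro v
    rw [hg.inChart_eq, hZ0, hZ1]
    rw [discr] at hd
    have h1 : coeffG (inChart g e) x = c * coeffF (inChart g e) x := by
      refine mul_left_cancel₀ hE ?_
      linear_combination hd - coeffF (inChart g e) x * hcE
    rw [h1, ← hcE]
    ring
  have h1 := h (fun _ => coordVec 0) (fun _ => coordVec 0) (fun _ => Z) analyticAt_const
    analyticAt_const analyticAt_const hrad
  have hEd : DifferentiableAt ℝ (coeffE (inChart g e)) x :=
    (he.analyticAt_coeff hg hx _ _).differentiableAt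
  have hFd : DifferentiableAt ℝ (coeffF (inChart g e)) x :=
    (he.analyticAt_coeff hg hx _ _).differentiableAt
  have e1 : (fun y => inChart g e y (coordVec 0) Z) =
      fun y => coeffF (inChart g e) y - c * coeffE (inChart g e) y := by
    funext y
    rw [hg.inChart_eq, hZ0, hZ1]
    simp [coordVec]
    ring
  have e2 : (fun y => inChart g e y (coordVec 0) (coordVec 0)) = coeffE (inChart g e) := rfl
  have hbr : ∀ v w : Plane, VectorField.lieBracket ℝ (fun _ : Plane => v) (fun _ => w) x = 0 := by
    intro v w
    simp [VectorField.lieBracket]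
  have h0 : ∀ v, inChart g e x 0 v = 0 := by
    intro v
    rw [hg.inChart_eq]
    simp
  have e3 : fderiv ℝ (fun y => coeffF (inChart g e) y - c * coeffE (inChart g e) y) x (coordVec 0) =
      pder 0 (coeffF (inChart g e)) x - c * pder 0 (coeffE (inChart g e)) x := by
    have := pder_sub 0 hFd (hEd.const_mul c)
    rw [pder] at this
    rw [this, pder_mul 0 (differentiableAt_const c) hEd, pder_const]
    ring
  have e4 : fderiv ℝ (coeffE (inChart g e)) x Z =
      pder 1 (coeffE (inChart g e)) x - c * pder 0 (coeffE (inChart g e)) x := by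
    simp [Z, pder]
  simp only [pseudoConnection, hbr, h0, e1, e2, e3, e4] at h1
  linear_combination h1

/-! ### Change of chart. -/

/-- The transition map between two charts pulls the coordinate expressions of the metric back. -/
lemma IsChartAt.inChart_change (he : IsChartAt e p) (he' : IsChartAt e' p) :
    ∀ᶠ x in 𝓝 (e p), AnalyticAt ℝ (e' ∘ e.symm) x ∧
      Function.Injective (fderiv ℝ (e' ∘ e.symm) x) ∧
      ∀ v w, inChart g e x v w = inChart g e' (e' (e.symm x)) (fderiv ℝ (e' ∘ e.symm) x v)
        (fderiv ℝ (e' ∘ e.symm) x w) := by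
  filter_upwards [he.eventually_target, he.eventually_iff.1 (e'.open_source.mem_nhds he'.2)]
    with x hx hx'
  have hc : IsChartAt e' (e.symm x) := ⟨he'.1, hx'⟩
  have hT : AnalyticAt ℝ (e' ∘ e.symm) x :=
    (contMDiffAt_iff_contDiffAt.1 (hc.contMDiffAt.comp x (he.contMDiffAt_symm hx))).analyticAt
  have hfac : ∀ v, symmDeriv e x v = symmDeriv e' (e' (e.symm x)) (fderiv ℝ (e' ∘ e.symm) x v) := by
    have h1 : e.symm =ᶠ[𝓝 x] e'.symm ∘ (e' ∘ e.symm) := by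
      filter_upwards [(he.contMDiffAt_symm hx).continuousAt.eventually
        (e'.open_source.mem_nhds hx')] with y hy using (e'.left_inv hy).symm
    have h2 := mfderiv_comp (I := 𝓘(ℝ, Plane)) (I' := 𝓘(ℝ, Plane)) (I'' := 𝓘(ℝ, Plane)) x
      ((hc.contMDiffAt_symm hc.mem_target).mdifferentiableAt (by simp) :
        MDifferentiableAt 𝓘(ℝ, Plane) 𝓘(ℝ, Plane) e'.symm ((e' ∘ e.symm) x))
      hT.differentiableAt.mdifferentiableAt
    rw [← h1.mfderiv_eq, mfderiv_eq_fderiv] at h2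
    exact fun v => congrArg (fun T : Plane →L[ℝ] Plane => T v) h2
  refine ⟨hT, ?_, fun v w => ?_⟩
  · intro v w hvw
    apply he.injective_symmDeriv hx
    rw [hfac, hfac, hvw]
  · have hpt : ∀ {y y' : M}, y = y' → ∀ v w : Plane, g y v w = g y' v w := by
      rintro y _ rfl v w
      rfl
    change g (e.symm x) (symmDeriv e x v) (symmDeriv e x w) = _
    rw [hfac, hfac]
    exact hpt (e'.left_inv hx').symm _ _

lemma jacobian_ne_zero {D : Plane →L[ℝ] Plane} (hD : Function.Injective D) :
    D (coordVec 0) 0 * D (coordVec 1) 1 - D (coordVec 0) 1 * D (coordVec 1) 0 ≠ 0 := by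
  intro h
  set u := D (coordVec 0)
  set v := D (coordVec 1)
  have key : ∀ a b : ℝ, a • u = b • v → a = 0 ∧ b = 0 := by
    intro a b hab
    have h1 : a • coordVec 0 = b • coordVec 1 := hD (by rw [map_smul, map_smul]; exact hab)
    exact ⟨by simpa [coordVec] using congrArg (fun w : Plane => w 0) h1,
      by simpa [coordVec] using (congrArg (fun w : Plane => w 1) h1).symm⟩
  have h1 := key (v 1) (u 1) (by
    ext i
    fin_cases i
    · simp
      linarith
    · simp
      ring)
  have h0 := key (v 0) (u 0) (by
    ext i
    fin_cases i
    · simp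
      ring
    · simp
      linarith)
  have := key 1 0 (by
    ext i
    fin_cases i
    · simp [h0]
    · simp [h1])
  exact one_ne_zero this.1

/-- In every chart around a semi-definite point, the discriminant is the square of a function with
nonvanishing gradient. -/
lemma IsChartAt.exists_density (hg : IsKossowskiMetric g) (he : IsChartAt e p)
    (hp : IsSemiDefinitePoint g p) : ∃ lam : Plane → ℝ, AnalyticAt ℝ lam (e p) ∧
      (∀ᶠ x in 𝓝 (e p), discr (inChart g e) x = lam x ^ 2) ∧ lam (e p) = 0 ∧
      fderiv ℝ lam (e p) ≠ 0 := by
  obtain ⟨e', he', lam, hlam, hd, hne⟩ := hg.density p hp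
  have hch := he.inChart_change (g := g) he'
  set T : Plane → Plane := e' ∘ e.symm with hT
  have hTp : T (e p) = e' p := by simp [hT, he.symm_apply]
  have hTan : AnalyticAt ℝ T (e p) := hch.self_of_nhds.1
  -- The discriminant is multiplied by the square of the Jacobian, so `J · (lam ∘ T)` is a square
  -- root in the new chart. Since `lam` vanishes at the point, the gradient of the product is `J`
  -- times that of `lam ∘ T`.
  let J : Plane → ℝ := fun x => pder 0 T x 0 * pder 1 T x 1 - pder 0 T x 1 * pder 1 T x 0
  have hco : ∀ i j, AnalyticAt ℝ (fun x => pder i T x j) (e p) := fun i j =>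
    ((EuclideanSpace.proj j : Plane →L[ℝ] ℝ).analyticAt _).comp (analyticAt_pder hTan i)
  have hJ : AnalyticAt ℝ J (e p) := ((hco 0 0).mul (hco 1 1)).sub ((hco 0 1).mul (hco 1 0))
  have hlam' : AnalyticAt ℝ lam (T (e p)) := by
    rw [hTp]
    exact hlam _ he'.mem_target
  have hlz : lam (e' p) = 0 := by
    by_contra h0
    apply hp
    have h1 := isRegularPoint_of_discr_pos hg he' he'.mem_target (by
      rw [hd _ he'.mem_target]
      positivity)
    rwa [he'.symm_apply] at h1
  have hlT : AnalyticAt ℝ (fun x => lam (T x)) (e p) := hlam'.comp hTan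
  refine ⟨fun x => J x * lam (T x), hJ.mul hlT, ?_, ?_, ?_⟩
  · have htar : ∀ᶠ x in 𝓝 (e p), T x ∈ e'.target :=
      hTan.continuousAt.eventually (by rw [hTp]; exact he'.eventually_target)
    filter_upwards [hch, htar] with x ⟨_, _, h1⟩ h2
    have h3 := hd _ h2
    rw [mul_pow, ← h3, discr, discr, coeffE, coeffF, coeffG, h1, h1, h1]
    simp only [hg.inChart_eq e']
    simp only [J, pder]
    change _ = _ * (coeffE (inChart g e') (e' (e.symm x)) * coeffG (inChart g e') (e' (e.symm x)) -
      coeffF (inChart g e') (e' (e.symm x)) ^ 2)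
    ring
  · simp [hTp, hlz]
  · intro h0
    apply hne
    have hD := hch.self_of_nhds.2.1
    have hsurj : Function.Surjective (fderiv ℝ T (e p)) :=
      (LinearMap.injective_iff_surjective (f := (fderiv ℝ T (e p)).toLinearMap)).1 hD
    have h1 : HasFDerivAt (fun x => lam (T x)) ((fderiv ℝ lam (e' p)).comp (fderiv ℝ T (e p))) (e p) := by
      rw [← hTp]
      exact hlam'.differentiableAt.hasFDerivAt.comp (e p) hTan.differentiableAt.hasFDerivAt
    have h2 := (hJ.differentiableAt.hasFDerivAt.mul h1).fderiv
    ext v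
    obtain ⟨u, rfl⟩ := hsurj v
    have h3 := congrArg (fun D : Plane →L[ℝ] ℝ => D u) (h2.symm.trans h0)
    simp only [hTp, hlz] at h3
    simpa [jacobian_ne_zero hD, J, pder] using h3

/-- A coframe of a Kossowski metric in a chart centred at `p` with `E ≠ 0`. -/
lemma IsChartAt.exists_isCoframe (hg : IsKossowskiMetric g) (he : IsChartAt e p) (he0 : e p = 0)
    (hE : 0 < coeffE (inChart g e) 0) : ∃ s q l a : Plane → ℝ, IsCoframe s q l a ∧
      ∀ᶠ x in 𝓝 0, coeffE (inChart g e) x = s x ^ 2 ∧ coeffF (inChart g e) x = s x * q x ∧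
        coeffG (inChart g e) x = q x ^ 2 + l x ^ 2 := by
  have h0t : (0 : Plane) ∈ e.target := he0 ▸ he.mem_target
  have hs0 : e.symm 0 = p := he0 ▸ he.symm_apply
  have hEan : AnalyticAt ℝ (coeffE (inChart g e)) 0 := he.analyticAt_coeff hg h0t _ _
  obtain ⟨lam, hlam, hd, hlam0⟩ : ∃ lam : Plane → ℝ, AnalyticAt ℝ lam 0 ∧
      (∀ᶠ x in 𝓝 0, discr (inChart g e) x = lam x ^ 2) ∧
      (lam 0 ≠ 0 ∨ lam 0 = 0 ∧ fderiv ℝ lam 0 ≠ 0) := by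
    by_cases hp : IsRegularPoint g p
    · obtain ⟨lam, h1, h2, h3⟩ := exists_sqrt (he.analyticAt_discr hg h0t)
        (IsRegularPoint.discr_pos hg he h0t (by rwa [hs0]))
      exact ⟨lam, h1, h3, Or.inl (h2 0).ne'⟩
    · obtain ⟨lam, h1, h2, h3⟩ := he.exists_density hg hp
      rw [he0] at h1 h2 h3
      exact ⟨lam, h1, h2, Or.inr h3⟩
  refine KossowskiMetrics.exists_isCoframe hEan (he.analyticAt_coeff hg h0t _ _) hlam hE hd hlam0 ?_
  filter_upwards [hd, e.open_target.mem_nhds h0t, hEan.continuousAt.eventually_const_lt hE]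
    with x h1 hx h3 h4
  rw [h4] at h1
  have h1' : discr (inChart g e) x = 0 := by rw [h1]; norm_num
  refine IsAdmissibleAt.coeff_eq hg he hx ?_ h3.ne' h1'
  -- Admissibility is needed at all semi-definite points near `p`, not only at `p`, because the
  -- division requires vanishing on the whole zero set of `lam`.
  have hsd : IsSemiDefinitePoint g (e.symm x) := fun hr =>
    (IsRegularPoint.discr_pos hg he hx hr).ne' h1'
  have := hg.admissible _ hsd e (he.of_mem_target hx)
  rwa [e.right_inv hx] at this

end

end KossowskiMetrics

namespace KossowskiMetrics

open Finset Filter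

/-! ### Realizations in local coordinates -/

lemma IsPlanarRealization.congr {s q l : Plane → ℝ} {w μ : ℝ → ℝ} {f ν f' ν' : Plane → Space}
    (h : IsPlanarRealization s q l w μ f ν) (hf : f' =ᶠ[𝓝 0] f) (hν : ν' =ᶠ[𝓝 0] ν) :
    IsPlanarRealization s q l w μ f' ν' := by
  have hp : ∀ᶠ x in 𝓝 0, ∀ i, pder i f' x = pder i f x := by
    filter_upwards [eventually_eventually_nhds.2 hf] with x hx i using pder_congr hx i
  have hc : ∀ᶠ t in 𝓝 (0 : ℝ), ∀ n, iteratedDeriv n (fun t => f' (axisPt t)) t =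
      iteratedDeriv n (fun t => f (axisPt t)) t := by
    filter_upwards [(tendsto_axisPt.eventually hf).eventually_nhds] with t ht n
    exact EventuallyEq.iteratedDeriv_eq n ht
  refine ⟨h.analyticAt_map.congr hf.symm, h.analyticAt_normal.congr hν.symm, ?_, ?_, ?_, ?_, ?_, ?_, ?_⟩
  · filter_upwards [h.norm_normal, hν] with x h1 h2
    rwa [h2]
  · filter_upwards [h.inner_normal, hp, hν] with x h1 h2 h3 i
    rw [h2, h3, h1]
  · filter_upwards [h.inner_zero_zero, hp] with x h1 h2
    rw [h2, h1]
  · filter_upwards [h.inner_zero_one, hp] with x h1 h2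
    rw [h2, h2, h1]
  · filter_upwards [h.inner_one_one, hp] with x h1 h2
    rw [h2, h1]
  · filter_upwards [h.normal_curvature, hc, tendsto_axisPt.eventually hν] with t h1 h2 h3
    rw [h2, h2, h3, h1]
  · filter_upwards [h.torsion_eq, hc] with t h1 h2
    rw [← h1, torsion, torsion, h2, h2, h2]

/-- The derivatives of the image curve in the chart in which the curve is the first axis. -/
lemma eventually_curve_eq {M : Type*} [TopologicalSpace M] {e : OpenPartialHomeomorph M Plane}
    {γ : ℝ → M} (f : M → Space) (hγ : ∀ᶠ t in 𝓝 0, γ t = e.symm (axisPt t)) :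
    ∀ᶠ t in 𝓝 0, ∀ n, iteratedDeriv n (f ∘ γ) t =
      iteratedDeriv n (fun t => (f ∘ e.symm) (axisPt t)) t := by
  filter_upwards [hγ.eventually_nhds] with t ht n
  refine EventuallyEq.iteratedDeriv_eq n ?_
  filter_upwards [ht] with t' h
  simp [h]

section

variable {M : Type*} [TopologicalSpace M] [ChartedSpace Plane M] [IsManifold 𝓘(ℝ, Plane) ω M]
  {e : OpenPartialHomeomorph M Plane} {p : M} {g : FormField M} {s q l : Plane → ℝ} {w μ : ℝ → ℝ}
  {γ : ℝ → M}

lemma IsRealization.exists_isPlanarRealization (he : IsChartAt e p)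
    (he0 : e p = 0) (hγ : ∀ᶠ t in 𝓝 0, γ t = e.symm (axisPt t))
    (hco : ∀ᶠ x in 𝓝 0, coeffE (inChart g e) x = s x ^ 2 ∧ coeffF (inChart g e) x = s x * q x ∧
      coeffG (inChart g e) x = q x ^ 2 + l x ^ 2) {f : M → Space}
    (hf : IsRealization g p γ w μ f) :
    ∃ ν : M → Space, IsPlanarRealization s q l w μ (f ∘ e.symm) (ν ∘ e.symm) := by
  obtain ⟨ν, hν, hn⟩ := hf.normal_curvature
  have hfan := hf.frontal.1
  obtain ⟨hνan, hν⟩ := (he.isUnitNormalAt_iff hfan).1 hν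
  have hfff := (he.isFirstFundamentalFormAt_iff hfan).1 hf.isometric
  have h1 := he.analyticAt hfan
  have h2 := he.analyticAt hνan
  rw [he0] at hν hfff h1 h2
  refine ⟨ν, h1, h2, ?_, ?_, ?_, ?_, ?_, ?_, ?_⟩
  · filter_upwards [hν] with x hx using hx.1
  · filter_upwards [hν] with x hx i using hx.2 _
  · filter_upwards [hfff, hco] with x hx hc
    exact (hx _ _).trans hc.1
  · filter_upwards [hfff, hco] with x hx hc
    exact (hx _ _).trans hc.2.1
  · filter_upwards [hfff, hco] with x hx hc
    exact (hx _ _).trans hc.2.2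
  · filter_upwards [hn, eventually_curve_eq f hγ, hγ] with t h3 h4 h5
    rw [normalCurvature, h4, h4, h5] at h3
    exact h3
  · filter_upwards [hf.torsion_eq, eventually_curve_eq f hγ] with t h3 h4
    rw [torsion, h4, h4, h4] at h3
    exact h3

lemma IsPlanarRealization.isRealization (hg : IsKossowskiMetric g) (he : IsChartAt e p)
    (he0 : e p = 0) (hγ : ∀ᶠ t in 𝓝 0, γ t = e.symm (axisPt t))
    (hco : ∀ᶠ x in 𝓝 0, coeffE (inChart g e) x = s x ^ 2 ∧ coeffF (inChart g e) x = s x * q x ∧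
      coeffG (inChart g e) x = q x ^ 2 + l x ^ 2) {f ν : Plane → Space}
    (hf : IsPlanarRealization s q l w μ f ν) : IsRealization g p γ w μ (f ∘ e) := by
  have hright : ∀ F : Plane → Space, (F ∘ e) ∘ e.symm =ᶠ[𝓝 0] F := by
    intro F
    filter_upwards [e.open_target.mem_nhds (he0 ▸ he.mem_target : (0 : Plane) ∈ e.target)] with x hx
    simp [e.right_inv hx]
  replace hf := hf.congr (hright f) (hright ν)
  have hfan : ContMDiffAt 𝓘(ℝ, Plane) 𝓘(ℝ, Space) ω (f ∘ e) p :=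
    he.contMDiffAt_comp (he0 ▸ (hf.analyticAt_map.congr (hright f)))
  have hνan : ContMDiffAt 𝓘(ℝ, Plane) 𝓘(ℝ, Space) ω (ν ∘ e) p :=
    he.contMDiffAt_comp (he0 ▸ (hf.analyticAt_normal.congr (hright ν)))
  have hν : IsUnitNormalAt (f ∘ e) (ν ∘ e) p := by
    refine (he.isUnitNormalAt_iff hfan).2 ⟨hνan, ?_⟩
    rw [he0]
    filter_upwards [hf.norm_normal, hf.inner_normal] with x h1 h2
    refine ⟨h1, fun v => ?_⟩
    rw [fderiv_eq_pder, inner_add_left, real_inner_smul_left, real_inner_smul_left, h2, h2]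
    ring
  refine ⟨⟨hfan, ν ∘ e, hν⟩, ?_, ⟨ν ∘ e, hν, ?_⟩, ?_⟩
  · refine (he.isFirstFundamentalFormAt_iff hfan).2 ?_
    rw [he0]
    filter_upwards [hf.inner_zero_zero, hf.inner_zero_one, hf.inner_one_one, hco]
      with x h1 h2 h3 ⟨h4, h5, h6⟩ v w'
    rw [hg.inChart_eq, h4, h5, h6, fderiv_eq_pder, fderiv_eq_pder]
    simp only [inner_add_left, inner_add_right, real_inner_smul_left, real_inner_smul_right, h1, h2, h3]
    rw [real_inner_comm, h2]
    ring
  · filter_upwards [hf.normal_curvature, eventually_curve_eq (f ∘ e) hγ, hγ] with t h3 h4 h5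
    rw [normalCurvature, h4, h4, h5]
    exact h3
  · filter_upwards [hf.torsion_eq, eventually_curve_eq (f ∘ e) hγ] with t h3 h4
    rw [← h3, torsion, torsion, h4, h4, h4]

end

/-! ### The Gauss equation for the Euler form -/

lemma pder_pder_inner {F G : Plane → Space} {x : Plane} (hF : AnalyticAt ℝ F x)
    (hG : AnalyticAt ℝ G x) (m n : Fin 2) : pder m (pder n fun y => inner ℝ (F y) (G y)) x =
      inner ℝ (pder m (pder n F) x) (G x) + inner ℝ (pder n F x) (pder m G x) +
        (inner ℝ (pder m F x) (pder n G x) + inner ℝ (F x) (pder m (pder n G) x)) := by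
  have h : (pder n fun y => inner ℝ (F y) (G y)) =ᶠ[𝓝 x]
      fun y => inner ℝ (pder n F y) (G y) + inner ℝ (F y) (pder n G y) := by
    filter_upwards [hF.eventually_analyticAt, hG.eventually_analyticAt] with y h1 h2
    exact pder_inner n h1.differentiableAt h2.differentiableAt
  have d1 := hF.differentiableAt
  have d2 := hG.differentiableAt
  have d3 := (analyticAt_pder hF n).differentiableAt
  have d4 := (analyticAt_pder hG n).differentiableAt
  rw [pder_congr h, pder_add m (d3.inner ℝ d2) (d1.inner ℝ d4), pder_inner m d3 d2,
    pder_inner m d1 d4]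

/-- A product of two triple determinants is a Gram determinant. Applied with `P, Q = f_u, f_v` and
`A, B, C = f_uu, f_uv, f_vv`, the entries `⟨A, C⟩` and `⟨B, B⟩` have the same cofactor and merge
into a difference, which is intrinsic. -/
lemma gramDet_eq (P Q A B C : Space) :
    Matrix.det !![inner ℝ A C - inner ℝ B B, inner ℝ A P, inner ℝ A Q;
        inner ℝ P C, inner ℝ P P, inner ℝ P Q; inner ℝ C Q, inner ℝ P Q, inner ℝ Q Q] -
      Matrix.det !![0, inner ℝ B P, inner ℝ B Q;
        inner ℝ B P, inner ℝ P P, inner ℝ P Q; inner ℝ B Q, inner ℝ P Q, inner ℝ Q Q] =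
    inner ℝ A (cross P Q) * inner ℝ C (cross P Q) - inner ℝ B (cross P Q) ^ 2 := by
  simp only [Matrix.det_fin_three, inner_space, cross_apply_zero, cross_apply_one, cross_apply_two]
  simp
  ring

/-- Brioschi's formula computes the determinant of the (unnormalized) second fundamental form. -/
lemma gaussCurvature_mul {f : Plane → Space} {G : PlaneForm} {x : Plane} (hf : AnalyticAt ℝ f x)
    (hE : coeffE G =ᶠ[𝓝 x] fun y => inner ℝ (pder 0 f y) (pder 0 f y))
    (hF : coeffF G =ᶠ[𝓝 x] fun y => inner ℝ (pder 0 f y) (pder 1 f y))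
    (hH : coeffG G =ᶠ[𝓝 x] fun y => inner ℝ (pder 1 f y) (pder 1 f y)) (hd : discr G x ≠ 0) :
    gaussCurvature G x * discr G x ^ 2 =
      inner ℝ (pder 0 (pder 0 f) x) (cross (pder 0 f x) (pder 1 f x)) *
        inner ℝ (pder 1 (pder 1 f) x) (cross (pder 0 f x) (pder 1 f x)) -
      inner ℝ (pder 0 (pder 1 f) x) (cross (pder 0 f x) (pder 1 f x)) ^ 2 := by
  have hu := analyticAt_pder hf 0
  have hv := analyticAt_pder hf 1
  have du := hu.differentiableAt
  have dv := hv.differentiableAt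
  have hnn : ∀ {φ ψ : Plane → ℝ} (i j : Fin 2), φ =ᶠ[𝓝 x] ψ →
      pder i (pder j φ) x = pder i (pder j ψ) x := fun {φ ψ} i j h =>
    pder_congr (by filter_upwards [eventually_eventually_nhds.2 h] with y hy using pder_congr hy j) i
  -- The mixed derivatives are brought to a common order so that the third derivatives cancel in
  -- `-E_vv / 2 + F_uv - G_uu / 2`, leaving `⟨f_uu, f_vv⟩ - ⟨f_uv, f_uv⟩`.
  have c1 : pder 1 (pder 0 f) x = pder 0 (pder 1 f) x := pder_comm hf 1 0
  have c2 : pder 1 (pder 1 (pder 0 f)) x = pder 0 (pder 1 (pder 1 f)) x := by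
    have : pder 1 (pder 0 f) =ᶠ[𝓝 x] pder 0 (pder 1 f) := by
      filter_upwards [hf.eventually_analyticAt] with y hy using pder_comm hy 1 0
    rw [pder_congr this, pder_comm hv]
  have c3 : pder 0 (pder 1 (pder 0 f)) x = pder 0 (pder 0 (pder 1 f)) x := by
    have : pder 1 (pder 0 f) =ᶠ[𝓝 x] pder 0 (pder 1 f) := by
      filter_upwards [hf.eventually_analyticAt] with y hy using pder_comm hy 1 0
    rw [pder_congr this]
  rw [gaussCurvature, div_mul_cancel₀ _ (pow_ne_zero 2 hd), ← gramDet_eq]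
  simp only [hnn 1 1 hE, hnn 0 1 hF, hnn 0 0 hH, pder_congr hE, pder_congr hF, pder_congr hH,
    hE.self_of_nhds, hF.self_of_nhds, hH.self_of_nhds, pder_pder_inner hu hu, pder_pder_inner hu hv,
    pder_pder_inner hv hv, pder_inner _ du du, pder_inner _ du dv, pder_inner _ dv dv, c1, c2, c3]
  have hcomm : ∀ X Y : Space, inner ℝ X Y = inner ℝ Y X := fun X Y => real_inner_comm Y X
  simp only [hcomm (pder 0 f x) (pder 0 (pder 0 f) x), hcomm (pder 0 f x) (pder 0 (pder 1 f) x),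
    hcomm (pder 0 f x) (pder 1 (pder 1 f) x),
    hcomm (pder 1 f x) (pder 0 (pder 1 f) x), hcomm (pder 1 f x) (pder 1 (pder 1 f) x),
    hcomm (pder 0 f x) (pder 0 (pder 1 (pder 1 f)) x),
    hcomm (pder 1 f x) (pder 0 (pder 0 (pder 1 f)) x)]
  congr 1 <;> congr 1 <;> ext i j <;> fin_cases i <;> fin_cases j <;>
    simp [-inner_self_eq_norm_sq_to_K]
  ring

end KossowskiMetrics

namespace KossowskiMetrics

open Finset Filter

/-! ### The Gauss map at non-parabolic semi-definite points. -/

lemma cross_eq_smul_of_orthogonal {P Q n : Space} (hn : ‖n‖ = 1) (hP : inner ℝ P n = (0 : ℝ))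
    (hQ : inner ℝ Q n = (0 : ℝ)) : cross P Q = inner ℝ (cross P Q) n • n := by
  have hnn : inner ℝ n n = (1 : ℝ) := by rw [real_inner_self_eq_norm_sq, hn, one_pow]
  have h0 : cross n (cross P Q) = 0 := by
    rw [inner_space] at hP hQ
    ext i
    fin_cases i
    · change cross n (cross P Q) 0 = 0
      rw [cross_apply_zero, cross_apply_one, cross_apply_two]
      linear_combination P 0 * hQ - Q 0 * hP
    · change cross n (cross P Q) 1 = 0
      rw [cross_apply_one, cross_apply_zero, cross_apply_two]
      linear_combination P 1 * hQ - Q 1 * hP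
    · change cross n (cross P Q) 2 = 0
      rw [cross_apply_two, cross_apply_zero, cross_apply_one]
      linear_combination P 2 * hQ - Q 2 * hP
  have h1 := norm_cross_sq n (cross P Q)
  rw [h0, norm_zero, hnn, one_mul] at h1
  rw [← sub_eq_zero, ← norm_eq_zero, ← sq_eq_zero_iff, ← real_inner_self_eq_norm_sq]
  simp only [inner_sub_left, inner_sub_right, real_inner_smul_left, real_inner_smul_right, hnn]
  rw [real_inner_comm (cross P Q) n] at *
  linarith

/-- Weingarten's equations. -/
lemma inner_pder_pder {f ν : Plane → Space} {x : Plane} (hf : AnalyticAt ℝ f x)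
    (hν : DifferentiableAt ℝ ν x) (h : ∀ᶠ y in 𝓝 x, ∀ i, inner ℝ (pder i f y) (ν y) = 0)
    (i j : Fin 2) : inner ℝ (pder j (pder i f) x) (ν x) = -inner ℝ (pder i f x) (pder j ν x) := by
  have h1 : (fun y => inner ℝ (pder i f y) (ν y)) =ᶠ[𝓝 x] fun _ => (0 : ℝ) := by
    filter_upwards [h] with y hy using hy i
  have h2 := pder_congr h1 j
  rw [pder_inner j (analyticAt_pder hf i).differentiableAt hν, pder_const] at h2
  linarith

/-- The square of `Kλ` is the square of the density of the Gauss map. -/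
lemma gaussCurvature_sq {f ν : Plane → Space} {G : PlaneForm} {x : Plane} {c : ℝ}
    (hf : AnalyticAt ℝ f x) (hν : DifferentiableAt ℝ ν x) (hn : ‖ν x‖ = 1)
    (h : ∀ᶠ y in 𝓝 x, ∀ i, inner ℝ (pder i f y) (ν y) = 0)
    (hE : coeffE G =ᶠ[𝓝 x] fun y => inner ℝ (pder 0 f y) (pder 0 f y))
    (hF : coeffF G =ᶠ[𝓝 x] fun y => inner ℝ (pder 0 f y) (pder 1 f y))
    (hH : coeffG G =ᶠ[𝓝 x] fun y => inner ℝ (pder 1 f y) (pder 1 f y))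
    (hd : discr G x = c ^ 2) (hc : c ≠ 0) :
    (gaussCurvature G x * c) ^ 2 = inner ℝ (ν x) (cross (pder 0 ν x) (pder 1 ν x)) ^ 2 := by
  have h1 := gaussCurvature_mul hf hE hF hH (by rw [hd]; positivity)
  have h2 := inner_pder_pder hf hν h
  have h3 := cross_eq_smul_of_orthogonal hn (h.self_of_nhds 0) (h.self_of_nhds 1)
  have h4 := inner_cross_cross (pder 0 f x) (pder 1 f x) (pder 0 ν x) (pder 1 ν x)
  have h5 := norm_cross_sq (pder 0 f x) (pder 1 f x)
  have h6 : pder 1 (pder 0 f) x = pder 0 (pder 1 f) x := pder_comm hf 1 0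
  have h7 := h2 0 1
  rw [h6, h2 1 0] at h7
  rw [discr, hE.self_of_nhds, hF.self_of_nhds, hH.self_of_nhds] at hd
  set m := inner ℝ (cross (pder 0 f x) (pder 1 f x)) (ν x)
  rw [h3] at h1 h4 h5
  rw [norm_smul, hn, mul_one, Real.norm_eq_abs, sq_abs, hd] at h5
  simp only [real_inner_smul_right, h2] at h1
  rw [real_inner_smul_left] at h4
  rw [discr, hE.self_of_nhds, hF.self_of_nhds, hH.self_of_nhds, hd] at h1
  set ψ := inner ℝ (ν x) (cross (pder 0 ν x) (pder 1 ν x))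
  set K := gaussCurvature G x
  have hm : m ≠ 0 := by
    intro h0
    rw [h0] at h5
    exact hc (by simpa using h5.symm)
  have h8 : m ^ 3 * (K * m - ψ) = 0 := by
    rw [← h5] at h1
    linear_combination h1 - m ^ 2 * h4 + (m ^ 2 * inner ℝ (pder 1 f x) (pder 0 ν x)) * h7
  -- Here `m` is the area density measured with `ν`. Only `m² = c²` is known, so replacing `m` by
  -- `c` is possible only after squaring.
  have h9 : K * m = ψ := by
    have := (mul_eq_zero.1 h8).resolve_left (pow_ne_zero 3 hm)
    linarith
  rw [← h9, mul_pow, mul_pow, h5]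

section

variable {M : Type*} [TopologicalSpace M] [ChartedSpace Plane M]
  {e : OpenPartialHomeomorph M Plane} {p : M} {g : FormField M} {f ν : M → Space}

lemma IsChartAt.fderiv_eq_dmap (he : IsChartAt e p)
    (hf : ContMDiffAt 𝓘(ℝ, Plane) 𝓘(ℝ, Space) ω f p) (v : Plane) :
    fderiv ℝ (f ∘ e.symm) (e p) v = dmap f p (symmDeriv e (e p) v) := by
  have h1 := he.fderiv_eq (F := f) he.mem_target (by rwa [he.symm_apply]) v
  have h2 : ∀ {y : M}, y = p → ∀ v : Plane, dmap f y v = dmap f p v := by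
    rintro y rfl v
    rfl
  exact h1.trans (h2 he.symm_apply _)

lemma isImmersedAt_of_isRegularPoint (hfg : IsFirstFundamentalFormAt f g p)
    (hp : IsRegularPoint g p) : IsImmersedAt f p := by
  intro v w hvw
  by_contra hne
  have h1 := hp (v - w) (sub_ne_zero.2 hne)
  have h2 : dmap f p (v - w) = 0 := by
    have : dmap f p (v - w) = dmap f p v - dmap f p w :=
      map_sub (mfderiv 𝓘(ℝ, Plane) 𝓘(ℝ, Space) f p) v w
    rw [this, hvw, sub_self]
  rw [← hfg.self_of_nhds (v - w) (v - w), h2, inner_zero_left] at h1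
  exact lt_irrefl _ h1

lemma isWaveFrontAt_of_injective (hf : ContMDiffAt 𝓘(ℝ, Plane) 𝓘(ℝ, Space) ω f p)
    (hν : ContMDiffAt 𝓘(ℝ, Plane) 𝓘(ℝ, Space) ω ν p)
    (h : ∀ v : TangentSpace 𝓘(ℝ, Plane) p, dmap ν p v = 0 → v = 0) : IsWaveFrontAt f ν p := by
  have h1 : MDifferentiableAt 𝓘(ℝ, Plane) 𝓘(ℝ, Space × Space) (fun x => (f x, ν x)) p :=
    (hf.prodMk_space hν).mdifferentiableAt (by simp)
  have h2 := mfderiv_comp (I := 𝓘(ℝ, Plane)) (I' := 𝓘(ℝ, Space × Space)) (I'' := 𝓘(ℝ, Space)) p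
    (g := Prod.snd) differentiableAt_snd.mdifferentiableAt h1
  intro v w hvw
  rw [← sub_eq_zero]
  refine h _ ?_
  have h3 : ∀ v : TangentSpace 𝓘(ℝ, Plane) p, dmap ν p v = mfderiv 𝓘(ℝ, Space × Space) 𝓘(ℝ, Space)
      Prod.snd (f p, ν p) (mfderiv 𝓘(ℝ, Plane) 𝓘(ℝ, Space × Space) (fun x => (f x, ν x)) p v) :=
    fun v => congrArg (fun T : Plane →L[ℝ] Space => T v) h2
  have h4 : dmap ν p (v - w) = dmap ν p v - dmap ν p w := map_sub (mfderiv 𝓘(ℝ, Plane) 𝓘(ℝ, Space) ν p) v w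
  rw [h4, sub_eq_zero, h3, h3, hvw]

variable [IsManifold 𝓘(ℝ, Plane) ω M]

/-- At regular points the square of the Euler density equals that of the Gauss map. Such points
accumulate at `p`, since by `exists_density` the discriminant has a square root with nonzero
gradient at `p`, and continuity carries the equality to `p`. -/
lemma IsChartAt.inner_cross_ne_zero (hg : IsKossowskiMetric g) (he : IsChartAt e p)
    (hp : IsSemiDefinitePoint g p) (hf : ContMDiffAt 𝓘(ℝ, Plane) 𝓘(ℝ, Space) ω f p)
    (hfg : IsFirstFundamentalFormAt f g p) (hν : IsUnitNormalAt f ν p) {h : Plane → ℝ}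
    (hh : IsEulerDensityAt g e p h) (hh0 : h (e p) ≠ 0) :
    inner ℝ ((ν ∘ e.symm) (e p))
      (cross (pder 0 (ν ∘ e.symm) (e p)) (pder 1 (ν ∘ e.symm) (e p))) ≠ 0 := by
  obtain ⟨hhan, lam, -, hd, hK⟩ := hh
  have hfff := (he.isFirstFundamentalFormAt_iff hf).1 hfg
  obtain ⟨hνan, hν⟩ := (he.isUnitNormalAt_iff hf).1 hν
  have hfan := he.analyticAt hf
  replace hνan := he.analyticAt hνan
  set F := f ∘ e.symm
  set N := ν ∘ e.symm
  obtain ⟨lam', hlam', hd', hlam0, hlam1⟩ := he.exists_density hg hp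
  let ψ : Plane → ℝ := fun x => inner ℝ (N x) (cross (pder 0 N x) (pder 1 N x))
  have hψ : AnalyticAt ℝ ψ (e p) :=
    analyticAt_inner hνan (analyticAt_cross (analyticAt_pder hνan 0) (analyticAt_pder hνan 1))
  -- Frequent vanishing is enough: a continuous function that is nonzero at the point would be
  -- nonzero all around it.
  have hfreq : ∃ᶠ x in 𝓝 (e p), h x ^ 2 - ψ x ^ 2 = 0 := by
    have h0 : ∃ᶠ x in 𝓝 (e p), lam' x ≠ 0 := by
      have := not_eventually_eq_zero (Or.inr hlam1)
      rwa [not_eventually] at this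
    refine (h0.and_eventually (hd.and (hd'.and (hK.and (hfan.eventually_analyticAt.and
      (hνan.eventually_analyticAt.and (hν.eventually_nhds.and hfff.eventually_nhds))))))).mono ?_
    rintro x ⟨h1, h2, h3, h4, h5, h6, h7, h8⟩
    have hlx : lam x ≠ 0 := by
      intro h0
      rw [h2, h0] at h3
      exact h1 (by simpa using h3.symm)
    rw [h4 hlx, gaussCurvature_sq h5 h6.differentiableAt h7.self_of_nhds.1
      (h7.mono fun y hy i => hy.2 _) ?_ ?_ ?_ h2 hlx, sub_self]
    · exact h8.mono fun y hy => (hy _ _).symm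
    · exact h8.mono fun y hy => (hy _ _).symm
    · exact h8.mono fun y hy => (hy _ _).symm
  intro h0
  have hcont : ContinuousAt (fun x => h x ^ 2 - ψ x ^ 2) (e p) :=
    ((hhan.pow 2).sub (hψ.pow 2)).continuousAt
  have hne : h (e p) ^ 2 - ψ (e p) ^ 2 ≠ 0 := by
    have : ψ (e p) = 0 := h0
    rw [this]
    simpa using hh0
  exact hfreq (hcont.eventually_ne hne)

/-- At a non-parabolic semi-definite point, the normal is an immersion. -/
lemma injective_dmap_normal (hg : IsKossowskiMetric g) (hp : IsSemiDefinitePoint g p)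
    (hnp : IsNonParabolicAt g p) (hf : ContMDiffAt 𝓘(ℝ, Plane) 𝓘(ℝ, Space) ω f p)
    (hfg : IsFirstFundamentalFormAt f g p) (hν : IsUnitNormalAt f ν p) :
    ∀ v : TangentSpace 𝓘(ℝ, Plane) p, dmap ν p v = 0 → v = 0 := by
  obtain ⟨e, he, h, hh, hh0⟩ := hnp
  have h1 := he.inner_cross_ne_zero hg hp hf hfg hν hh hh0
  intro v hv
  obtain ⟨v', rfl⟩ := he.surjective_symmDeriv he.mem_target v
  have h2 : fderiv ℝ (ν ∘ e.symm) (e p) v' = 0 := (he.fderiv_eq_dmap hν.1 v').trans hv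
  rw [fderiv_eq_pder] at h2
  set a := pder 0 (ν ∘ e.symm) (e p)
  set b := pder 1 (ν ∘ e.symm) (e p)
  have hc := fun i : Fin 3 => congrArg (fun w : Space => w i) h2
  have k0 := hc 0
  have k1 := hc 1
  have k2 := hc 2
  simp only [PiLp.add_apply, PiLp.smul_apply, smul_eq_mul, PiLp.zero_apply] at k0 k1 k2
  rw [inner_space, cross_apply_zero, cross_apply_one, cross_apply_two] at h1
  set n := (ν ∘ e.symm) (e p)
  -- Cramer's rule: a linear relation between the two derivatives is paired with the normal and the
  -- other derivative.
  have e0 : v' 0 = 0 := by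
    refine (mul_eq_zero.1 ?_).resolve_right h1
    linear_combination (n 1 * b 2 * (-1) + n 2 * b 1) * k0 + (n 0 * b 2 - n 2 * b 0) * k1 +
      (n 1 * b 0 - n 0 * b 1) * k2
  have e1 : v' 1 = 0 := by
    refine (mul_eq_zero.1 ?_).resolve_right h1
    linear_combination (n 1 * a 2 - n 2 * a 1) * k0 + (n 2 * a 0 - n 0 * a 2) * k1 +
      (n 0 * a 1 - n 1 * a 0) * k2
  have : v' = 0 := by
    ext i
    fin_cases i
    · exact e0
    · exact e1
  rw [this]
  exact map_zero _

/-! ### The limiting normal curvature -/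

/-- A linear change of coordinates turns the null vector `v` into the second coordinate vector. -/
lemma exists_isAdjustedAt (hf : ContMDiffAt 𝓘(ℝ, Plane) 𝓘(ℝ, Space) ω f p)
    {v : TangentSpace 𝓘(ℝ, Plane) p} (hv : v ≠ 0) (hfv : dmap f p v = 0) :
    ∃ e : OpenPartialHomeomorph M Plane, IsAdjustedAt f e p := by
  let e₀ := chartAt Plane p
  have he₀ : IsChartAt e₀ p := ⟨IsManifold.chart_mem_maximalAtlas _, mem_chart_source _ _⟩
  obtain ⟨d, rfl⟩ := he₀.surjective_symmDeriv he₀.mem_target v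
  have hd : d 0 ^ 2 + d 1 ^ 2 ≠ 0 := by
    intro h
    apply hv
    have h0 : d 0 = 0 := by nlinarith [sq_nonneg (d 0), sq_nonneg (d 1)]
    have h1 : d 1 = 0 := by nlinarith [sq_nonneg (d 0), sq_nonneg (d 1)]
    have : d = 0 := by
      ext i
      fin_cases i
      · exact h0
      · exact h1
    rw [this]
    exact map_zero _
  let n : Plane := !₂[-d 1, d 0]
  let A : Plane →L[ℝ] Plane := (EuclideanSpace.proj 0 : Plane →L[ℝ] ℝ).smulRight n +
    (EuclideanSpace.proj 1 : Plane →L[ℝ] ℝ).smulRight d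
  have hA : ∀ w : Plane, A w = w 0 • n + w 1 • d := fun w => rfl
  have hinj : Function.Injective A := by
    rw [injective_iff_map_eq_zero]
    intro w hw
    rw [hA] at hw
    have hw0 : w 0 * (-d 1) + w 1 * d 0 = 0 := by
      simpa [n] using congrArg (fun w : Plane => w 0) hw
    have hw1 : w 0 * d 0 + w 1 * d 1 = 0 := by
      simpa [n] using congrArg (fun w : Plane => w 1) hw
    have k0 : w 0 * (d 0 ^ 2 + d 1 ^ 2) = 0 := by linear_combination d 0 * hw1 - d 1 * hw0
    have k1 : w 1 * (d 0 ^ 2 + d 1 ^ 2) = 0 := by linear_combination d 0 * hw0 + d 1 * hw1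
    ext i
    fin_cases i
    · exact (mul_eq_zero.1 k0).resolve_right hd
    · exact (mul_eq_zero.1 k1).resolve_right hd
  obtain ⟨y₀, hy₀⟩ := (LinearMap.injective_iff_surjective (f := A.toLinearMap)).1 hinj (e₀ p)
  replace hy₀ : A y₀ = e₀ p := hy₀
  obtain ⟨e₁, h0, h1, h2, h3⟩ := exists_local_inverse (A.analyticAt y₀)
    (by rw [ContinuousLinearMap.fderiv]; exact hinj)
  have he : IsChartAt (e₀.trans e₁.symm) p :=
    he₀.trans (by rw [← hy₀, ← h1]; exact e₁.map_source h0) h3 (by simpa using h2)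
  have hp : (e₀.trans e₁.symm) p = y₀ := by
    simp only [OpenPartialHomeomorph.coe_trans, Function.comp_apply]
    rw [← hy₀, ← h1]
    exact e₁.left_inv h0
  refine ⟨_, he, ?_⟩
  have hsymm : f ∘ (e₀.trans e₁.symm).symm = (f ∘ e₀.symm) ∘ A := by
    funext y
    simp [h1]
  have hfd : DifferentiableAt ℝ (f ∘ e₀.symm) (A y₀) := by
    rw [hy₀]
    exact (he₀.analyticAt hf).differentiableAt
  rw [hp, hsymm, pder, fderiv_comp y₀ hfd A.differentiableAt, ContinuousLinearMap.fderiv,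
    ContinuousLinearMap.comp_apply, hy₀]
  have hAd : A (coordVec 1) = d := by simp [hA, coordVec]
  rw [hAd, he₀.fderiv_eq_dmap hf]
  exact hfv

/-- The limiting normal curvature exists, and does not vanish if the normal is an immersion. -/
lemma exists_limitingNormalCurvature (hf : ContMDiffAt 𝓘(ℝ, Plane) 𝓘(ℝ, Space) ω f p)
    (hν : IsUnitNormalAt f ν p) {v u : TangentSpace 𝓘(ℝ, Plane) p} (hv : v ≠ 0)
    (hfv : dmap f p v = 0) (hfu : dmap f p u ≠ 0)
    (hinj : ∀ v : TangentSpace 𝓘(ℝ, Plane) p, dmap ν p v = 0 → v = 0) :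
    ∃ κ : ℝ, HasLimitingNormalCurvature f ν p κ ∧ κ ≠ 0 := by
  let Df : Plane →L[ℝ] Space := mfderiv 𝓘(ℝ, Plane) 𝓘(ℝ, Space) f p
  let Dn : Plane →L[ℝ] Space := mfderiv 𝓘(ℝ, Plane) 𝓘(ℝ, Space) ν p
  have hnorm : ‖ν p‖ = 1 := hν.2.self_of_nhds.1
  have hdecomp : ∀ {e : OpenPartialHomeomorph M Plane}, IsChartAt e p → ∀ w : Plane, ∃ α β : ℝ,
      w = α • symmDeriv e (e p) (coordVec 0) + β • symmDeriv e (e p) (coordVec 1) := by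
    intro e he w
    obtain ⟨w', rfl⟩ := he.surjective_symmDeriv he.mem_target w
    refine ⟨w' 0, w' 1, ?_⟩
    conv_lhs => rw [plane_eq_sum w']
    simp [Fin.sum_univ_two]
  have hchart : ∀ {e : OpenPartialHomeomorph M Plane}, IsChartAt e p → ∀ i j : Fin 2,
      inner ℝ (pder j (pder i (f ∘ e.symm)) (e p)) (ν p) =
        -inner ℝ (Df (symmDeriv e (e p) (coordVec i))) (Dn (symmDeriv e (e p) (coordVec j))) := by
    intro e he i j
    obtain ⟨hνan, hν'⟩ := (he.isUnitNormalAt_iff hf).1 hν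
    have h1 := inner_pder_pder (he.analyticAt hf) (he.analyticAt hνan).differentiableAt
      (hν'.mono fun y hy i => hy.2 _) i j
    have h2 : (ν ∘ e.symm) (e p) = ν p := by simp [he.symm_apply]
    rw [h2] at h1
    rw [h1, pder, pder, he.fderiv_eq_dmap hf, he.fderiv_eq_dmap hνan]
    rfl
  have hpd : ∀ {e : OpenPartialHomeomorph M Plane}, IsChartAt e p → ∀ i : Fin 2,
      pder i (f ∘ e.symm) (e p) = Df (symmDeriv e (e p) (coordVec i)) := by
    intro e he i
    rw [pder, he.fderiv_eq_dmap hf]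
    rfl
  have hne : ∀ {e : OpenPartialHomeomorph M Plane}, IsAdjustedAt f e p →
      Df (symmDeriv e (e p) (coordVec 1)) = 0 ∧ Df (symmDeriv e (e p) (coordVec 0)) ≠ 0 := by
    intro e he
    have h1 : Df (symmDeriv e (e p) (coordVec 1)) = 0 := by rw [← hpd he.1, he.2]
    refine ⟨h1, fun h0 => hfu ?_⟩
    obtain ⟨α, β, hu⟩ := hdecomp he.1 u
    change Df u = 0
    rw [hu, map_add, map_smul, map_smul, h0, h1]
    simp
  obtain ⟨e₀, he₀⟩ := exists_isAdjustedAt hf hv hfv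
  obtain ⟨hV, hX⟩ := hne he₀
  set X := symmDeriv e₀ (e₀ p) (coordVec 0) with hXdef
  set V := symmDeriv e₀ (e₀ p) (coordVec 1) with hVdef
  -- By symmetry of the second derivatives this equals `⟨df V, dν X⟩`, and `df V = 0`.
  have hsymm : inner ℝ (Df X) (Dn V) = (0 : ℝ) := by
    have h1 := hchart he₀.1 0 1
    rw [pder_comm (he₀.1.analyticAt hf), hchart he₀.1 1 0, ← hVdef, hV, inner_zero_left] at h1
    linarith
  refine ⟨-inner ℝ (Df X) (Dn X) / ‖Df X‖ ^ 2, ⟨⟨e₀, he₀⟩, fun e he => ?_⟩, ?_⟩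
  · obtain ⟨-, hX'⟩ := hne he
    rw [hchart he.1, hpd he.1]
    -- Another adjusted chart replaces `X` by `α X + β V`. The `V` part disappears by `hV` and
    -- `hsymm`, and numerator and denominator both scale by `α²`.
    obtain ⟨α, β, hw⟩ := hdecomp he₀.1 (symmDeriv e (e p) (coordVec 0))
    have h1 : Df (symmDeriv e (e p) (coordVec 0)) = α • Df X := by
      rw [hw, map_add, map_smul, map_smul, ← hVdef, hV, smul_zero, add_zero]
    have h2 : Dn (symmDeriv e (e p) (coordVec 0)) = α • Dn X + β • Dn V := by
      rw [hw, map_add, map_smul, map_smul]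
    rw [h1] at hX'
    have hα : α ≠ 0 := by
      rintro rfl
      simp at hX'
    have hXn : ‖Df X‖ ≠ 0 := norm_ne_zero_iff.2 hX
    rw [h1, h2, inner_add_right, real_inner_smul_left, real_inner_smul_left, real_inner_smul_right,
      real_inner_smul_right, hsymm, norm_smul, mul_pow, Real.norm_eq_abs, sq_abs]
    field_simp
    ring
  -- If the limiting normal curvature were zero, `dν X` and `dν V` would both be orthogonal to `df
  -- X` and to `ν`, hence proportional, contradicting the injectivity of `dν`.
  · intro h0
    have hXn : ‖Df X‖ ≠ 0 := norm_ne_zero_iff.2 hX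
    have h1 : inner ℝ (Df X) (Dn X) = (0 : ℝ) := by
      have := (div_eq_zero_iff.1 h0).resolve_right (pow_ne_zero 2 hXn)
      linarith
    obtain ⟨hνan, hν'⟩ := (he₀.1.isUnitNormalAt_iff hf).1 hν
    have hnan := he₀.1.analyticAt hνan
    have hper : ∀ i : Fin 2, inner ℝ (Dn (symmDeriv e₀ (e₀ p) (coordVec i))) (ν p) = (0 : ℝ) := by
      intro i
      have h2 : (fun x => inner ℝ ((ν ∘ e₀.symm) x) ((ν ∘ e₀.symm) x)) =ᶠ[𝓝 (e₀ p)]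
          fun _ => (1 : ℝ) := by
        filter_upwards [hν'] with x hx
        rw [real_inner_self_eq_norm_sq, hx.1, one_pow]
      have h3 := pder_congr h2 i
      have h4 : (ν ∘ e₀.symm) (e₀ p) = ν p := by simp [he₀.1.symm_apply]
      have h5 : pder i (ν ∘ e₀.symm) (e₀ p) = Dn (symmDeriv e₀ (e₀ p) (coordVec i)) := by
        rw [pder, he₀.1.fderiv_eq_dmap hνan]
        rfl
      rw [pder_inner i hnan.differentiableAt hnan.differentiableAt, pder_const, h4, h5,
        real_inner_comm _ (ν p)] at h3
      linarith
    have hfν : inner ℝ (Df X) (ν p) = (0 : ℝ) := hν.2.self_of_nhds.2 X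
    let y : Space := ‖Df X‖⁻¹ • Df X
    have hyy : inner ℝ y y = (1 : ℝ) := by
      rw [real_inner_smul_left, real_inner_smul_right, real_inner_self_eq_norm_sq]
      field_simp
    have hνν : inner ℝ (ν p) (ν p) = (1 : ℝ) := by rw [real_inner_self_eq_norm_sq, hnorm, one_pow]
    have hyν : inner ℝ y (ν p) = (0 : ℝ) := by
      simp only [y]
      rw [real_inner_smul_left, hfν, mul_zero]
    have hX2 := eq_inner_smul_cross hyy hνν hyν (v := Dn X) (by
      simp only [y]
      rw [real_inner_smul_right, real_inner_comm, h1, mul_zero]) (hper 0)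
    have hV2 := eq_inner_smul_cross hyy hνν hyν (v := Dn V) (by
      simp only [y]
      rw [real_inner_smul_right, real_inner_comm, hsymm, mul_zero]) (hper 1)
    set a := inner ℝ (Dn X) (cross y (ν p))
    set b := inner ℝ (Dn V) (cross y (ν p))
    have hlin : ∀ w : Plane, Dn w = 0 → w = 0 := hinj
    have h6 : b • X - a • V = 0 := hlin _ (by
      rw [map_sub, map_smul, map_smul, hX2, hV2, smul_smul, smul_smul, mul_comm, sub_self])
    have h7 : symmDeriv e₀ (e₀ p) (b • coordVec 0 - a • coordVec 1) = 0 := by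
      rw [map_sub, map_smul, map_smul]
      exact h6
    have h8 : b • coordVec 0 - a • coordVec 1 = 0 :=
      he₀.1.injective_symmDeriv he₀.1.mem_target (by rw [h7, map_zero])
    have ha : a = 0 := by
      have := congrArg (fun w : Plane => w 1) h8
      simpa [coordVec] using this
    have h9 : X = 0 := hlin X (by rw [hX2, ha, zero_smul])
    exact hX (by rw [h9, map_zero])

/-- The properties of a frontal germ at a non-parabolic semi-definite point. -/
lemma isWaveFrontAt_of_isNonParabolicAt (hg : IsKossowskiMetric g) (hp : IsSemiDefinitePoint g p)
    (hnp : IsNonParabolicAt g p) (hf : ContMDiffAt 𝓘(ℝ, Plane) 𝓘(ℝ, Space) ω f p)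
    (hfg : IsFirstFundamentalFormAt f g p) (hν : IsUnitNormalAt f ν p)
    {u : TangentSpace 𝓘(ℝ, Plane) p} (hu : 0 < g p u u) :
    IsWaveFrontAt f ν p ∧ ∃ κ : ℝ, HasLimitingNormalCurvature f ν p κ ∧ κ ≠ 0 := by
  have hinj := injective_dmap_normal hg hp hnp hf hfg hν
  refine ⟨isWaveFrontAt_of_injective hf hν.1 hinj, ?_⟩
  have hex : ∃ v : TangentSpace 𝓘(ℝ, Plane) p, v ≠ 0 ∧ ¬ 0 < g p v v := by
    by_contra! H
    exact hp H
  obtain ⟨v, hv, hgv⟩ := hex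
  have hfv : dmap f p v = 0 := by
    have h1 : inner ℝ (dmap f p v) (dmap f p v) = (0 : ℝ) :=
      (hfg.self_of_nhds v v).trans (le_antisymm (not_lt.1 hgv) (hg.nonneg p v))
    exact inner_self_eq_zero.1 h1
  have hfu : dmap f p u ≠ 0 := by
    intro h0
    rw [← hfg.self_of_nhds u u, h0, inner_zero_left] at hu
    exact lt_irrefl _ hu
  exact exists_limitingNormalCurvature hf hν hv hfv hfu hinj

end

end KossowskiMetrics

namespace KossowskiMetrics

open Finset Filter

section

variable {M : Type*} [TopologicalSpace M] [ChartedSpace Plane M]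

/-! ### Assembly of the theorem. -/

lemma IsChartAt.coeffE_pos {e : OpenPartialHomeomorph M Plane} {g : FormField M} {γ : ℝ → M}
    (he : IsChartAt e (γ 0)) (he0 : e (γ 0) = 0) (hγ : ∀ᶠ t in 𝓝 0, γ t = e.symm (axisPt t))
    (hγ' : 0 < g (γ 0) (mfderiv 𝓘(ℝ, ℝ) 𝓘(ℝ, Plane) γ 0 (1 : ℝ))
      (mfderiv 𝓘(ℝ, ℝ) 𝓘(ℝ, Plane) γ 0 (1 : ℝ))) : 0 < coeffE (inChart g e) 0 := by
  have hax : HasDerivAt axisPt (coordVec 0) 0 := by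
    simp only [funext axisPt_eq]
    simpa using (hasDerivAt_id (0 : ℝ)).smul_const (coordVec 0)
  have h0 : e.symm (axisPt 0) = γ 0 := by rw [axisPt_zero, ← he0, he.symm_apply]
  have h1 := mfderiv_comp (I := 𝓘(ℝ, ℝ)) (I' := 𝓘(ℝ, Plane)) (I'' := 𝓘(ℝ, Plane)) (0 : ℝ)
    ((he.contMDiffAt_symm (by rw [axisPt_zero, ← he0]; exact he.mem_target)).mdifferentiableAt
      (by simp) : MDifferentiableAt 𝓘(ℝ, Plane) 𝓘(ℝ, Plane) e.symm (axisPt 0))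
    hax.differentiableAt.mdifferentiableAt
  have h2 : γ =ᶠ[𝓝 0] e.symm ∘ axisPt := hγ
  rw [← h2.mfderiv_eq] at h1
  have h3 : ∀ v : Plane, v = mfderiv 𝓘(ℝ, ℝ) 𝓘(ℝ, Plane) γ 0 (1 : ℝ) →
      v = symmDeriv e 0 (coordVec 0) := by
    rintro v rfl
    refine (congrArg (fun T : ℝ →L[ℝ] Plane => T 1) h1).trans ?_
    change symmDeriv e (axisPt 0) (mfderiv 𝓘(ℝ, ℝ) 𝓘(ℝ, Plane) axisPt 0 (1 : ℝ)) = _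
    have h4 : mfderiv 𝓘(ℝ, ℝ) 𝓘(ℝ, Plane) axisPt 0 (1 : ℝ) = coordVec 0 := by
      rw [mfderiv_eq_fderiv]
      exact hax.deriv
    rw [h4, axisPt_zero]
  have hpt : ∀ {y y' : M}, y = y' → ∀ v w : Plane, g y v w = g y' v w := by
    rintro y _ rfl v w
    rfl
  have h5 := h3 _ rfl
  have h6 : g (γ 0) (mfderiv 𝓘(ℝ, ℝ) 𝓘(ℝ, Plane) γ 0 (1 : ℝ))
      (mfderiv 𝓘(ℝ, ℝ) 𝓘(ℝ, Plane) γ 0 (1 : ℝ)) = coeffE (inChart g e) 0 := by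
    refine (congrArg₂ (fun v w : Plane => g (γ 0) v w) h5 h5).trans ?_
    refine hpt ?_ _ _
    rw [← h0, axisPt_zero]
  rwa [← h6]

lemma StronglyCongruentAt.congruentAt {p : M} {f₁ f₂ : M → Space}
    (h : StronglyCongruentAt p f₁ f₂) : CongruentAt p f₁ f₂ := by
  obtain ⟨Φ, hΦ⟩ := h
  exact ⟨Φ, id, rfl, (Diffeomorph.refl 𝓘(ℝ, Plane) M ω).isLocalDiffeomorph p, hΦ⟩

variable [IsManifold 𝓘(ℝ, Plane) ω M]

/-- The realizations of a Kossowski metric: there are two of them, to one of which every realization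
is strongly congruent. -/
theorem exists_realizations {g : FormField M} (hg : IsKossowskiMetric g) {w μ : ℝ → ℝ}
    (hw : AnalyticAt ℝ w 0) (hμ : AnalyticAt ℝ μ 0) {γ : ℝ → M}
    (hγ : ContMDiffAt 𝓘(ℝ, ℝ) 𝓘(ℝ, Plane) ω γ 0)
    (hγ' : 0 < g (γ 0) (mfderiv 𝓘(ℝ, ℝ) 𝓘(ℝ, Plane) γ 0 (1 : ℝ))
      (mfderiv 𝓘(ℝ, ℝ) 𝓘(ℝ, Plane) γ 0 (1 : ℝ))) :
    (∃ f₁ f₂ : M → Space, IsRealization g (γ 0) γ w μ f₁ ∧ IsRealization g (γ 0) γ w μ f₂ ∧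
      ∀ f : M → Space, IsRealization g (γ 0) γ w μ f →
        StronglyCongruentAt (γ 0) f f₁ ∨ StronglyCongruentAt (γ 0) f f₂) ∧
    ((∀ᶠ t in 𝓝 (0 : ℝ), μ t = 0) → ∀ f f' : M → Space, IsRealization g (γ 0) γ w μ f →
      IsRealization g (γ 0) γ w μ f' → StronglyCongruentAt (γ 0) f f') := by
  have hne : mfderiv 𝓘(ℝ, ℝ) 𝓘(ℝ, Plane) γ 0 (1 : ℝ) ≠ 0 := by
    intro h0
    rw [h0] at hγ'
    simp at hγ'
  obtain ⟨e, he, he0, hγe⟩ := exists_chart_along hγ hne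
  obtain ⟨s, q, l, a, hcof, hco⟩ := he.exists_isCoframe hg he0 (he.coeffE_pos he0 hγe hγ')
  have hframe : ∀ f : M → Space, IsRealization g (γ 0) γ w μ f → ∃ E : Fin 3 → Plane → Space,
      IsAdapted s q l (f ∘ e.symm) E ∧ IsPlanarRealization s q l w μ (f ∘ e.symm) (E 2) := by
    intro f hf
    obtain ⟨ν, hν⟩ := hf.exists_isPlanarRealization he he0 hγe hco
    obtain ⟨E, hE, hE2⟩ := hν.exists_frame hcof
    exact ⟨E, hE, hE2 ▸ hν⟩
  have hback : ∀ {f f' : M → Space} {Φ : Space ≃ᵢ Space},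
      f' ∘ e.symm =ᶠ[𝓝 0] Φ ∘ f ∘ e.symm → StronglyCongruentAt (γ 0) f' f := by
    intro f f' Φ h
    refine ⟨Φ, he.eventually_iff.2 ?_⟩
    rw [he0]
    exact h
  constructor
  -- The two representatives have frames of determinant `1` and `-1`. The frame of an arbitrary
  -- realization has one of these determinants, and its sign selects the representative.
  · obtain ⟨F₁, E₁, hE₁, hd₁, hF₁⟩ := exists_isPlanarRealization hcof hw hμ (one_pow 2)
    obtain ⟨F₂, E₂, hE₂, hd₂, hF₂⟩ := exists_isPlanarRealization hcof hw hμ (σ := -1) (by norm_num)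
    have hright : ∀ F : Plane → Space, (F ∘ e) ∘ e.symm =ᶠ[𝓝 0] F := by
      intro F
      filter_upwards [e.open_target.mem_nhds (he0 ▸ he.mem_target : (0 : Plane) ∈ e.target)]
        with x hx
      simp [e.right_inv hx]
    refine ⟨F₁ ∘ e, F₂ ∘ e, hF₁.isRealization hg he he0 hγe hco,
      hF₂.isRealization hg he he0 hγe hco, fun f hf => ?_⟩
    obtain ⟨E, hE, hfE⟩ := hframe f hf
    rcases mul_self_eq_one_iff.1 (by rw [← sq, det3_sq_of_orthonormal hE.orthonormal.self_of_nhds] :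
      _ * (det3 fun i => E i 0) = 1) with h | h
    · obtain ⟨Φ, hΦ⟩ := hE₁.congruent_of_realization hcof hw hE hF₁ hfE (Or.inl (hd₁.trans h.symm))
      refine Or.inl (hback (Φ := Φ) (hΦ.trans ?_))
      filter_upwards [hright F₁] with x hx
      exact congrArg Φ hx.symm
    · obtain ⟨Φ, hΦ⟩ := hE₂.congruent_of_realization hcof hw hE hF₂ hfE (Or.inl (hd₂.trans h.symm))
      refine Or.inr (hback (Φ := Φ) (hΦ.trans ?_))
      filter_upwards [hright F₂] with x hx
      exact congrArg Φ hx.symm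
  · intro h0 f f' hf hf'
    obtain ⟨E, hE, hfE⟩ := hframe f hf
    obtain ⟨E', hE', hfE'⟩ := hframe f' hf'
    obtain ⟨Φ, hΦ⟩ := hE'.congruent_of_realization hcof hw hE hfE' hfE (Or.inr h0)
    exact hback hΦ

end

end KossowskiMetrics

theorem theoremB {M : Type*} [TopologicalSpace M] [ChartedSpace Plane M]
    [IsManifold 𝓘(ℝ, Plane) ω M]
    (g : FormField M) (hg : IsKossowskiMetric g)
    (w μ : ℝ → ℝ) (hw : AnalyticAt ℝ w 0) (hμ : AnalyticAt ℝ μ 0)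
    (p : M) (γ : ℝ → M) (hγ : ContMDiffAt 𝓘(ℝ, ℝ) 𝓘(ℝ, Plane) ω γ 0) (hγp : γ 0 = p)
    (hγ' : 0 < g (γ 0) (mfderiv 𝓘(ℝ, ℝ) 𝓘(ℝ, Plane) γ 0 (1 : ℝ))
      (mfderiv 𝓘(ℝ, ℝ) 𝓘(ℝ, Plane) γ 0 (1 : ℝ))) :
    -- existence, with all the listed properties
    (∃ f : M → Space, IsRealization g p γ w μ f) ∧
    (∀ f : M → Space, IsRealization g p γ w μ f →
      (IsRegularPoint g p → IsImmersedAt f p) ∧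
      (IsSemiDefinitePoint g p → IsNonParabolicAt g p →
        ∀ ν : M → Space, IsUnitNormalAt f ν p →
          IsWaveFrontAt f ν p ∧ ∃ κ : ℝ, HasLimitingNormalCurvature f ν p κ ∧ κ ≠ 0)) ∧
    -- at most two strong congruence classes, and at most two congruence classes
    (∃ f₁ f₂ : M → Space, IsRealization g p γ w μ f₁ ∧ IsRealization g p γ w μ f₂ ∧
      ∀ f : M → Space, IsRealization g p γ w μ f →
        StronglyCongruentAt p f f₁ ∨ StronglyCongruentAt p f f₂) ∧
    (∃ f₁ f₂ : M → Space, IsRealization g p γ w μ f₁ ∧ IsRealization g p γ w μ f₂ ∧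
      ∀ f : M → Space, IsRealization g p γ w μ f → CongruentAt p f f₁ ∨ CongruentAt p f f₂) ∧
    -- exactly one class if the torsion vanishes identically
    ((∀ᶠ t in 𝓝 (0 : ℝ), μ t = 0) →
      ∀ f f' : M → Space, IsRealization g p γ w μ f → IsRealization g p γ w μ f' →
        StronglyCongruentAt p f f' ∧ CongruentAt p f f') := by
  subst hγp
  obtain ⟨⟨f₁, f₂, h₁, h₂, h⟩, h0⟩ := exists_realizations hg hw hμ hγ hγ'
  refine ⟨⟨f₁, h₁⟩, fun f hf => ⟨isImmersedAt_of_isRegularPoint hf.isometric, fun hp hnp ν hν =>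
      isWaveFrontAt_of_isNonParabolicAt hg hp hnp hf.frontal.1 hf.isometric hν hγ'⟩,
    ⟨f₁, f₂, h₁, h₂, h⟩, ⟨f₁, f₂, h₁, h₂, fun f hf =>
      (h f hf).imp StronglyCongruentAt.congruentAt StronglyCongruentAt.congruentAt⟩,
    fun hμ0 f f' hf hf' => ⟨h0 hμ0 f f' hf hf', (h0 hμ0 f f' hf hf').congruentAt⟩⟩
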